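/- For $m\in\mathbb{R}$ let $X_m:=L_1\big((0,\infty),x^m\,\mathrm{d}x\big)$ (complex-valued functions), and for a non-empty interval $I\subset\mathbb{R}$ let $\mathsf{X}_I:=\bigcap_{r\in I}X_r$. For $(\alpha,a,b)\in\mathbb{R}^3$ consider the differential operator $$\mathcal{A}_\alpha(a,b)f(x):=x^\alpha\Big(f''(x)+\frac{a}{x}f'(x)+\frac{b}{x^2}f(x)\Big),\qquad x>0,$$ understood in the sense of distributions on $(0,\infty)$. **Theorem (singular case).** Let $\alpha<2$ and let $(a,b)\in\mathbb{R}^2$ be such that $D:=(a-1)^2-4b>0$. Set $$n_*:=\frac{a-3-\sqrt{D}}{2},\qquad n_*^\pm:=\frac{1-2\alpha+a\pm\sqrt{D}}{2},$$ and let $n\in(n_*,n_*^+]$. Define $\mathbb{A}_nf:=\mathcal{A}_\alpha(a,b)f$ for $f\in\mathrm{dom}(\mathbb{A}_n)$, where * (c1) if $n_*<n\le n_*^-$, then $\mathrm{dom}(\mathbb{A}_n)=\{f\in\mathsf{X}_{(n_*,n]} : \mathcal{A}_\alpha(a,b)f\in X_n\}$; * (c2) if $n_*^-<n<n_*^+$,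 then $\mathrm{dom}(\mathbb{A}_n)=\{f\in\mathsf{X}_{[n-2+\alpha,n]} : \mathcal{A}_\alpha(a,b)f\in X_n\}$; * (c3) if $n=n_*^+$, then $\mathrm{dom}(\mathbb{A}_n)=\{f\in\mathsf{X}_{(n-2+\alpha,n]} : \mathcal{A}_\alpha(a,b)f\in X_n \text{ and } \lim_{x\to0}x^{(a+\sqrt{D}-1)/2}f(x)=0\}$, where $f$ denotes the continuous representative on $(0,\infty)$. Then $\mathbb{A}_n$ is the infinitesimal generator of a bounded and positive analytic semigroup on $X_n$ of angle $\pi/2$ (that is, of a semigroup $(T(z))$, $z\in\{|\arg z|<\pi/2\}\cup\{0\}$, analytic in the open sector $\{|\arg z|<\pi/2\}$, strongly continuous at $0$ and uniformly bounded on each smaller sector $\{|\arg z|<\varepsilon\}$, $0<\varepsilon<\pi/2$, such that $T(t)$ maps nonnegative functions to nonnegative functions for all $t\ge0$). This semigroup is a semigroup of contractions, $\|T(t)\|\le1$ for all $t\ge0$, when $n\in(n_*^-,n_*^+]$. -/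

import Mathlib

open MeasureTheory Set Filter Topology TopologicalSpace
open scoped Distributions ContDiff

noncomputable section

namespace SingularOp

/-! ### Analytic semigroups and their generators on a complex Banach space -/

section Semigroup

variable {E : Type*} [NormedAddCommGroup E] [NormedSpace ℂ E]

/-- The open sector `{z ≠ 0 : |arg z| < δ}` in the complex plane. -/
def sector (δ : ℝ) : Set ℂ := {z | z ≠ 0 ∧ |Complex.arg z| < δ}

/-- `T` is a bounded analytic semigroup of angle `δ ∈ (0, π/2]`: the family `T z`, for `z` in the
open sector of half-angle `δ` together with `0`, satisfies `T 0 = 1` and the semigroup law, is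
analytic (for the operator norm) in the open sector, and, on every strictly smaller sector, is
strongly continuous at `0` and uniformly bounded. -/
structure IsBoundedAnalyticSemigroup (δ : ℝ) (T : ℂ → E →L[ℂ] E) : Prop where
  map_zero : T 0 = 1
  map_add : ∀ z ∈ sector δ, ∀ w ∈ sector δ, T (z + w) = T z * T w
  analytic : DifferentiableOn ℂ T (sector δ)
  tendsto_zero : ∀ ε : ℝ, 0 < ε → ε < δ → ∀ f : E,
    Tendsto (fun z : ℂ => T z f) (𝓝[sector ε] 0) (𝓝 f)
  bounded : ∀ ε : ℝ, 0 < ε → ε < δ → ∃ C : ℝ, ∀ z ∈ sector ε, ‖T z‖ ≤ C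

/-- The graph of the infinitesimal generator: the pairs `(f, g)` such that
`(T t f - f) / t` converges to `g` as `t → 0`, `t > 0`. -/
def generatorGraph (T : ℂ → E →L[ℂ] E) : Submodule ℂ (E × E) where
  carrier := {p | Tendsto (fun t : ℝ => ((t : ℂ)⁻¹) • (T (t : ℂ) p.1 - p.1)) (𝓝[>] 0) (𝓝 p.2)}
  zero_mem' := by simp
  add_mem' := by
    intro p q hp hq
    refine (Tendsto.add hp hq).congr fun t => ?_
    simp only [Prod.fst_add, map_add, ← smul_add]
    congr 1
    abel
  smul_mem' := by
    intro c p hp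
    refine (Tendsto.const_smul hp c).congr fun t => ?_
    simp only [Prod.smul_fst, map_smul, ← smul_sub]
    exact smul_comm _ _ _

/-- The infinitesimal generator of the semigroup `T`, as an unbounded operator: its domain is the
set of all `f` for which the limit of `(T t f - f) / t` as `t → 0+` exists, and its value is
that limit. -/
def generator (T : ℂ → E →L[ℂ] E) : E →ₗ.[ℂ] E := (generatorGraph T).toLinearPMap

theorem generator_graph (T : ℂ → E →L[ℂ] E) : (generator T).graph = generatorGraph T := by
  refine Submodule.toLinearPMap_graph_eq _ ?_
  rintro ⟨f, g⟩ h h0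
  simp only at h0
  subst h0
  have h' : Tendsto (fun t : ℝ => ((t : ℂ)⁻¹) • (T (t : ℂ) (0 : E) - 0)) (𝓝[>] 0) (𝓝 g) := h
  simp only [map_zero, sub_zero, smul_zero] at h'
  exact (tendsto_nhds_unique h' tendsto_const_nhds)

end Semigroup

/-! ### The weighted spaces `X_m = L₁((0,∞), x^m dx)` -/

/-- The measure `x^m dx` on `(0,∞)`. -/
def wMeasure (m : ℝ) : Measure ℝ :=
  (volume.restrict (Ioi 0)).withDensity fun x => ENNReal.ofReal (x ^ m)

/-- The space `X_m = L₁((0,∞), x^m dx)` of complex-valued functions. -/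
abbrev X (m : ℝ) : Type := Lp ℂ 1 (wMeasure m)

/-- `f` belongs to the intersection of the spaces `X_r`, `r ∈ I`. -/
def MemXInter (I : Set ℝ) (f : ℝ → ℂ) : Prop := ∀ r ∈ I, Integrable f (wMeasure r)

/-- An operator on `X_m` is positive if it maps nonnegative functions to nonnegative functions. -/
def IsPositiveOp {m : ℝ} (S : X m →L[ℂ] X m) : Prop :=
  ∀ f : X m, (∀ᵐ x ∂(wMeasure m), 0 ≤ (f x).re ∧ (f x).im = 0) →
    ∀ᵐ x ∂(wMeasure m), 0 ≤ (S f x).re ∧ (S f x).im = 0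

/-! ### The differential operator `x^α (f'' + (a/x) f' + (b/x²) f)` in the sense of
distributions -/

/-- The open half-line `(0,∞)`. -/
def halfLine : Opens ℝ := ⟨Ioi 0, isOpen_Ioi⟩

/-- The formal adjoint
`φ ↦ (x^α φ)'' - a (x^(α-1) φ)' + b x^(α-2) φ` of
`f ↦ x^α f'' + a x^(α-1) f' + b x^(α-2) f`. -/
def formalAdjoint (α a b : ℝ) (φ : ℝ → ℝ) (x : ℝ) : ℝ :=
  deriv (deriv fun y => y ^ α * φ y) x - a * deriv (fun y => y ^ (α - 1) * φ y) x
    + b * (x ^ (α - 2) * φ x)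

/-- `g = x^α (f'' + (a/x) f' + (b/x²) f)` in the sense of distributions on `(0,∞)`. -/
def HasDistribOp (α a b : ℝ) (f g : ℝ → ℂ) : Prop :=
  ∀ φ : 𝓓(halfLine, ℝ),
    ∫ x in Ioi (0 : ℝ), formalAdjoint α a b φ x • f x = ∫ x in Ioi (0 : ℝ), φ x • g x

/-- The continuous representative of `f` on `(0,∞)` exists and, multiplied by `x^s`, tends to `0`
as `x → 0`. -/
def VanishesAtZero (s : ℝ) (f : ℝ → ℂ) : Prop :=
  ∃ h : ℝ → ℂ, ContinuousOn h (Ioi 0) ∧ f =ᵐ[volume.restrict (Ioi 0)] h ∧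
    Tendsto (fun x : ℝ => (x ^ s) • h x) (𝓝[>] 0) (𝓝 0)

/-- The discriminant `D = (a-1)² - 4b`. -/
def disc (a b : ℝ) : ℝ := (a - 1) ^ 2 - 4 * b

/-- `n_* = (a - 3 - √D) / 2`. -/
def nStar (a b : ℝ) : ℝ := (a - 3 - √(disc a b)) / 2

/-- `n_*^- = (1 - 2α + a - √D) / 2`. -/
def nStarMinus (α a b : ℝ) : ℝ := (1 - 2 * α + a - √(disc a b)) / 2

/-- `n_*^+ = (1 - 2α + a + √D) / 2`. -/
def nStarPlus (α a b : ℝ) : ℝ := (1 - 2 * α + a + √(disc a b)) / 2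

/-- The conditions, in the three cases `n ≤ n_*^-`, `n_*^- < n < n_*^+` and `n = n_*^+`, which a
function `f ∈ X_n` with `x^α (f'' + (a/x) f' + (b/x²) f) ∈ X_n` has to satisfy in order to belong
to the domain of the operator. -/
structure DomainCond (α a b n : ℝ) (f : ℝ → ℂ) : Prop where
  case1 : n ≤ nStarMinus α a b → MemXInter (Ioc (nStar a b) n) f
  case2 : nStarMinus α a b < n → n < nStarPlus α a b → MemXInter (Icc (n - 2 + α) n) f
  case3 : n = nStarPlus α a b → MemXInter (Ioc (n - 2 + α) n) f ∧
    VanishesAtZero ((a + √(disc a b) - 1) / 2) f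

/-! Auxiliary facts: the measures `x^m dx` have the same null sets, and elements of `X_m` can be
integrated against test functions. -/

theorem ae_wMeasure_iff {m : ℝ} {p : ℝ → Prop} :
    (∀ᵐ x ∂(wMeasure m), p x) ↔ ∀ᵐ x ∂(volume.restrict (Ioi (0 : ℝ))), p x := by
  unfold wMeasure
  rw [ae_withDensity_iff (by fun_prop)]
  constructor
  · intro h
    filter_upwards [h, ae_restrict_mem measurableSet_Ioi] with x hx hx0
    exact hx (by simpa using Real.rpow_pos_of_pos hx0 m)
  · intro h
    filter_upwards [h] with x hx _
    exact hx

theorem ae_eq_wMeasure {m r : ℝ} {f g : ℝ → ℂ} (h : f =ᵐ[wMeasure m] g) :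
    f =ᵐ[wMeasure r] g :=
  ae_wMeasure_iff.2 (ae_wMeasure_iff.1 h)

theorem ae_eq_restrict {m : ℝ} {f g : ℝ → ℂ} (h : f =ᵐ[wMeasure m] g) :
    f =ᵐ[volume.restrict (Ioi 0)] g :=
  ae_wMeasure_iff.1 h

theorem locallyIntegrableOn_of_wMeasure {m : ℝ} {f : ℝ → ℂ} (hf : Integrable f (wMeasure m)) :
    LocallyIntegrableOn f (Ioi 0) := by
  have h1 : IntegrableOn (fun x => (ENNReal.ofReal (x ^ m)).toReal • f x) (Ioi 0) :=
    (integrable_withDensity_iff_integrable_smul' (by fun_prop) (by simp)).1 hf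
  have h2 := LocallyIntegrableOn.continuousOn_smul (isOpen_Ioi.isLocallyClosed)
    h1.locallyIntegrableOn (g := fun x : ℝ => x ^ (-m))
    (fun x hx => (Real.continuousAt_rpow_const x (-m) (Or.inl (ne_of_gt hx))).continuousWithinAt)
  refine h2.congr ?_
  filter_upwards [ae_restrict_mem measurableSet_Ioi] with x hx
  have hx0 : (0 : ℝ) < x := hx
  rw [ENNReal.toReal_ofReal (Real.rpow_nonneg hx0.le m), smul_smul, ← Real.rpow_add hx0]
  simp

theorem integrableOn_smul {f : ℝ → ℂ} (hf : LocallyIntegrableOn f (Ioi 0)) {u : ℝ → ℝ}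
    (hu : Continuous u) (hc : HasCompactSupport u) (hs : tsupport u ⊆ Ioi 0) :
    IntegrableOn (fun x => u x • f x) (Ioi 0) := by
  have h1 : IntegrableOn (fun x => u x • f x) (tsupport u) :=
    (hf.integrableOn_compact_subset hs hc).continuousOn_smul hu.continuousOn hc
  have h2 : Integrable (fun x => u x • f x) := by
    rw [← integrableOn_iff_integrable_of_support_subset (s := tsupport u)]
    · exact h1
    · intro x hx
      apply subset_tsupport
      intro h0
      simp [h0] at hx
  exact h2.integrableOn

theorem contDiff_rpow_mul (s : ℝ) (φ : 𝓓(halfLine, ℝ)) :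
    ContDiff ℝ ∞ (fun y : ℝ => y ^ s * φ y) := by
  rw [contDiff_iff_contDiffAt]
  intro x
  by_cases hx : x ∈ tsupport φ
  · have hx0 : (0 : ℝ) < x := φ.tsupport_subset hx
    exact ContDiffAt.mul (n := ∞) (contDiffAt_id.rpow_const_of_ne hx0.ne') φ.contDiff.contDiffAt
  · have h0 : (fun y : ℝ => y ^ s * φ y) =ᶠ[𝓝 x] fun _ => 0 := by
      filter_upwards [notMem_tsupport_iff_eventuallyEq.1 hx] with y hy
      simp [hy]
    exact contDiffAt_const.congr_of_eventuallyEq h0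

theorem tsupport_rpow_mul (s : ℝ) (φ : 𝓓(halfLine, ℝ)) :
    tsupport (fun y : ℝ => y ^ s * φ y) ⊆ tsupport φ :=
  closure_mono fun x hx h0 => hx (by simp [h0])

theorem continuous_formalAdjoint (α a b : ℝ) (φ : 𝓓(halfLine, ℝ)) :
    Continuous (formalAdjoint α a b φ) := by
  have h1 : Continuous (deriv (deriv fun y : ℝ => y ^ α * φ y)) := by
    have := (contDiff_infty.1 (contDiff_rpow_mul α φ) 2).continuous_iteratedDeriv 2 le_rfl
    simpa [iteratedDeriv_succ, iteratedDeriv_zero] using this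
  have h2 : Continuous (deriv fun y : ℝ => y ^ (α - 1) * φ y) :=
    (contDiff_rpow_mul (α - 1) φ).continuous_deriv (by exact_mod_cast le_top)
  have h3 := (contDiff_rpow_mul (α - 2) φ).continuous
  exact (h1.sub (h2.const_mul a)).add (h3.const_mul b)

theorem tsupport_formalAdjoint (α a b : ℝ) (φ : 𝓓(halfLine, ℝ)) :
    tsupport (formalAdjoint α a b φ) ⊆ tsupport φ := by
  refine closure_minimal ?_ (isClosed_tsupport _)
  intro x hx
  by_contra hn
  apply hx
  have e1 : x ∉ tsupport (deriv (deriv fun y : ℝ => y ^ α * φ y)) := fun h =>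
    hn (tsupport_rpow_mul α φ (tsupport_deriv_subset (tsupport_deriv_subset h)))
  have e2 : x ∉ tsupport (deriv fun y : ℝ => y ^ (α - 1) * φ y) := fun h =>
    hn (tsupport_rpow_mul (α - 1) φ (tsupport_deriv_subset h))
  have e3 : φ x = 0 := image_eq_zero_of_notMem_tsupport hn
  simp [formalAdjoint, image_eq_zero_of_notMem_tsupport e1,
    image_eq_zero_of_notMem_tsupport e2, e3]

theorem integrableOn_formalAdjoint {m : ℝ} (α a b : ℝ) {f : ℝ → ℂ}
    (hf : Integrable f (wMeasure m)) (φ : 𝓓(halfLine, ℝ)) :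
    IntegrableOn (fun x => formalAdjoint α a b φ x • f x) (Ioi 0) :=
  integrableOn_smul (locallyIntegrableOn_of_wMeasure hf) (continuous_formalAdjoint α a b φ)
    (φ.hasCompactSupport.of_isClosed_subset (isClosed_tsupport _)
      (tsupport_formalAdjoint α a b φ))
    ((tsupport_formalAdjoint α a b φ).trans φ.tsupport_subset)

theorem integrableOn_test {m : ℝ} {f : ℝ → ℂ}
    (hf : Integrable f (wMeasure m)) (φ : 𝓓(halfLine, ℝ)) :
    IntegrableOn (fun x => φ x • f x) (Ioi 0) :=
  integrableOn_smul (locallyIntegrableOn_of_wMeasure hf) φ.continuous φ.hasCompactSupport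
    φ.tsupport_subset

theorem X.integrable {m : ℝ} (f : X m) : Integrable f (wMeasure m) := L1.integrable_coeFn f

theorem HasDistribOp.add {α a b m : ℝ} {f₁ g₁ f₂ g₂ : X m} (h₁ : HasDistribOp α a b f₁ g₁)
    (h₂ : HasDistribOp α a b f₂ g₂) :
    HasDistribOp α a b (f₁ + f₂ : X m) (g₁ + g₂ : X m) := by
  intro φ
  have e1 : ∫ x in Ioi (0 : ℝ), formalAdjoint α a b φ x • (f₁ + f₂ : X m) x
      = ∫ x in Ioi (0 : ℝ), (formalAdjoint α a b φ x • f₁ x + formalAdjoint α a b φ x • f₂ x) := by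
    refine integral_congr_ae ?_
    filter_upwards [ae_eq_restrict (Lp.coeFn_add f₁ f₂)] with x hx
    rw [hx, Pi.add_apply, smul_add]
  have e2 : ∫ x in Ioi (0 : ℝ), φ x • (g₁ + g₂ : X m) x
      = ∫ x in Ioi (0 : ℝ), (φ x • g₁ x + φ x • g₂ x) := by
    refine integral_congr_ae ?_
    filter_upwards [ae_eq_restrict (Lp.coeFn_add g₁ g₂)] with x hx
    rw [hx, Pi.add_apply, smul_add]
  rw [e1, e2, integral_add (integrableOn_formalAdjoint α a b f₁.integrable φ)
    (integrableOn_formalAdjoint α a b f₂.integrable φ),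
    integral_add (integrableOn_test g₁.integrable φ) (integrableOn_test g₂.integrable φ),
    h₁ φ, h₂ φ]

theorem HasDistribOp.smul {α a b m : ℝ} (c : ℂ) {f g : X m} (h : HasDistribOp α a b f g) :
    HasDistribOp α a b (c • f : X m) (c • g : X m) := by
  intro φ
  have e1 : ∫ x in Ioi (0 : ℝ), formalAdjoint α a b φ x • (c • f : X m) x
      = ∫ x in Ioi (0 : ℝ), c • (formalAdjoint α a b φ x • f x) := by
    refine integral_congr_ae ?_
    filter_upwards [ae_eq_restrict (Lp.coeFn_smul c f)] with x hx
    rw [hx, Pi.smul_apply, smul_comm]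
  have e2 : ∫ x in Ioi (0 : ℝ), φ x • (c • g : X m) x
      = ∫ x in Ioi (0 : ℝ), c • (φ x • g x) := by
    refine integral_congr_ae ?_
    filter_upwards [ae_eq_restrict (Lp.coeFn_smul c g)] with x hx
    rw [hx, Pi.smul_apply, smul_comm]
  rw [e1, e2, integral_smul, integral_smul, h φ]

theorem HasDistribOp.zero (α a b m : ℝ) :
    HasDistribOp α a b (0 : X m) (0 : X m) := by
  intro φ
  have h0 := ae_eq_restrict (Lp.coeFn_zero ℂ 1 (wMeasure m))
  rw [integral_eq_zero_of_ae, integral_eq_zero_of_ae]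
  · filter_upwards [h0] with x hx
    rw [hx, Pi.zero_apply, smul_zero]
  · filter_upwards [h0] with x hx
    rw [hx, Pi.zero_apply, smul_zero]

theorem MemXInter.congr {m : ℝ} {I : Set ℝ} {f g : ℝ → ℂ} (h : f =ᵐ[wMeasure m] g)
    (hf : MemXInter I f) : MemXInter I g :=
  fun r hr => (hf r hr).congr (ae_eq_wMeasure h)

theorem VanishesAtZero.congr {m s : ℝ} {f g : ℝ → ℂ} (h : f =ᵐ[wMeasure m] g)
    (hf : VanishesAtZero s f) : VanishesAtZero s g := by
  obtain ⟨k, hk, hfk, ht⟩ := hf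
  exact ⟨k, hk, (ae_eq_restrict h).symm.trans hfk, ht⟩

theorem DomainCond.congr {α a b n m : ℝ} {f g : ℝ → ℂ} (h : f =ᵐ[wMeasure m] g)
    (hf : DomainCond α a b n f) : DomainCond α a b n g where
  case1 h1 := (hf.case1 h1).congr h
  case2 h1 h2 := (hf.case2 h1 h2).congr h
  case3 h1 := ⟨(hf.case3 h1).1.congr h, (hf.case3 h1).2.congr h⟩

theorem VanishesAtZero.add {s : ℝ} {f g : ℝ → ℂ} (hf : VanishesAtZero s f)
    (hg : VanishesAtZero s g) : VanishesAtZero s (f + g) := by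
  obtain ⟨k, hk, hfk, ht⟩ := hf
  obtain ⟨l, hl, hgl, hu⟩ := hg
  refine ⟨k + l, hk.add hl, hfk.add hgl, ?_⟩
  simpa [smul_add] using ht.add hu

theorem VanishesAtZero.smul {s : ℝ} (c : ℂ) {f : ℝ → ℂ} (hf : VanishesAtZero s f) :
    VanishesAtZero s (c • f) := by
  obtain ⟨k, hk, hfk, ht⟩ := hf
  refine ⟨c • k, hk.const_smul c, hfk.const_smul c, ?_⟩
  have := ht.const_smul c
  rw [smul_zero] at this
  refine this.congr fun x => ?_
  exact smul_comm _ _ _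

theorem DomainCond.add {α a b n : ℝ} {f g : ℝ → ℂ} (hf : DomainCond α a b n f)
    (hg : DomainCond α a b n g) : DomainCond α a b n (f + g) where
  case1 h1 r hr := (hf.case1 h1 r hr).add (hg.case1 h1 r hr)
  case2 h1 h2 r hr := (hf.case2 h1 h2 r hr).add (hg.case2 h1 h2 r hr)
  case3 h1 := ⟨fun r hr => ((hf.case3 h1).1 r hr).add ((hg.case3 h1).1 r hr),
    (hf.case3 h1).2.add (hg.case3 h1).2⟩

theorem DomainCond.smul {α a b n : ℝ} (c : ℂ) {f : ℝ → ℂ} (hf : DomainCond α a b n f) :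
    DomainCond α a b n (c • f) where
  case1 h1 r hr := (hf.case1 h1 r hr).smul c
  case2 h1 h2 r hr := (hf.case2 h1 h2 r hr).smul c
  case3 h1 := ⟨fun r hr => ((hf.case3 h1).1 r hr).smul c, (hf.case3 h1).2.smul c⟩

theorem DomainCond.zero (α a b n : ℝ) : DomainCond α a b n 0 where
  case1 _ _ _ := integrable_zero _ _ _
  case2 _ _ _ _ := integrable_zero _ _ _
  case3 _ := ⟨fun _ _ => integrable_zero _ _ _, 0, continuousOn_const, ae_eq_refl _, by simp⟩

/-- The graph of the operator: the pairs `(f, g)` in `X_n × X_n` such that `f` satisfies the domain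
condition and `g = x^α (f'' + (a/x) f' + (b/x²) f)` in the sense of distributions. -/
def operatorGraph (α a b n : ℝ) : Submodule ℂ (X n × X n) where
  carrier := {p | DomainCond α a b n p.1 ∧ HasDistribOp α a b p.1 p.2}
  zero_mem' := ⟨(DomainCond.zero α a b n).congr (Lp.coeFn_zero ℂ 1 (wMeasure n)).symm,
    HasDistribOp.zero α a b n⟩
  add_mem' := fun {p q} hp hq =>
    ⟨(hp.1.add hq.1).congr (Lp.coeFn_add p.1 q.1).symm, hp.2.add hq.2⟩
  smul_mem' := fun c p hp =>
    ⟨(hp.1.smul c).congr (Lp.coeFn_smul c p.1).symm, hp.2.smul c⟩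

/-- The unbounded operator `f ↦ x^α (f'' + (a/x) f' + (b/x²) f)` on `X_n`. Its domain consists of
all `f ∈ X_n` which satisfy the domain condition and for which the distribution
`x^α (f'' + (a/x) f' + (b/x²) f)` belongs to `X_n`. -/
def operator (α a b n : ℝ) : X n →ₗ.[ℂ] X n := (operatorGraph α a b n).toLinearPMap

theorem operator_graph (α a b n : ℝ) : (operator α a b n).graph = operatorGraph α a b n := by
  refine Submodule.toLinearPMap_graph_eq _ ?_
  rintro ⟨f, g⟩ h h0
  simp only at h0
  subst h0
  have hz := ae_eq_restrict (Lp.coeFn_zero ℂ 1 (wMeasure n))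
  have hg : ∀ᵐ x ∂(volume : Measure ℝ), x ∈ Ioi (0 : ℝ) → g x = 0 := by
    refine isOpen_Ioi.ae_eq_zero_of_integral_contDiff_smul_eq_zero
      (locallyIntegrableOn_of_wMeasure g.integrable) ?_
    intro φ h1 h2 h3
    have h4 := h.2 ⟨φ, h1, h2, h3⟩
    have h5 : ∫ x in Ioi (0 : ℝ), φ x • g x = 0 := by
      refine h4.symm.trans (integral_eq_zero_of_ae ?_)
      filter_upwards [hz] with x hx
      rw [hx, Pi.zero_apply, smul_zero]
    rw [← h5, setIntegral_eq_integral_of_forall_compl_eq_zero]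
    intro x hx
    have : φ x = 0 := image_eq_zero_of_notMem_tsupport fun h => hx (h3 h)
    simp [this]
  refine Lp.ext ?_
  refine EventuallyEq.trans ?_ (Lp.coeFn_zero ℂ 1 (wMeasure n)).symm
  exact ae_wMeasure_iff.2 ((ae_restrict_iff' measurableSet_Ioi).2 hg)

end SingularOp

end

open MeasureTheory Set Filter Topology TopologicalSpace
open scoped Distributions ContDiff

noncomputable section

namespace SingularOp

/-! ### Strong and norm analyticity of operator families. -/

section AbstractSemigroup

variable {E : Type*} [NormedAddCommGroup E] [NormedSpace ℂ E]

/-! Put σ = 2 − α, d = √D and k = (1 + d − a)/2. Then b = k(k − d), the homogeneous equation has the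
solutions x^k and x^(k−d), and the critical exponents become n_* = −1 − k, n_*^- = σ − 1 − k and
n_*^+ = σ − 1 + d − k. Conjugation by x^k and the variable u = x^σ/σ² turn the operator into u∂² +
(1 + ν)∂ with ν = d/σ, whose heat kernel with respect to u^ν du is explicit: a modified Bessel
function, written here as a Poisson integral.

Construction. The kernel at time z sends the function w^(−ν−1) e^(−u/w) to the same function with w
replaced by w + z (`integral_besselHeat_mul_heatCurve`); this is a Laplace transform, computed by
Fubini from a Gaussian and a Gamma integral (`integral_rpow_mul_cexp_mul_integral`). Multiplied by
x^k these functions form an analytic curve e(w) in X_n with dense span, by Weierstrass approximation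
(`dense_of_exp_neg_rpow`). Translation along the curve together with operator bounds yields the
semigroup law, analyticity and strong continuity at once
(`isBoundedAnalyticSemigroup_of_translation`).

Bounds. On X_n the norm is controlled by the action of the kernel on the power u^q, q = (n −
n_*^+)/σ ≤ 0. This power is a superposition of the functions w^(−ν−1) e^(−u/w) with density
proportional to w^(ν+q), so time t only shifts w by t. If ν + q ≥ 0, that is n ≥ n_*^-, the density
is nondecreasing and the power is excessive: the semigroup is contractive. If −1 < ν + q < 0, that
is n_* < n < n_*^-, a constant is lost. Complex times are compared with the real time |z|²/Re z at
the cost of (|z|/Re z)^(ν+1).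

Generator. In divergence form the equation Af = g reads (x^(1+d) (x^(−k) f)′)′ = x^(n_*^+) g. Its
solutions without an x^(k−d) component form the closed subspace `primitiveGraph`. It contains the
pairs (e(w), e′(w)), hence the graph of the generator (`generatorGraph_le`). As 1 − A is onto for
the generator and injective on `primitiveGraph` (`eq_zero_of_mem_primitiveGraph`), the two graphs
agree.

Domain. A du Bois-Reymond argument gives every distributional solution as an element of that form
plus B x^(k−d). Each of the conditions (c1)–(c3) excludes B ≠ 0 and holds when B = 0, so
`primitiveGraph` is the graph of the operator. -/

theorem mem_sector_pi_div_two {z : ℂ} : z ∈ sector (Real.pi / 2) ↔ 0 < z.re := by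
  simp only [sector, mem_ofPred_eq, Complex.abs_arg_lt_pi_div_two_iff]
  constructor
  · rintro ⟨h0, h | h⟩
    · exact h
    · exact absurd h h0
  · intro h
    exact ⟨fun h0 => by simp [h0] at h, Or.inl h⟩

theorem sector_pi_div_two_eq : sector (Real.pi / 2) = {z : ℂ | 0 < z.re} :=
  Set.ext fun _ => mem_sector_pi_div_two

theorem isOpen_re_pos : IsOpen {z : ℂ | 0 < z.re} :=
  isOpen_lt continuous_const Complex.continuous_re

theorem norm_div_re_le_of_mem_sector {ε : ℝ} (hε : ε < Real.pi / 2) {z : ℂ}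
    (hz : z ∈ sector ε) : ‖z‖ / z.re ≤ 1 / Real.cos ε := by
  have h0 : 0 < ‖z‖ := norm_pos_iff.2 hz.1
  have hε0 : 0 ≤ ε := (abs_nonneg _).trans hz.2.le
  have hc : 0 < Real.cos ε := Real.cos_pos_of_mem_Ioo ⟨by linarith [Real.pi_pos], hε⟩
  have h1 : Real.cos ε ≤ Real.cos (Complex.arg z) := by
    rw [← Real.cos_abs (Complex.arg z)]
    exact Real.cos_le_cos_of_nonneg_of_le_pi (abs_nonneg _) (by linarith [Real.pi_pos]) hz.2.le
  rw [Complex.cos_arg hz.1, le_div_iff₀ h0] at h1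
  have hre : 0 < z.re := (mul_pos hc h0).trans_le h1
  rw [div_le_div_iff₀ hre hc]
  linarith

/-- A locally bounded family of operators which is strongly analytic on a set with dense span
is strongly analytic. -/
theorem differentiableOn_apply_of_dense {U : Set ℂ} (hU : IsOpen U) {T : ℂ → E →L[ℂ] E}
    (hb : ∀ z ∈ U, ∃ r > 0, ∃ C, ∀ w ∈ Metric.ball z r, ‖T w‖ ≤ C) [CompleteSpace E]
    {D : Set E} (hD : Dense (Submodule.span ℂ D : Set E))
    (hd : ∀ x ∈ D, DifferentiableOn ℂ (fun z => T z x) U) (x : E) :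
    DifferentiableOn ℂ (fun z => T z x) U := by
  have hspan : ∀ y ∈ Submodule.span ℂ D, DifferentiableOn ℂ (fun z => T z y) U := by
    intro y hy
    induction hy using Submodule.span_induction with
    | mem y hy => exact hd y hy
    | zero => simp
    | add y z _ _ hy hz => simpa using hy.fun_add hz
    | smul c y _ hy => simpa using hy.fun_const_smul c
  obtain ⟨y, hy, hyx⟩ := mem_closure_iff_seq_limit.1 (hD.closure_eq ▸ mem_univ x)
  have hloc : TendstoLocallyUniformlyOn (fun n z => T z (y n)) (fun z => T z x) atTop U := by
    rw [Metric.tendstoLocallyUniformlyOn_iff]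
    intro ε hε z hz
    obtain ⟨r, hr, C, hC⟩ := hb z hz
    refine ⟨Metric.ball z r, mem_nhdsWithin_of_mem_nhds (Metric.ball_mem_nhds z hr), ?_⟩
    have hlim : Tendsto (fun n => C * ‖x - y n‖) atTop (𝓝 (C * 0)) := by
      refine Tendsto.const_mul C ?_
      have := (tendsto_const_nhds (x := x)).sub hyx
      simpa using this.norm
    rw [mul_zero] at hlim
    filter_upwards [hlim.eventually (gt_mem_nhds hε)] with n hn w hw
    rw [dist_eq_norm, ← map_sub]
    exact ((T w).le_of_opNorm_le (hC w hw) _).trans_lt hn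
  exact hloc.differentiableOn (Eventually.of_forall fun n => hspan _ (hy n)) hU

/-- A locally bounded, strongly analytic family of operators is analytic in operator norm. -/
theorem differentiableOn_of_apply [CompleteSpace E] {U : Set ℂ} (hU : IsOpen U)
    {T : ℂ → E →L[ℂ] E}
    (hb : ∀ z ∈ U, ∃ r > 0, ∃ C, ∀ w ∈ Metric.ball z r, ‖T w‖ ≤ C)
    (hs : ∀ x, DifferentiableOn ℂ (fun z => T z x) U) : DifferentiableOn ℂ T U := by
  have hcont : ContinuousOn T U := by
    intro z hz
    obtain ⟨r₁, hr₁, C, hC⟩ := hb z hz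
    obtain ⟨r₂, hr₂, hU₂⟩ := Metric.isOpen_iff.1 hU z hz
    obtain ⟨r, hr, hr1, hr2⟩ : ∃ r > 0, 2 * r < r₁ ∧ 2 * r < r₂ := by
      refine ⟨min r₁ r₂ / 4, by positivity, ?_, ?_⟩ <;>
        linarith [min_le_left r₁ r₂, min_le_right r₁ r₂, lt_min hr₁ hr₂]
    have hC0 : 0 ≤ C := (norm_nonneg _).trans (hC z (Metric.mem_ball_self hr₁))
    -- Cauchy's estimate on circles of radius r bounds the derivative of each orbit by C‖x‖/r. This
    -- is uniform for ‖x‖ ≤ 1, so strong analyticity gives Lipschitz continuity in operator norm.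
    have hlip : ∀ w ∈ Metric.ball z r, ‖T w - T z‖ ≤ C / r * ‖w - z‖ := by
      intro w hw
      refine ContinuousLinearMap.opNorm_le_bound _ (by positivity) fun x => ?_
      have hder : ∀ v ∈ Metric.ball z r, ‖deriv (fun z => T z x) v‖ ≤ C * ‖x‖ / r := by
        intro v hv
        have hsub : Metric.closedBall v r ⊆ Metric.ball z (2 * r) := by
          intro u hu
          rw [Metric.mem_closedBall] at hu
          rw [Metric.mem_ball] at hv ⊢
          linarith [dist_triangle u v z]
        refine Complex.norm_deriv_le_of_forall_mem_sphere_norm_le hr ?_ ?_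
        · refine DifferentiableOn.diffContOnCl ?_
          rw [closure_ball v hr.ne']
          exact (hs x).mono (hsub.trans ((Metric.ball_subset_ball hr2.le).trans hU₂))
        · intro u hu
          refine (T u).le_of_opNorm_le (hC u ?_) x
          exact Metric.ball_subset_ball hr1.le (hsub (Metric.sphere_subset_closedBall hu))
      have := (convex_ball z r).norm_image_sub_le_of_norm_deriv_le
        (f := fun z => T z x) (x := z) (y := w)
        (fun v hv => (hs x).differentiableAt (hU.mem_nhds
          (hU₂ (Metric.ball_subset_ball (by linarith) hv)))) hder (Metric.mem_ball_self hr) hw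
      calc ‖(T w - T z) x‖ = ‖T w x - T z x‖ := rfl
        _ ≤ _ := this
        _ = _ := by ring
    refine ContinuousAt.continuousWithinAt ?_
    rw [ContinuousAt, tendsto_iff_norm_sub_tendsto_zero]
    have hlim : Tendsto (fun w => C / r * ‖w - z‖) (𝓝 z) (𝓝 0) := by
      have : Continuous fun w : ℂ => C / r * ‖w - z‖ := by fun_prop
      simpa using this.tendsto z
    refine squeeze_zero' (Eventually.of_forall fun _ => norm_nonneg _) ?_ hlim
    filter_upwards [Metric.ball_mem_nhds z hr] with w hw using hlip w hw
  intro z hz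
  obtain ⟨r, hr, hrU⟩ := Metric.nhds_basis_closedBall.mem_iff.1 (hU.mem_nhds hz)
  have hcs : ContinuousOn T (Metric.sphere z r) :=
    hcont.mono (Metric.sphere_subset_closedBall.trans hrU)
  -- Norm continuity makes the operator-valued Cauchy integral meaningful. Tested on vectors it
  -- reproduces `T w`, and Cauchy integrals of continuous functions are analytic.
  have hrep : ∀ w ∈ Metric.ball z r,
      (2 * Real.pi * Complex.I : ℂ)⁻¹ • (∮ ζ in C(z, r), (ζ - w)⁻¹ • T ζ) = T w := by
    intro w hw
    ext x
    have hi : CircleIntegrable (fun ζ => (ζ - w)⁻¹ • T ζ) z r := by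
      refine ContinuousOn.circleIntegrable hr.le (ContinuousOn.fun_smul ?_ hcs)
      refine ContinuousOn.inv₀ (by fun_prop) fun ζ hζ h0 => ?_
      rw [sub_eq_zero.1 h0, mem_sphere_iff_norm] at hζ
      rw [mem_ball_iff_norm] at hw
      exact hw.ne hζ
    have h1 : (∮ ζ in C(z, r), (ζ - w)⁻¹ • T ζ) x = ∮ ζ in C(z, r), (ζ - w)⁻¹ • T ζ x := by
      exact ContinuousLinearMap.intervalIntegral_apply hi.out x
    rw [smul_apply, h1]
    refine DiffContOnCl.two_pi_i_inv_smul_circleIntegral_sub_inv_smul ?_ hw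
    refine DifferentiableOn.diffContOnCl ?_
    rw [closure_ball z hr.ne']
    exact (hs x).mono hrU
  have hana := (hasFPowerSeriesOn_cauchy_integral
    (hcs.circleIntegrable hr.le) (R := ⟨r, hr.le⟩) hr).differentiableOn
  refine DifferentiableAt.differentiableWithinAt ?_
  have hda := hana.differentiableAt (x := z) (Metric.isOpen_eball.mem_nhds (Metric.mem_eball_self (ENNReal.coe_pos.2 hr)))
  refine hda.congr_of_eventuallyEq ?_
  filter_upwards [Metric.ball_mem_nhds z hr] with w hw
  exact (hrep w hw).symm

end AbstractSemigroup

/-! ### From a translated curve to a semigroup, and identification of its generator. -/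

section Generator

variable {E : Type*} [NormedAddCommGroup E] [NormedSpace ℂ E]

/-- A family of operators which acts by translation on a curve with dense span, and which satisfies
a uniform bound on sectors, is a bounded analytic semigroup of angle `π/2`. -/
theorem isBoundedAnalyticSemigroup_of_translation [CompleteSpace E] {T : ℂ → E →L[ℂ] E}
    {e : ℂ → E} {C μ : ℝ} (hμ : 0 ≤ μ) (hC : 0 ≤ C) (h0 : T 0 = 1)
    (hT : ∀ z w : ℂ, 0 < z.re → 0 < w.re → T z (e w) = e (w + z))
    (he : DifferentiableOn ℂ e {z | 0 < z.re})
    (hD : Dense (Submodule.span ℂ (e '' {z | 0 < z.re}) : Set E))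
    (hb : ∀ z : ℂ, 0 < z.re → ‖T z‖ ≤ C * (‖z‖ / z.re) ^ μ) :
    IsBoundedAnalyticSemigroup (Real.pi / 2) T := by
  have hre : ∀ {ε : ℝ}, ε < Real.pi / 2 → ∀ {z}, z ∈ sector ε → 0 < z.re := fun hε z hz =>
    mem_sector_pi_div_two.1 ⟨hz.1, hz.2.trans hε⟩
  have hbound : ∀ ε : ℝ, 0 < ε → ε < Real.pi / 2 → ∀ z ∈ sector ε,
      ‖T z‖ ≤ C * (1 / Real.cos ε) ^ μ := by
    intro ε _ hε z hz
    refine (hb z (hre hε hz)).trans (mul_le_mul_of_nonneg_left ?_ hC)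
    refine Real.rpow_le_rpow (div_nonneg (norm_nonneg _) (hre hε hz).le) ?_ hμ
    exact norm_div_re_le_of_mem_sector hε hz
  have hdiff : DifferentiableOn ℂ T {z | 0 < z.re} := by
    have hloc : ∀ z ∈ {z : ℂ | 0 < z.re}, ∃ r > 0, ∃ C', ∀ w ∈ Metric.ball z r, ‖T w‖ ≤ C' := by
      intro z hz
      have hz' : 0 < z.re := hz
      refine ⟨z.re / 2, half_pos hz', C * ((‖z‖ + z.re) / (z.re / 2)) ^ μ, fun w hw => ?_⟩
      rw [mem_ball_iff_norm] at hw
      have h1 : |(w - z).re| < z.re / 2 := (Complex.abs_re_le_norm _).trans_lt hw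
      have h2 : z.re / 2 < w.re := by
        rw [Complex.sub_re, abs_lt] at h1
        linarith
      have h3 : ‖w‖ ≤ ‖z‖ + z.re := by
        have := norm_add_le (w - z) z
        rw [sub_add_cancel] at this
        linarith
      refine (hb w (by linarith)).trans (mul_le_mul_of_nonneg_left ?_ hC)
      refine Real.rpow_le_rpow (div_nonneg (norm_nonneg _) (by linarith)) ?_ hμ
      exact div_le_div₀ (by positivity) h3 (by positivity) h2.le
    refine differentiableOn_of_apply isOpen_re_pos hloc
      (differentiableOn_apply_of_dense isOpen_re_pos hloc hD ?_)
    rintro _ ⟨w, hw, rfl⟩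
    have hw' : 0 < w.re := hw
    have h1 : DifferentiableOn ℂ (fun z => e (w + z)) {z : ℂ | 0 < z.re} := by
      refine he.comp (by fun_prop) fun z hz => ?_
      have hz' : 0 < z.re := hz
      change 0 < (w + z).re
      rw [Complex.add_re]
      positivity
    exact h1.congr fun z hz => hT z w hz hw
  refine ⟨h0, fun z hz w hw => ?_, by rwa [sector_pi_div_two_eq], fun ε hε0 hε f => ?_,
    fun ε hε0 hε => ⟨_, hbound ε hε0 hε⟩⟩
  · rw [mem_sector_pi_div_two] at hz hw
    refine ContinuousLinearMap.ext_on hD ?_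
    rintro _ ⟨v, hv, rfl⟩
    have hv' : 0 < v.re := hv
    rw [mul_apply_eq_comp, hT w v hw hv, hT z _ hz (by rw [Complex.add_re]; positivity),
      hT _ v (by rw [Complex.add_re]; positivity) hv, add_assoc, add_comm w z]
  · set K := C * (1 / Real.cos ε) ^ μ with hK
    have hKb := hbound ε hε0 hε
    have hspan : ∀ y ∈ Submodule.span ℂ (e '' {z | 0 < z.re}),
        Tendsto (fun z : ℂ => T z y) (𝓝[sector ε] 0) (𝓝 y) := by
      intro y hy
      induction hy using Submodule.span_induction with
      | mem y hy =>
        obtain ⟨w, hw, rfl⟩ := hy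
        have hcont : ContinuousAt (fun z : ℂ => e (w + z)) 0 := by
          have := (he.differentiableAt (isOpen_re_pos.mem_nhds hw)).continuousAt
          exact ContinuousAt.comp (g := e) (f := fun z : ℂ => w + z) (by simpa using this)
            (by fun_prop)
        have h1 : Tendsto (fun z : ℂ => e (w + z)) (𝓝[sector ε] 0) (𝓝 (e w)) := by
          have := hcont.tendsto.mono_left (nhdsWithin_le_nhds (s := sector ε))
          simpa using this
        refine h1.congr' ?_
        filter_upwards [self_mem_nhdsWithin] with z hz
        exact (hT z w (hre hε hz) hw).symm
      | zero => simp [tendsto_const_nhds]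
      | add y z _ _ hy hz => simpa using hy.add hz
      | smul c y _ hy => simpa using hy.const_smul c
    have hK0 : 0 ≤ K := by
      have hc : 0 < Real.cos ε := Real.cos_pos_of_mem_Ioo ⟨by linarith [Real.pi_pos], hε⟩
      positivity
    rw [Metric.tendsto_nhds]
    intro δ hδ
    obtain ⟨y, hy, hfy⟩ := hD.exists_dist_lt f (ε := δ / (2 * (K + 1))) (by positivity)
    filter_upwards [(Metric.tendsto_nhds.1 (hspan y hy)) (δ / 2) (half_pos hδ),
      self_mem_nhdsWithin] with z hz hzs
    have e1 : T z f - f = T z (f - y) + (T z y - y) + (y - f) := by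
      rw [map_sub]
      abel
    rw [dist_eq_norm] at hfy hz ⊢
    rw [e1]
    have h1 : ‖T z (f - y)‖ ≤ K * ‖f - y‖ := (T z).le_of_opNorm_le (hKb z hzs) _
    have h2 : (K + 1) * ‖f - y‖ < δ / 2 := by
      rw [lt_div_iff₀ (by positivity)] at hfy
      linarith
    calc _ ≤ ‖T z (f - y)‖ + ‖T z y - y‖ + ‖y - f‖ := norm_add₃_le
      _ < δ := by rw [norm_sub_rev y f]; linarith

variable {T : ℂ → E →L[ℂ] E} (hT : IsBoundedAnalyticSemigroup (Real.pi / 2) T)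
include hT

theorem IsBoundedAnalyticSemigroup.tendsto_ofReal_apply (f : E) :
    Tendsto (fun t : ℝ => T (t : ℂ) f) (𝓝[>] 0) (𝓝 f) := by
  refine (hT.tendsto_zero (Real.pi / 4) (by positivity) (by linarith [Real.pi_pos]) f).comp ?_
  refine tendsto_nhdsWithin_iff.2 ⟨?_, ?_⟩
  · exact (Complex.continuous_ofReal.tendsto' 0 0 (by simp)).mono_left nhdsWithin_le_nhds
  · filter_upwards [self_mem_nhdsWithin] with t ht
    have ht' : 0 < t := ht
    refine ⟨by exact_mod_cast ht'.ne', ?_⟩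
    rw [Complex.arg_ofReal_of_nonneg ht'.le, abs_zero]
    positivity

theorem IsBoundedAnalyticSemigroup.hasDerivAt_apply {t : ℝ} (ht : 0 < t) (f : E) :
    HasDerivAt (fun s : ℝ => T (s : ℂ) f) (deriv T (t : ℂ) f) t := by
  have h1 : HasDerivAt T (deriv T (t : ℂ)) (t : ℂ) := by
    refine (hT.analytic.differentiableAt ?_).hasDerivAt
    rw [sector_pi_div_two_eq]
    exact isOpen_re_pos.mem_nhds (by simpa using ht)
  have h2 : HasDerivAt (fun z => T z f) (deriv T (t : ℂ) f) (t : ℂ) := by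
    simpa using h1.clm_apply (hasDerivAt_const (t : ℂ) f)
  have := h2.scomp_of_eq t (Complex.ofRealCLM.hasDerivAt (x := t)) (by simp)
  simpa [Function.comp_def] using this

theorem IsBoundedAnalyticSemigroup.map_ofReal_add {s t : ℝ} (hs : 0 < s) (ht : 0 < t) (f : E) :
    T ((s + t : ℝ) : ℂ) f = T (s : ℂ) (T (t : ℂ) f) := by
  rw [Complex.ofReal_add, hT.map_add _ (mem_sector_pi_div_two.2 (by simpa))
    _ (mem_sector_pi_div_two.2 (by simpa))]
  rfl

/-- By the semigroup law the right difference quotient at t is `T t` applied to the difference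
quotient at 0, which converges to `g`. -/
theorem IsBoundedAnalyticSemigroup.deriv_apply_of_mem {f g : E} (h : (f, g) ∈ generatorGraph T)
    {t : ℝ} (ht : 0 < t) : deriv T (t : ℂ) f = T (t : ℂ) g := by
  have h1 : Tendsto (fun s : ℝ => s⁻¹ • (T ((t + s : ℝ) : ℂ) f - T (t : ℂ) f)) (𝓝[>] 0)
      (𝓝 (deriv T (t : ℂ) f)) :=
    (hT.hasDerivAt_apply ht f).tendsto_slope_zero_right
  have h2 := ((T (t : ℂ)).continuous.tendsto g).comp
    (show Tendsto (fun t : ℝ => ((t : ℂ)⁻¹) • (T (t : ℂ) f - f)) (𝓝[>] 0) (𝓝 g) from h)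
  refine tendsto_nhds_unique h1 (h2.congr' ?_)
  filter_upwards [self_mem_nhdsWithin] with s hs
  rw [hT.map_ofReal_add ht hs, Function.comp_apply, map_smul, map_sub, ← Complex.ofReal_inv,
    Complex.coe_smul]

/-- A closed subspace which contains the pairs `(e w, e' w)` of a translated curve with dense span
contains the graph of the generator. -/
theorem IsBoundedAnalyticSemigroup.generatorGraph_le {e : ℂ → E}
    (he : ∀ z w : ℂ, 0 < z.re → 0 < w.re → T z (e w) = e (w + z))
    (hD : Dense (Submodule.span ℂ (e '' {z | 0 < z.re}) : Set E))
    {Γ : Submodule ℂ (E × E)} (hΓ : IsClosed (Γ : Set (E × E))) {e' : ℂ → E}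
    (hder : ∀ w : ℂ, 0 < w.re → HasDerivAt e (e' w) w)
    (hmem : ∀ w : ℂ, 0 < w.re → (e w, e' w) ∈ Γ) : generatorGraph T ≤ Γ := by
  -- The pair depends continuously on h, so closedness of Γ and density reduce the claim to h =
  -- e(w), where the pair is (e(w + t), e′(w + t)).
  have h1 : ∀ t : ℝ, 0 < t → ∀ h : E, (T (t : ℂ) h, deriv T (t : ℂ) h) ∈ Γ := by
    intro t ht h
    set L : E →L[ℂ] E × E := (T (t : ℂ)).prod (deriv T (t : ℂ)) with hL
    have hcl : IsClosed ((Γ.comap (L : E →ₗ[ℂ] E × E) : Submodule ℂ E) : Set E) :=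
      hΓ.preimage L.continuous
    have hle : Submodule.span ℂ (e '' {z | 0 < z.re}) ≤ Γ.comap (L : E →ₗ[ℂ] E × E) := by
      rw [Submodule.span_le]
      rintro _ ⟨w, hw, rfl⟩
      have hw' : 0 < w.re := hw
      have hwt : 0 < (w + t).re := by
        rw [Complex.add_re, Complex.ofReal_re]
        positivity
      have e1 : deriv T (t : ℂ) (e w) = e' (w + t) := by
        have h2 : HasDerivAt (fun s : ℝ => e (w + s)) (e' (w + t)) t := by
          have := (hder _ hwt).scomp_of_eq (h := fun s : ℝ => w + (s : ℂ)) t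
            ((Complex.ofRealCLM.hasDerivAt (x := t)).const_add w) rfl
          simpa [Function.comp_def] using this
        refine (hT.hasDerivAt_apply ht (e w)).unique (h2.congr_of_eventuallyEq ?_)
        filter_upwards [lt_mem_nhds ht] with s hs
        exact he _ _ (by simpa using hs) hw
      change (T (t : ℂ) (e w), deriv T (t : ℂ) (e w)) ∈ Γ
      rw [e1, he _ _ (by simpa using ht) hw]
      exact hmem _ hwt
    have : h ∈ closure ((Γ.comap (L : E →ₗ[ℂ] E × E) : Submodule ℂ E) : Set E) :=
      closure_mono hle (hD.closure_eq ▸ mem_univ h)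
    rw [hcl.closure_eq] at this
    exact this
  rintro ⟨f, g⟩ hfg
  -- For (f, g) in the generator the derivative of the orbit at t is T_t g. The pairs (T_t f, T_t g)
  -- therefore lie in Γ and converge to (f, g) as t → 0.
  have h2 : Tendsto (fun t : ℝ => (T (t : ℂ) f, T (t : ℂ) g)) (𝓝[>] 0) (𝓝 (f, g)) :=
    (hT.tendsto_ofReal_apply f).prodMk_nhds (hT.tendsto_ofReal_apply g)
  refine hΓ.mem_of_tendsto h2 ?_
  filter_upwards [self_mem_nhdsWithin] with t ht
  rw [← hT.deriv_apply_of_mem hfg ht]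
  exact h1 t ht f

/-- The operator `1 - A` is surjective for the generator `A` of a bounded semigroup. -/
theorem IsBoundedAnalyticSemigroup.exists_mem_generatorGraph [CompleteSpace E] (h : E) :
    ∃ p ∈ generatorGraph T, p.1 - p.2 = h := by
  obtain ⟨C, hC⟩ := hT.bounded (Real.pi / 4) (by positivity) (by linarith [Real.pi_pos])
  have hsec : ∀ t : ℝ, 0 < t → (t : ℂ) ∈ sector (Real.pi / 4) := fun t ht => by
    refine ⟨by exact_mod_cast ht.ne', ?_⟩
    rw [Complex.arg_ofReal_of_nonneg ht.le, abs_zero]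
    positivity
  set F : ℝ → E := fun t => Real.exp (-t) • T (t : ℂ) h with hF
  have hFc : ContinuousOn F (Ioi 0) := fun t ht =>
    ((by fun_prop : ContinuousAt (fun t : ℝ => Real.exp (-t)) t).smul
      (hT.hasDerivAt_apply ht h).continuousAt).continuousWithinAt
  have hFi : IntegrableOn F (Ioi 0) := by
    refine Integrable.mono' (g := fun t => Real.exp (-t) * (C * ‖h‖))
      ((integrableOn_exp_neg_Ioi 0).mul_const _)
      (hFc.aestronglyMeasurable measurableSet_Ioi) ?_
    filter_upwards [ae_restrict_mem measurableSet_Ioi] with t ht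
    rw [hF, norm_smul, Real.norm_of_nonneg (Real.exp_pos _).le]
    exact mul_le_mul_of_nonneg_left ((T (t : ℂ)).le_of_opNorm_le (hC _ (hsec t ht)) h)
      (Real.exp_pos _).le
  have hF0 : Tendsto F (𝓝[>] 0) (𝓝 h) := by
    have h1 : Tendsto (fun t : ℝ => Real.exp (-t)) (𝓝[>] 0) (𝓝 1) :=
      ((by fun_prop : Continuous fun t : ℝ => Real.exp (-t)).tendsto' 0 1 (by simp)).mono_left
        nhdsWithin_le_nhds
    simpa using h1.smul (hT.tendsto_ofReal_apply h)
  set R : E := ∫ t in Ioi (0 : ℝ), F t with hR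
  set φ : ℝ → E := fun s => ∫ t in (0 : ℝ)..s, F t with hφ
  have hφ' : HasDerivWithinAt φ h (Ici 0) 0 := by
    refine intervalIntegral.integral_hasDerivWithinAt_of_tendsto_ae_right (t := Ioi 0) (by simp)
      ?_ ?_
    · exact ⟨Ioi 0, self_mem_nhdsWithin, hFc.aestronglyMeasurable measurableSet_Ioi⟩
    · exact hF0.mono_left inf_le_left
  have hshift : ∀ s : ℝ, 0 < s → T (s : ℂ) R = Real.exp s • (R - φ s) := by
    intro s hs
    have h1 : R - φ s = ∫ t in Ioi s, F t := by
      rw [hφ, hR, sub_eq_iff_eq_add, add_comm]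
      exact (intervalIntegral.integral_interval_add_Ioi hFi
        (hFi.mono_set (Ioi_subset_Ioi hs.le))).symm
    have h2 : ∫ t in Ioi s, F t = ∫ t in Ioi (0 : ℝ), F (t + s) := by
      rw [← (measurePreserving_add_right volume s).setIntegral_preimage_emb
        (measurableEmbedding_addRight s), preimage_add_const_Ioi, sub_self]
    rw [h1, h2, ← integral_smul, hR, ← ContinuousLinearMap.integral_comp_comm _ hFi]
    refine setIntegral_congr_fun measurableSet_Ioi fun t ht => ?_
    have hm := hT.map_ofReal_add hs ht h
    simp only [hF]
    rw [add_comm t s, hm, smul_smul, ← Real.exp_add, ← Complex.coe_smul, map_smul,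
      Complex.coe_smul]
    congr 2
    ring
  refine ⟨(R, R - h), ?_, by simp⟩
  have hψ : HasDerivWithinAt (fun s => Real.exp s • (R - φ s)) (R - h) (Ici 0) 0 := by
    have := (Real.hasDerivAt_exp 0).hasDerivWithinAt.fun_smul (hφ'.const_sub R)
    simpa [hφ, sub_eq_add_neg, add_comm] using this
  have hsl := (hasDerivWithinAt_iff_tendsto_slope' self_notMem_Ioi).1 hψ.Ioi_of_Ici
  change Tendsto (fun t : ℝ => ((t : ℂ)⁻¹) • (T (t : ℂ) R - R)) (𝓝[>] 0) (𝓝 (R - h))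
  refine hsl.congr' ?_
  filter_upwards [self_mem_nhdsWithin] with s hs
  rw [← Complex.ofReal_inv, Complex.coe_smul, hshift s hs]
  simp [hφ, slope_def_module]

/-- If the generator is contained in a graph on which `1 - A` is injective, then it is equal to
that graph. -/
theorem IsBoundedAnalyticSemigroup.generatorGraph_eq [CompleteSpace E]
    {Γ : Submodule ℂ (E × E)} (hle : generatorGraph T ≤ Γ)
    (hinj : ∀ f, (f, f) ∈ Γ → f = 0) : generatorGraph T = Γ := by
  refine le_antisymm hle ?_
  rintro ⟨f, g⟩ hfg
  obtain ⟨⟨f', g'⟩, hp, hp'⟩ := hT.exists_mem_generatorGraph (f - g)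
  have h1 : (f - f', g - g') ∈ Γ := Γ.sub_mem hfg (hle hp)
  have h2 : g - g' = f - f' := by
    have h3 : f' - g' = f - g := hp'
    rw [sub_eq_sub_iff_add_eq_add] at h3 ⊢
    rw [add_comm g, h3.symm, add_comm]
  rw [h2] at h1
  have h3 := hinj _ h1
  rw [h3] at h2
  rw [sub_eq_zero.1 h3, sub_eq_zero.1 h2]
  exact hp

end Generator

/-! ### Kernel operators and differentiable curves in L¹. -/

section IntegralOperators

variable {Ω : Type*} [MeasurableSpace Ω] {μ : Measure Ω}

/-- Tonelli: integrating in the first variable first leaves the column norms, which are bounded by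
`C`. -/
theorem integrable_kernel_mul [SFinite μ] {κ : Ω → Ω → ℂ}
    (hκ : Measurable (Function.uncurry κ)) {C : ENNReal} (hC : C ≠ ⊤)
    (hb : ∀ᵐ y ∂μ, ∫⁻ x, ‖κ x y‖ₑ ∂μ ≤ C) {f : Ω → ℂ} (hf : Integrable f μ) :
    Integrable (fun p : Ω × Ω => κ p.1 p.2 * f p.2) (μ.prod μ) ∧
      ∫⁻ x, ‖∫ y, κ x y * f y ∂μ‖ₑ ∂μ ≤ C * ∫⁻ y, ‖f y‖ₑ ∂μ := by
  have hm : AEStronglyMeasurable (fun p : Ω × Ω => κ p.1 p.2 * f p.2) (μ.prod μ) :=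
    (hκ.aestronglyMeasurable).mul hf.1.comp_snd
  have h1 : ∫⁻ y, ∫⁻ x, ‖κ x y * f y‖ₑ ∂μ ∂μ ≤ C * ∫⁻ y, ‖f y‖ₑ ∂μ := by
    rw [← lintegral_const_mul'' C hf.1.enorm]
    refine lintegral_mono_ae ?_
    filter_upwards [hb] with y hy
    simp only [enorm_mul]
    rw [lintegral_mul_const]
    · gcongr
    · exact (hκ.comp measurable_prodMk_right).enorm
  have h2 : ∫⁻ x, ∫⁻ y, ‖κ x y * f y‖ₑ ∂μ ∂μ ≤ C * ∫⁻ y, ‖f y‖ₑ ∂μ := by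
    rw [lintegral_lintegral_swap hm.enorm]
    exact h1
  refine ⟨⟨hm, ?_⟩, (lintegral_mono fun x => enorm_integral_le_lintegral_enorm _).trans h2⟩
  rw [HasFiniteIntegral, lintegral_prod _ hm.enorm]
  exact h2.trans_lt (ENNReal.mul_lt_top hC.lt_top hf.2)

/-- A measurable kernel whose columns are uniformly bounded in `L¹` defines a bounded operator
on `L¹`. -/
theorem exists_kernelOperator [SFinite μ] {κ : Ω → Ω → ℂ}
    (hκ : Measurable (Function.uncurry κ)) {C : ℝ} (hC : 0 ≤ C)
    (hb : ∀ᵐ y ∂μ, ∫⁻ x, ‖κ x y‖ₑ ∂μ ≤ ENNReal.ofReal C) :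
    ∃ S : Lp ℂ 1 μ →L[ℂ] Lp ℂ 1 μ, ‖S‖ ≤ C ∧
      ∀ f : Lp ℂ 1 μ, S f =ᵐ[μ] fun x => ∫ y, κ x y * f y ∂μ := by
  have hint : ∀ f : Lp ℂ 1 μ, Integrable (fun p : Ω × Ω => κ p.1 p.2 * f p.2) (μ.prod μ) :=
    fun f => (integrable_kernel_mul hκ ENNReal.ofReal_ne_top hb (L1.integrable_coeFn f)).1
  have hint' : ∀ f : Lp ℂ 1 μ, Integrable (fun x => ∫ y, κ x y * f y ∂μ) μ :=
    fun f => (hint f).integral_prod_left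
  have hcoe : ∀ f : Lp ℂ 1 μ, (hint' f).toL1 _ =ᵐ[μ] fun x => ∫ y, κ x y * f y ∂μ :=
    fun f => Integrable.coeFn_toL1 _
  let S₀ : Lp ℂ 1 μ →ₗ[ℂ] Lp ℂ 1 μ :=
    { toFun := fun f => (hint' f).toL1 _
      map_add' := fun f g => by
        refine Lp.ext ?_
        filter_upwards [hcoe (f + g), hcoe f, hcoe g, Lp.coeFn_add ((hint' f).toL1 _)
          ((hint' g).toL1 _), (hint f).prod_right_ae, (hint g).prod_right_ae] with x h1 h2 h3 h4 h5 h6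
        rw [h1, h4, Pi.add_apply, h2, h3, ← integral_add h5 h6]
        refine integral_congr_ae ?_
        filter_upwards [Lp.coeFn_add f g] with y hy
        rw [hy, Pi.add_apply, mul_add]
      map_smul' := fun c f => by
        refine Lp.ext ?_
        filter_upwards [hcoe (c • f), hcoe f, Lp.coeFn_smul c ((hint' f).toL1 _)] with x h1 h2 h3
        rw [h1, RingHom.id_apply, h3, Pi.smul_apply, h2, ← integral_smul]
        refine integral_congr_ae ?_
        filter_upwards [Lp.coeFn_smul c f] with y hy
        rw [hy, Pi.smul_apply, smul_eq_mul, smul_eq_mul]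
        ring }
  refine ⟨S₀.mkContinuous C fun f => ?_, LinearMap.mkContinuous_norm_le _ hC _, fun f => hcoe f⟩
  change ‖(hint' f).toL1 _‖ ≤ C * ‖f‖
  rw [Integrable.norm_toL1_eq_lintegral_enorm, L1.norm_def]
  refine ENNReal.toReal_le_of_le_ofReal (by positivity) ?_
  have := (integrable_kernel_mul hκ ENNReal.ofReal_ne_top hb (L1.integrable_coeFn f)).2
  rwa [ENNReal.ofReal_mul hC, ENNReal.ofReal_toReal (L1.hasFiniteIntegral_coeFn f).ne]

/-- Differentiation of a curve in `L¹` under a dominated derivative. -/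
theorem hasDerivAt_L1_of_dominated {F F' : ℂ → Ω → ℂ} {w₀ : ℂ} {r : ℝ} (hr : 0 < r)
    {bound : Ω → ℝ} (hbound : Integrable bound μ) {e : ℂ → Lp ℂ 1 μ} {e' : Lp ℂ 1 μ}
    (he : ∀ w ∈ Metric.ball w₀ r, e w =ᵐ[μ] F w) (he' : e' =ᵐ[μ] F' w₀)
    (hF' : ∀ᵐ x ∂μ, ∀ w ∈ Metric.ball w₀ r, ‖F' w x‖ ≤ bound x)
    (hder : ∀ᵐ x ∂μ, ∀ w ∈ Metric.ball w₀ r, HasDerivAt (fun w => F w x) (F' w x) w) :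
    HasDerivAt e e' w₀ := by
  have hw₀ := Metric.mem_ball_self (x := w₀) hr
  rw [hasDerivAt_iff_tendsto]
  have hae : ∀ w ∈ Metric.ball w₀ r, (e w - e w₀ - (w - w₀) • e' : Lp ℂ 1 μ) =ᵐ[μ]
      fun x => F w x - F w₀ x - (w - w₀) • F' w₀ x := by
    intro w hw
    filter_upwards [he w hw, he w₀ hw₀, he', Lp.coeFn_sub (e w - e w₀) ((w - w₀) • e'),
      Lp.coeFn_sub (e w) (e w₀), Lp.coeFn_smul (w - w₀) e'] with x h1 h2 h3 h6 h7 h8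
    rw [h6, Pi.sub_apply, h7, Pi.sub_apply, h8, Pi.smul_apply, h1, h2, h3]
  have h1 : Tendsto (fun w => ∫ x, ‖w - w₀‖⁻¹ * ‖F w x - F w₀ x - (w - w₀) • F' w₀ x‖ ∂μ)
      (𝓝 w₀) (𝓝 (∫ _, (0 : ℝ) ∂μ)) := by
    -- One copy of `bound` comes from the mean value inequality for the increment, the other from
    -- the linear term.
    refine tendsto_integral_filter_of_dominated_convergence (fun x => 2 * bound x) ?_ ?_
      (hbound.const_mul 2) ?_
    · filter_upwards [Metric.ball_mem_nhds w₀ hr] with w hw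
      exact ((Lp.aestronglyMeasurable _).congr (hae w hw)).norm.const_mul _
    · filter_upwards [Metric.ball_mem_nhds w₀ hr] with w hw
      filter_upwards [hF', hder] with x h4 h5
      rw [norm_mul, norm_inv, norm_norm, norm_norm]
      have h9 : ‖F w x - F w₀ x‖ ≤ bound x * ‖w - w₀‖ :=
        (convex_ball w₀ r).norm_image_sub_le_of_norm_hasDerivWithin_le
          (fun v hv => (h5 v hv).hasDerivWithinAt) h4 hw₀ hw
      have h10 : ‖(w - w₀) • F' w₀ x‖ ≤ bound x * ‖w - w₀‖ := by
        rw [norm_smul, mul_comm]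
        gcongr
        exact h4 w₀ hw₀
      rcases eq_or_ne w w₀ with rfl | hne
      · simpa using (norm_nonneg _).trans (h4 w hw₀)
      · rw [inv_mul_le_iff₀ (norm_pos_iff.2 (sub_ne_zero.2 hne))]
        linarith [norm_sub_le (F w x - F w₀ x) ((w - w₀) • F' w₀ x)]
    · filter_upwards [hder] with x hx
      exact hasDerivAt_iff_tendsto.1 (hx w₀ hw₀)
  rw [integral_zero] at h1
  refine h1.congr' ?_
  filter_upwards [Metric.ball_mem_nhds w₀ hr] with w hw
  rw [integral_const_mul, L1.norm_eq_integral_norm]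
  congr 1
  refine integral_congr_ae ?_
  filter_upwards [hae w hw] with x hx
  rw [hx]

end IntegralOperators

/-! ### Complex powers on the right half-plane and the Gamma integral. -/

section GammaIntegrals

/-- Both arguments lie in (−π/2, π/2), so their sum does not cross the branch cut of the logarithm.
-/
theorem mul_cpow_of_re_pos {z w : ℂ} (hz : 0 < z.re) (hw : 0 < w.re) (s : ℂ) :
    (z * w) ^ s = z ^ s * w ^ s := by
  have hz0 : z ≠ 0 := fun h => by simp [h] at hz
  have hw0 : w ≠ 0 := fun h => by simp [h] at hw
  have h1 := abs_lt.1 (Complex.abs_arg_lt_pi_div_two_iff.2 (Or.inl hz))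
  have h2 := abs_lt.1 (Complex.abs_arg_lt_pi_div_two_iff.2 (Or.inl hw))
  rw [Complex.cpow_def_of_ne_zero (mul_ne_zero hz0 hw0), Complex.cpow_def_of_ne_zero hz0,
    Complex.cpow_def_of_ne_zero hw0, ← Complex.exp_add, ← add_mul,
    Complex.log_mul hz0 hw0 ⟨by linarith, by linarith⟩]

theorem inv_re_pos {z : ℂ} (hz : 0 < z.re) : 0 < (z⁻¹).re := by
  have hz0 : z ≠ 0 := fun h => by simp [h] at hz
  rw [Complex.inv_re]
  exact div_pos hz (Complex.normSq_pos.2 hz0)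

theorem inv_cpow_of_re_pos {z : ℂ} (hz : 0 < z.re) (s : ℂ) : z⁻¹ ^ s = (z ^ s)⁻¹ := by
  refine Complex.inv_cpow z s fun h => ?_
  rw [Complex.arg_eq_pi_iff] at h
  linarith [h.1]

theorem integrableOn_rpow_mul_exp_neg_mul {s b : ℝ} (hs : -1 < s) (hb : 0 < b) :
    IntegrableOn (fun x : ℝ => x ^ s * Real.exp (-b * x)) (Ioi 0) := by
  simpa using integrableOn_rpow_mul_exp_neg_mul_rpow hs one_pos hb

theorem norm_ofReal_mul_cexp (r : ℝ) (hr : 0 ≤ r) (z : ℂ) :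
    ‖(r : ℂ) * Complex.exp z‖ = r * Real.exp z.re := by
  rw [norm_mul, Complex.norm_exp, Complex.norm_of_nonneg hr]

theorem integrableOn_rpow_mul_cexp {s : ℝ} (hs : -1 < s) {p : ℂ} (hp : 0 < p.re) :
    IntegrableOn (fun y : ℝ => ((y ^ s : ℝ) : ℂ) * Complex.exp (-p * y)) (Ioi 0) := by
  refine Integrable.mono' (integrableOn_rpow_mul_exp_neg_mul hs hp)
    (Measurable.aestronglyMeasurable (by fun_prop)) ?_
  filter_upwards [ae_restrict_mem measurableSet_Ioi] with y hy
  rw [norm_ofReal_mul_cexp _ (Real.rpow_nonneg (le_of_lt hy) _)]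
  simp

/-- The Gamma integral with a complex rate. -/
theorem integral_rpow_mul_cexp {a : ℝ} (ha : 0 < a) {p : ℂ} (hp : 0 < p.re) :
    ∫ y in Ioi (0 : ℝ), ((y ^ (a - 1) : ℝ) : ℂ) * Complex.exp (-p * y)
      = Real.Gamma a * p ^ (-a : ℂ) := by
  set L : ℂ → ℂ := fun p => ∫ y in Ioi (0 : ℝ), ((y ^ (a - 1) : ℝ) : ℂ) * Complex.exp (-p * y)
  have hLd : DifferentiableOn ℂ L {z | 0 < z.re} := by
    intro p₀ hp₀
    have hp₀' : 0 < p₀.re := hp₀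
    have hball : ∀ p ∈ Metric.ball p₀ (p₀.re / 2), p₀.re / 2 < p.re := by
      intro p hp
      rw [mem_ball_iff_norm] at hp
      have h1 := (Complex.abs_re_le_norm (p - p₀)).trans_lt hp
      rw [Complex.sub_re, abs_lt] at h1
      linarith
    refine (hasDerivAt_integral_of_dominated_loc_of_deriv_le
      (F := fun p y => ((y ^ (a - 1) : ℝ) : ℂ) * Complex.exp (-p * y))
      (F' := fun p y => ((y ^ (a - 1) : ℝ) : ℂ) * (Complex.exp (-p * y) * (-(y : ℂ))))
      (bound := fun y => y ^ a * Real.exp (-(p₀.re / 2) * y))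
      (Metric.ball_mem_nhds p₀ (half_pos hp₀')) ?_ (integrableOn_rpow_mul_cexp (by linarith) hp₀')
      ?_ ?_ ?_ ?_).2.differentiableAt.differentiableWithinAt
    · exact Eventually.of_forall fun p => Measurable.aestronglyMeasurable (by fun_prop)
    · exact Measurable.aestronglyMeasurable (by fun_prop)
    · filter_upwards [ae_restrict_mem measurableSet_Ioi] with y hy p hp
      have hy' : 0 < y := hy
      rw [← mul_assoc, norm_mul, norm_ofReal_mul_cexp _ (Real.rpow_nonneg hy'.le _), norm_neg,
        Complex.norm_of_nonneg hy'.le, mul_right_comm, ← Real.rpow_add_one hy'.ne']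
      have h2 := hball p hp
      simp only [sub_add_cancel]
      gcongr
      simpa using mul_le_mul_of_nonneg_right h2.le hy'.le
    · exact integrableOn_rpow_mul_exp_neg_mul (by linarith) (half_pos hp₀')
    · refine Eventually.of_forall fun y p _ => ?_
      refine HasDerivAt.const_mul _ ?_
      have h3 : HasDerivAt (fun p : ℂ => -p * y) (-(y : ℂ)) p := by
        simpa using ((hasDerivAt_id p).neg.mul_const (y : ℂ))
      exact h3.cexp
  have hRd : DifferentiableOn ℂ (fun p : ℂ => Real.Gamma a * p ^ (-a : ℂ)) {z | 0 < z.re} := by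
    intro p hp
    exact ((differentiableAt_id.cpow_const (Or.inl hp)).const_mul _).differentiableWithinAt
  have heq : ∀ t : ℝ, 0 < t → L t = Real.Gamma a * (t : ℂ) ^ (-a : ℂ) := by
    intro t ht
    have h1 := Complex.integral_cpow_mul_exp_neg_mul_Ioi (a := a) (r := t) (by simpa using ha) ht
    rw [Complex.Gamma_ofReal, one_div, ← Complex.ofReal_inv, mul_comm] at h1
    have h2 : ((t⁻¹ : ℝ) : ℂ) ^ (a : ℂ) = (t : ℂ) ^ (-a : ℂ) := by
      rw [← Complex.ofReal_neg, ← Complex.ofReal_cpow (inv_pos.2 ht).le,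
        ← Complex.ofReal_cpow ht.le, Real.inv_rpow ht.le, Real.rpow_neg ht.le]
    rw [h2] at h1
    rw [← h1]
    refine setIntegral_congr_fun measurableSet_Ioi fun y hy => ?_
    have hy' : 0 < y := hy
    simp only [Complex.ofReal_cpow hy'.le]
    push_cast
    ring_nf
  have hconn : IsPreconnected {z : ℂ | 0 < z.re} := (convex_halfSpace_re_gt 0).isPreconnected
  -- Both sides are analytic on the half-plane and agree on the positive reals, which accumulate at
  -- 1; the identity theorem concludes.
  have hfreq : ∃ᶠ z in 𝓝[≠] (1 : ℂ), L z = Real.Gamma a * z ^ (-a : ℂ) := by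
    have htend : Tendsto (fun t : ℝ => (t : ℂ)) (𝓝[>] 1) (𝓝[≠] (1 : ℂ)) := by
      refine tendsto_nhdsWithin_iff.2 ⟨?_, ?_⟩
      · exact (Complex.continuous_ofReal.tendsto' 1 1 (by simp)).mono_left nhdsWithin_le_nhds
      · filter_upwards [self_mem_nhdsWithin] with t ht
        have ht' : 1 < t := ht
        simpa using ht'.ne'
    refine htend.frequently (Eventually.frequently ?_)
    filter_upwards [self_mem_nhdsWithin] with t ht
    exact heq t (zero_lt_one.trans ht)
  exact (hLd.analyticOnNhd isOpen_re_pos).eqOn_of_preconnected_of_frequently_eq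
    (hRd.analyticOnNhd isOpen_re_pos) hconn (by simp) hfreq hp

end GammaIntegrals

/-! ### A two-variable integral that yields the Laplace transform of the Bessel function. -/

section GaussGamma

/-- The integrand `e^{2 β X - p u} (u - X²)_+^{ν - 1/2}`. -/
def gaussGamma (ν : ℝ) (p β : ℂ) (X u : ℝ) : ℂ :=
  (Ioi (X ^ 2)).indicator
    (fun u : ℝ => (((u - X ^ 2) ^ (ν - 1 / 2) : ℝ) : ℂ) * Complex.exp (2 * β * X - p * u)) u

variable {ν : ℝ} {p β : ℂ}

/-- After the shift u = y + X² the integrand factors into a Gamma integrand in y and a Gaussian in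
X. The final `+ 0` is the constant term in the quadratic exponent of `integral_cexp_quadratic`. -/
theorem gaussGamma_eq_shift (X : ℝ) :
    (fun y : ℝ => (((y + X ^ 2 - X ^ 2) ^ (ν - 1 / 2) : ℝ) : ℂ)
        * Complex.exp (2 * β * X - p * (y + X ^ 2 : ℝ)))
      = fun y : ℝ => (((y ^ (ν + 1 / 2 - 1) : ℝ) : ℂ) * Complex.exp (-p * y))
        * Complex.exp (-p * (X : ℂ) ^ 2 + 2 * β * X + 0) := by
  funext y
  rw [mul_assoc (((y ^ (ν + 1 / 2 - 1) : ℝ) : ℂ)), ← Complex.exp_add, add_sub_cancel_right,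
    show ν + 1 / 2 - 1 = ν - 1 / 2 by ring]
  congr 2
  push_cast
  ring

theorem integrable_gaussGamma_right (hν : -1 / 2 < ν) (hp : 0 < p.re) (X : ℝ) :
    Integrable (gaussGamma ν p β X) := by
  unfold gaussGamma
  rw [integrable_indicator_iff measurableSet_Ioi,
    ← (measurePreserving_add_right volume (X ^ 2)).integrableOn_comp_preimage
      (measurableEmbedding_addRight (X ^ 2)), preimage_add_const_Ioi, sub_self]
  have := (integrableOn_rpow_mul_cexp (s := ν + 1 / 2 - 1) (by linarith) hp).mul_const
    (Complex.exp (-p * (X : ℂ) ^ 2 + 2 * β * X + 0))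
  rw [← gaussGamma_eq_shift] at this
  exact this

theorem integral_gaussGamma_right (hν : -1 / 2 < ν) (hp : 0 < p.re) (X : ℝ) :
    ∫ u, gaussGamma ν p β X u
      = Real.Gamma (ν + 1 / 2) * p ^ (-(ν + 1 / 2 : ℝ) : ℂ)
        * Complex.exp (-p * (X : ℂ) ^ 2 + 2 * β * X + 0) := by
  unfold gaussGamma
  rw [integral_indicator measurableSet_Ioi,
    ← (measurePreserving_add_right volume (X ^ 2)).setIntegral_preimage_emb
      (measurableEmbedding_addRight (X ^ 2)), preimage_add_const_Ioi, sub_self,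
    ← integral_rpow_mul_cexp (a := ν + 1 / 2) (by linarith) hp, ← integral_mul_const]
  refine setIntegral_congr_fun measurableSet_Ioi fun y _ => ?_
  exact congrFun (gaussGamma_eq_shift X) y

/-- The modulus is the same function with real parameters, so absolute integrability for Fubini
follows from the closed form of the inner integral. -/
theorem norm_gaussGamma (X u : ℝ) :
    ((‖gaussGamma ν p β X u‖ : ℝ) : ℂ) = gaussGamma ν p.re β.re X u := by
  unfold gaussGamma
  by_cases h : u ∈ Ioi (X ^ 2)
  · have h' : X ^ 2 < u := h
    rw [indicator_of_mem h, indicator_of_mem h, norm_ofReal_mul_cexp _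
      (Real.rpow_nonneg (by linarith) _)]
    push_cast
    congr 2
    simp
  · rw [indicator_of_notMem h, indicator_of_notMem h]
    simp

theorem measurable_gaussGamma :
    Measurable (Function.uncurry (gaussGamma ν p β)) := by
  have h : Function.uncurry (gaussGamma ν p β) = {q : ℝ × ℝ | q.1 ^ 2 < q.2}.indicator
      (fun q : ℝ × ℝ => (((q.2 - q.1 ^ 2) ^ (ν - 1 / 2) : ℝ) : ℂ)
        * Complex.exp (2 * β * q.1 - p * q.2)) := by
    ext ⟨X, u⟩
    simp [gaussGamma, indicator]
  rw [h]
  exact Measurable.indicator (by fun_prop) (measurableSet_lt (by fun_prop) (by fun_prop))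

theorem integrable_gaussGamma (hν : -1 / 2 < ν) (hp : 0 < p.re) :
    Integrable (Function.uncurry (gaussGamma ν p β)) (volume.prod volume) := by
  rw [integrable_prod_iff measurable_gaussGamma.aestronglyMeasurable]
  refine ⟨Eventually.of_forall fun X => integrable_gaussGamma_right hν hp X, ?_⟩
  have h1 : (fun X => ((∫ u, ‖Function.uncurry (gaussGamma ν p β) (X, u)‖ : ℝ) : ℂ))
      = fun X : ℝ => Real.Gamma (ν + 1 / 2) * (p.re : ℂ) ^ (-(ν + 1 / 2 : ℝ) : ℂ)
        * Complex.exp (-(p.re : ℂ) * (X : ℂ) ^ 2 + 2 * (β.re : ℂ) * X + 0) := by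
    funext X
    rw [← integral_gaussGamma_right hν (by simpa using hp) X, ← integral_complex_ofReal]
    exact integral_congr_ae (Eventually.of_forall fun u => norm_gaussGamma X u)
  have h2 : Integrable (fun X => ((∫ u, ‖Function.uncurry (gaussGamma ν p β) (X, u)‖ : ℝ) : ℂ)) := by
    rw [h1]
    exact (integrable_cexp_quadratic (by simpa using hp) _ _).const_mul _
  simpa using h2.re

/-- Scaling X = √u s turns the constraint X² < u into |s| < 1 and extracts the factor u^ν. -/
theorem integral_gaussGamma_left {u : ℝ} (hu : 0 < u) :
    ∫ X, gaussGamma ν p β X u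
      = ((u ^ ν : ℝ) : ℂ) * Complex.exp (-p * u)
        * ∫ s in (-1 : ℝ)..1, Complex.exp (2 * β * (√u * s : ℝ))
          * (((1 - s ^ 2) ^ (ν - 1 / 2) : ℝ) : ℂ) := by
  have hsu : 0 < √u := Real.sqrt_pos.2 hu
  have h1 : (fun X => gaussGamma ν p β X u) = (Ioo (-√u) √u).indicator
      (fun X : ℝ => (((u - X ^ 2) ^ (ν - 1 / 2) : ℝ) : ℂ) * Complex.exp (2 * β * X - p * u)) := by
    ext X
    have h2 : X ^ 2 < u ↔ X ∈ Ioo (-√u) √u := by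
      rw [mem_Ioo, ← abs_lt, ← Real.sqrt_sq_eq_abs, Real.sqrt_lt_sqrt_iff (sq_nonneg X)]
    simp only [gaussGamma, indicator, mem_Ioi, h2]
  rw [h1, integral_indicator measurableSet_Ioo, ← integral_Ioc_eq_integral_Ioo,
    ← intervalIntegral.integral_of_le (by linarith)]
  have h3 := intervalIntegral.smul_integral_comp_mul_left (a := -1) (b := 1)
    (fun X : ℝ => (((u - X ^ 2) ^ (ν - 1 / 2) : ℝ) : ℂ) * Complex.exp (2 * β * X - p * u)) (√u)
  rw [mul_neg, mul_one] at h3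
  rw [← h3, ← intervalIntegral.integral_smul, ← intervalIntegral.integral_const_mul]
  refine intervalIntegral.integral_congr_ae (Eventually.of_forall fun s hs => ?_)
  rw [uIoc_of_le (by norm_num)] at hs
  have hs2 : 0 ≤ 1 - s ^ 2 := by nlinarith [hs.1, hs.2]
  have h4 : √u * (u - (√u * s) ^ 2) ^ (ν - 1 / 2) = u ^ ν * (1 - s ^ 2) ^ (ν - 1 / 2) := by
    have h5 : u - (√u * s) ^ 2 = u * (1 - s ^ 2) := by
      rw [mul_pow, Real.sq_sqrt hu.le]
      ring
    rw [h5, Real.mul_rpow hu.le hs2, ← mul_assoc, Real.sqrt_eq_rpow, ← Real.rpow_add hu]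
    ring_nf
  rw [Complex.real_smul, ← mul_assoc, ← Complex.ofReal_mul, h4,
    show 2 * β * ((√u * s : ℝ) : ℂ) - p * u = 2 * β * ((√u * s : ℝ) : ℂ) + -p * u by ring,
    Complex.exp_add]
  push_cast
  ring_nf

/-- The Laplace transform of the integral representation of a modified Bessel function. -/
theorem integral_rpow_mul_cexp_mul_integral (hν : -1 / 2 < ν) (hp : 0 < p.re) :
    ∫ u in Ioi (0 : ℝ), ((u ^ ν : ℝ) : ℂ) * Complex.exp (-p * u)
        * ∫ s in (-1 : ℝ)..1, Complex.exp (2 * β * (√u * s : ℝ))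
          * (((1 - s ^ 2) ^ (ν - 1 / 2) : ℝ) : ℂ)
      = (√Real.pi * Real.Gamma (ν + 1 / 2) : ℝ) * p ^ (-(ν + 1 : ℝ) : ℂ)
        * Complex.exp (β ^ 2 / p) := by
  have hp0 : p ≠ 0 := fun h => by simp [h] at hp
  have h1 : ∫ u in Ioi (0 : ℝ), ∫ X, gaussGamma ν p β X u = ∫ u, ∫ X, gaussGamma ν p β X u := by
    refine setIntegral_eq_integral_of_forall_compl_eq_zero fun u hu => ?_
    refine integral_eq_zero_of_ae (Eventually.of_forall fun X => ?_)
    refine indicator_of_notMem ?_ _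
    have : u ≤ 0 := not_lt.1 hu
    simp only [mem_Ioi, not_lt]
    nlinarith [sq_nonneg X]
  -- Fubini for `gaussGamma`: integrating in X first gives the left-hand side, integrating in u
  -- first gives a Gamma factor times a Gaussian in X.
  rw [← setIntegral_congr_fun measurableSet_Ioi
    (fun u hu => integral_gaussGamma_left (ν := ν) (p := p) (β := β) hu), h1,
    ← integral_integral_swap (integrable_gaussGamma hν hp)]
  simp_rw [integral_gaussGamma_right hν hp]
  rw [integral_const_mul, integral_cexp_quadratic (by simpa using hp)]
  have h2 : (Real.pi / -(-p) : ℂ) ^ (1 / 2 : ℂ) = (√Real.pi : ℝ) * p ^ (-(1 / 2 : ℝ) : ℂ) := by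
    rw [neg_neg, div_eq_mul_inv, mul_cpow_of_re_pos (by simpa using Real.pi_pos)
      (inv_re_pos hp), inv_cpow_of_re_pos hp, Real.sqrt_eq_rpow,
      Complex.ofReal_cpow Real.pi_pos.le, Complex.cpow_neg]
    norm_num
  rw [h2]
  have h3 : p ^ (-(ν + 1 : ℝ) : ℂ) = p ^ (-(ν + 1 / 2 : ℝ) : ℂ) * p ^ (-(1 / 2 : ℝ) : ℂ) := by
    rw [← Complex.cpow_add _ _ hp0]
    congr 1
    push_cast
    ring
  have h4 : (0 : ℂ) - (2 * β) ^ 2 / (4 * -p) = β ^ 2 / p := by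
    field_simp
    ring
  rw [h3, h4]
  push_cast
  ring

end GaussGamma

/-! ### The Bessel heat kernel and its action on exponentials. -/

section BesselHeatKernel

/-- The heat kernel of `u ∂² + (1 + ν) ∂` with respect to `u^ν du`, at complex time `z`, given by
the Poisson integral of the modified Bessel function. -/
def besselHeat (ν : ℝ) (z : ℂ) (u v : ℝ) : ℂ :=
  (((√Real.pi * Real.Gamma (ν + 1 / 2))⁻¹ : ℝ) : ℂ) * z ^ (-(ν + 1 : ℝ) : ℂ)
    * ∫ s in (-1 : ℝ)..1, Complex.exp (-((u + v - 2 * √(u * v) * s : ℝ) : ℂ) / z)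
      * (((1 - s ^ 2) ^ (ν - 1 / 2) : ℝ) : ℂ)

/-- The heat kernel `besselHeat` at real times, as a real number. -/
def besselHeatReal (ν t u v : ℝ) : ℝ :=
  (√Real.pi * Real.Gamma (ν + 1 / 2))⁻¹ * t ^ (-(ν + 1))
    * ∫ s in (-1 : ℝ)..1, Real.exp (-(u + v - 2 * √(u * v) * s) / t) * (1 - s ^ 2) ^ (ν - 1 / 2)

/-- The curve `w ↦ w^{-ν-1} e^{-u/w}` on which the semigroup acts by translation. -/
def heatCurve (ν : ℝ) (w : ℂ) (u : ℝ) : ℂ :=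
  w ^ (-(ν + 1 : ℝ) : ℂ) * Complex.exp (-u / w)

variable {ν : ℝ}

theorem besselHeat_ofReal {t : ℝ} (ht : 0 < t) (u v : ℝ) :
    besselHeat ν t u v = besselHeatReal ν t u v := by
  rw [besselHeat, besselHeatReal, Complex.ofReal_mul, Complex.ofReal_mul,
    ← intervalIntegral.integral_ofReal, Complex.ofReal_cpow ht.le]
  push_cast
  rfl

theorem sub_sq_rpow_nonneg {s : ℝ} (hs : s ∈ Ioc (-1 : ℝ) 1) (r : ℝ) : 0 ≤ (1 - s ^ 2) ^ r :=
  Real.rpow_nonneg (by nlinarith [hs.1, hs.2]) _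

theorem besselHeatReal_nonneg (hν : -1 / 2 < ν) {t : ℝ} (ht : 0 < t) (u v : ℝ) :
    0 ≤ besselHeatReal ν t u v := by
  have hΓ : 0 < Real.Gamma (ν + 1 / 2) := Real.Gamma_pos_of_pos (by linarith)
  refine mul_nonneg (by positivity) ?_
  rw [intervalIntegral.integral_of_le (by norm_num)]
  refine setIntegral_nonneg measurableSet_Ioc fun s hs => ?_
  exact mul_nonneg (Real.exp_pos _).le (sub_sq_rpow_nonneg hs _)

/-- In the Poisson integral the exponent is −c/z with c real, and |e^(−c/z)| = e^(−c/t) for t =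
|z|²/Re z. The remaining weight is nonnegative, so only the prefactor z^(−ν−1) has to be compared
with t^(−ν−1). -/
theorem norm_besselHeat_le (hν : -1 / 2 < ν) {z : ℂ} (hz : 0 < z.re) (u v : ℝ) :
    ‖besselHeat ν z u v‖
      ≤ (‖z‖ / z.re) ^ (ν + 1) * besselHeatReal ν (‖z‖ ^ 2 / z.re) u v := by
  have hz0 : 0 < ‖z‖ := norm_pos_iff.2 fun h => by simp [h] at hz
  have hΓ : 0 < Real.Gamma (ν + 1 / 2) := Real.Gamma_pos_of_pos (by linarith)
  have h1 : ‖∫ s in (-1 : ℝ)..1, Complex.exp (-((u + v - 2 * √(u * v) * s : ℝ) : ℂ) / z)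
      * (((1 - s ^ 2) ^ (ν - 1 / 2) : ℝ) : ℂ)‖
      ≤ ∫ s in (-1 : ℝ)..1, Real.exp (-(u + v - 2 * √(u * v) * s) / (‖z‖ ^ 2 / z.re))
        * (1 - s ^ 2) ^ (ν - 1 / 2) := by
    refine (intervalIntegral.norm_integral_le_integral_norm (by norm_num)).trans_eq ?_
    refine intervalIntegral.integral_congr_ae (Eventually.of_forall fun s hs => ?_)
    rw [uIoc_of_le (by norm_num)] at hs
    rw [norm_mul, Complex.norm_of_nonneg (sub_sq_rpow_nonneg hs _), Complex.norm_exp,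
      ← Complex.ofReal_neg, div_eq_mul_inv, Complex.re_ofReal_mul, Complex.inv_re,
      Complex.normSq_eq_norm_sq, div_div_eq_mul_div, mul_div_assoc]
  have h2 : ‖z ^ (-(ν + 1 : ℝ) : ℂ)‖
      = (‖z‖ / z.re) ^ (ν + 1) * (‖z‖ ^ 2 / z.re) ^ (-(ν + 1)) := by
    rw [← Complex.ofReal_neg, Complex.norm_cpow_real,
      show ‖z‖ ^ 2 / z.re = ‖z‖ / z.re * ‖z‖ by ring,
      Real.mul_rpow (by positivity) hz0.le, ← mul_assoc,
      ← Real.rpow_add (by positivity), add_neg_cancel, Real.rpow_zero, one_mul]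
  rw [besselHeat, besselHeatReal, norm_mul, norm_mul, h2,
    Complex.norm_of_nonneg (by positivity)]
  calc _ ≤ _ := mul_le_mul_of_nonneg_left h1 (by positivity)
    _ = _ := by ring

theorem besselHeat_comm (z : ℂ) (u v : ℝ) : besselHeat ν z u v = besselHeat ν z v u := by
  simp only [besselHeat, add_comm u v, mul_comm u v]

theorem measurable_besselHeat (z : ℂ) :
    Measurable (Function.uncurry (besselHeat ν z)) := by
  have h : Function.uncurry (besselHeat ν z) = fun q : ℝ × ℝ =>
      (((√Real.pi * Real.Gamma (ν + 1 / 2))⁻¹ : ℝ) : ℂ) * z ^ (-(ν + 1 : ℝ) : ℂ)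
        * ∫ s in Ioc (-1 : ℝ) 1,
          Complex.exp (-((q.1 + q.2 - 2 * √(q.1 * q.2) * s : ℝ) : ℂ) / z)
          * (((1 - s ^ 2) ^ (ν - 1 / 2) : ℝ) : ℂ) := by
    funext q
    rw [← intervalIntegral.integral_of_le (by norm_num)]
    rfl
  rw [h]
  refine Measurable.const_mul (StronglyMeasurable.measurable ?_) _
  refine StronglyMeasurable.integral_prod_right (f := fun (q : ℝ × ℝ) (s : ℝ) =>
    Complex.exp (-((q.1 + q.2 - 2 * √(q.1 * q.2) * s : ℝ) : ℂ) / z)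
          * (((1 - s ^ 2) ^ (ν - 1 / 2) : ℝ) : ℂ)) ?_
  refine Measurable.stronglyMeasurable ?_
  unfold Function.uncurry
  fun_prop

theorem measurable_besselHeatReal {t : ℝ} (ht : 0 < t) :
    Measurable (Function.uncurry (besselHeatReal ν t)) := by
  have h : Function.uncurry (besselHeatReal ν t)
      = fun q => (Function.uncurry (besselHeat ν t) q).re := by
    funext q
    simp [Function.uncurry, besselHeat_ofReal ht]
  rw [h]
  exact Complex.measurable_re.comp (measurable_besselHeat _)

/-- The exponent splits into terms in v, in u and in √(uv), leaving the Laplace transform of the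
Bessel integral with p = l + 1/z and β = √v/z. The case Re l = 0 is needed for
`integral_besselHeat`. -/
theorem integral_besselHeat_mul_cexp (hν : -1 / 2 < ν) {z l : ℂ} (hz : 0 < z.re) (hl : 0 ≤ l.re)
    {v : ℝ} (hv : 0 ≤ v) :
    ∫ u in Ioi (0 : ℝ), besselHeat ν z u v * (((u ^ ν : ℝ) : ℂ) * Complex.exp (-l * u))
      = z ^ (-(ν + 1 : ℝ) : ℂ) * (l + z⁻¹) ^ (-(ν + 1 : ℝ) : ℂ)
        * Complex.exp (-(v : ℂ) / z + v / (z ^ 2 * (l + z⁻¹))) := by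
  have hz0 : z ≠ 0 := fun h => by simp [h] at hz
  have hΓ : 0 < Real.Gamma (ν + 1 / 2) := Real.Gamma_pos_of_pos (by linarith)
  have hp : 0 < (l + z⁻¹).re := by
    rw [Complex.add_re]
    linarith [inv_re_pos hz]
  have hp0 : l + z⁻¹ ≠ 0 := fun h => by simp [h] at hp
  have key := integral_rpow_mul_cexp_mul_integral (ν := ν) (β := (√v : ℂ) / z) hν hp
  have h1 : ∀ u ∈ Ioi (0 : ℝ), besselHeat ν z u v * (((u ^ ν : ℝ) : ℂ) * Complex.exp (-l * u))
      = ((((√Real.pi * Real.Gamma (ν + 1 / 2))⁻¹ : ℝ) : ℂ) * z ^ (-(ν + 1 : ℝ) : ℂ)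
          * Complex.exp (-(v : ℂ) / z)) *
        (((u ^ ν : ℝ) : ℂ) * Complex.exp (-(l + z⁻¹) * u)
        * ∫ s in (-1 : ℝ)..1, Complex.exp (2 * ((√v : ℂ) / z) * (√u * s : ℝ))
          * (((1 - s ^ 2) ^ (ν - 1 / 2) : ℝ) : ℂ)) := by
    intro u hu
    have hu' : 0 < u := hu
    have h2 : ∀ s : ℝ, Complex.exp (-((u + v - 2 * √(u * v) * s : ℝ) : ℂ) / z)
        = Complex.exp (-(v : ℂ) / z) * Complex.exp (-z⁻¹ * u)
          * Complex.exp (2 * ((√v : ℂ) / z) * (√u * s : ℝ)) := by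
      intro s
      rw [← Complex.exp_add, ← Complex.exp_add, Real.sqrt_mul hu'.le]
      congr 1
      push_cast
      field_simp
      ring
    have h3 : Complex.exp (-(l + z⁻¹) * u) = Complex.exp (-l * u) * Complex.exp (-z⁻¹ * u) := by
      rw [← Complex.exp_add]
      congr 1
      ring
    simp only [besselHeat, h2, h3, mul_assoc (Complex.exp (-(v : ℂ) / z) * Complex.exp (-z⁻¹ * u)),
      intervalIntegral.integral_const_mul]
    ring
  have h4 : Complex.exp (((√v : ℂ) / z) ^ 2 / (l + z⁻¹))
      = Complex.exp (v / (z ^ 2 * (l + z⁻¹))) := by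
    rw [div_pow, ← Complex.ofReal_pow, Real.sq_sqrt hv, div_div]
  rw [setIntegral_congr_fun measurableSet_Ioi h1, integral_const_mul, key, h4, Complex.exp_add]
  have h5 : (√Real.pi * Real.Gamma (ν + 1 / 2) : ℝ) ≠ 0 := by positivity
  have h6 : (((√Real.pi * Real.Gamma (ν + 1 / 2))⁻¹ : ℝ) : ℂ)
      * ((√Real.pi * Real.Gamma (ν + 1 / 2) : ℝ) : ℂ) = 1 := by
    rw [← Complex.ofReal_mul, inv_mul_cancel₀ h5, Complex.ofReal_one]
  linear_combination (z ^ (-(ν + 1 : ℝ) : ℂ) * (l + z⁻¹) ^ (-(ν + 1 : ℝ) : ℂ)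
    * Complex.exp (-(v : ℂ) / z) * Complex.exp (v / (z ^ 2 * (l + z⁻¹)))) * h6

/-- The heat kernel acts on `heatCurve` by translation. -/
theorem integral_besselHeat_mul_heatCurve (hν : -1 / 2 < ν) {z w : ℂ} (hz : 0 < z.re)
    (hw : 0 < w.re) {v : ℝ} (hv : 0 ≤ v) :
    ∫ u in Ioi (0 : ℝ), besselHeat ν z u v * (((u ^ ν : ℝ) : ℂ) * heatCurve ν w u)
      = heatCurve ν (w + z) v := by
  have hz0 : z ≠ 0 := fun h => by simp [h] at hz
  have hw0 : w ≠ 0 := fun h => by simp [h] at hw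
  have hs : 0 < (w + z).re := by
    rw [Complex.add_re]
    positivity
  have hs0 : w + z ≠ 0 := fun h => by simp [h] at hs
  have hwi := inv_re_pos hw
  have hp : 0 < (w⁻¹ + z⁻¹).re := by
    rw [Complex.add_re]
    linarith [inv_re_pos hz]
  have key := integral_besselHeat_mul_cexp hν hz hwi.le hv
  have h1 : ∀ u : ℝ, besselHeat ν z u v * (((u ^ ν : ℝ) : ℂ) * heatCurve ν w u)
      = w ^ (-(ν + 1 : ℝ) : ℂ) * (besselHeat ν z u v * (((u ^ ν : ℝ) : ℂ)
        * Complex.exp (-w⁻¹ * u))) := by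
    intro u
    rw [heatCurve, show (-u / w : ℂ) = -w⁻¹ * u by field_simp]
    ring
  simp only [h1]
  rw [integral_const_mul, key, ← mul_cpow_of_re_pos hz hp,
    show z * (w⁻¹ + z⁻¹) = (w + z) * w⁻¹ by field_simp; ring,
    mul_cpow_of_re_pos hs hwi, inv_cpow_of_re_pos hw, heatCurve]
  have h2 : (-(v : ℂ) / z + v / (z ^ 2 * (w⁻¹ + z⁻¹))) = -v / (w + z) := by
    have h3 : w⁻¹ + z⁻¹ = (w + z) / (w * z) := by
      field_simp
      ring
    rw [h3]
    field_simp
    ring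
  have h4 : w ^ (-(ν + 1 : ℝ) : ℂ) ≠ 0 := by simp [Complex.cpow_eq_zero_iff, hw0]
  rw [h2]
  field_simp

/-- The case l = 0, where both the powers and the exponents cancel: the heat flow conserves mass. -/
theorem integral_besselHeat (hν : -1 / 2 < ν) {z : ℂ} (hz : 0 < z.re) {v : ℝ} (hv : 0 ≤ v) :
    ∫ u in Ioi (0 : ℝ), besselHeat ν z u v * ((u ^ ν : ℝ) : ℂ) = 1 := by
  have hz0 : z ≠ 0 := fun h => by simp [h] at hz
  have key := integral_besselHeat_mul_cexp hν hz (l := 0) (by simp) hv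
  simp only [neg_zero, zero_mul, Complex.exp_zero, mul_one, zero_add] at key
  have h1 : -(v : ℂ) / z + v / (z ^ 2 * z⁻¹) = 0 := by
    field_simp
    ring
  rw [key, ← mul_cpow_of_re_pos hz (inv_re_pos hz), mul_inv_cancel₀ hz0, Complex.one_cpow, h1]
  simp

/-- A Bochner integral with nonzero value forces integrability, so no separate integrability proof
is needed to pass to the Lebesgue integral. -/
theorem lintegral_ofReal_eq_of_integral_eq {Ω : Type*} [MeasurableSpace Ω] {μ : Measure Ω}
    {f : Ω → ℝ} {c : ℝ} (hf : 0 ≤ᵐ[μ] f) (hc : c ≠ 0) (h : ∫ x, (f x : ℂ) ∂μ = (c : ℂ)) :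
    ∫⁻ x, ENNReal.ofReal (f x) ∂μ = ENNReal.ofReal c := by
  rw [integral_complex_ofReal, Complex.ofReal_inj] at h
  have hi : Integrable f μ := by
    by_contra hn
    rw [integral_undef hn] at h
    exact hc h.symm
  rw [← ofReal_integral_eq_lintegral_ofReal hi hf, h]

theorem lintegral_besselHeatReal_mul_heatCurve (hν : -1 / 2 < ν) {t w : ℝ} (ht : 0 < t)
    (hw : 0 < w) {v : ℝ} (hv : 0 ≤ v) :
    ∫⁻ u in Ioi (0 : ℝ), ENNReal.ofReal (besselHeatReal ν t u v
        * (u ^ ν * (w ^ (-(ν + 1)) * Real.exp (-u / w))))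
      = ENNReal.ofReal ((w + t) ^ (-(ν + 1)) * Real.exp (-v / (w + t))) := by
  have hwt : 0 < w + t := by positivity
  refine lintegral_ofReal_eq_of_integral_eq ?_ (by positivity) ?_
  · filter_upwards [ae_restrict_mem measurableSet_Ioi] with u hu
    have hu' : 0 < u := hu
    have := besselHeatReal_nonneg hν ht u v
    change 0 ≤ _
    positivity
  · have key := integral_besselHeat_mul_heatCurve hν (z := t) (w := w) (by simpa) (by simpa) hv
    have h1 : ∀ {r : ℝ} (_ : 0 < r) (u : ℝ),
        heatCurve ν r u = ((r ^ (-(ν + 1)) * Real.exp (-u / r) : ℝ) : ℂ) := by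
      intro r hr u
      rw [heatCurve, Complex.ofReal_mul, Complex.ofReal_cpow hr.le]
      push_cast
      rfl
    rw [← Complex.ofReal_add, h1 hwt] at key
    rw [← key]
    refine integral_congr_ae (Eventually.of_forall fun u => ?_)
    simp only [h1 hw, besselHeat_ofReal ht]
    push_cast
    rfl

theorem lintegral_besselHeatReal (hν : -1 / 2 < ν) {t : ℝ} (ht : 0 < t) {v : ℝ} (hv : 0 ≤ v) :
    ∫⁻ u in Ioi (0 : ℝ), ENNReal.ofReal (besselHeatReal ν t u v * u ^ ν) = 1 := by
  rw [← ENNReal.ofReal_one]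
  refine lintegral_ofReal_eq_of_integral_eq ?_ one_ne_zero ?_
  · filter_upwards [ae_restrict_mem measurableSet_Ioi] with u hu
    have hu' : 0 < u := hu
    have := besselHeatReal_nonneg hν ht u v
    change 0 ≤ _
    positivity
  · rw [Complex.ofReal_one, ← integral_besselHeat hν (z := t) (by simpa) hv]
    refine integral_congr_ae (Eventually.of_forall fun u => ?_)
    simp only [besselHeat_ofReal ht]
    push_cast
    rfl

end BesselHeatKernel

/-! ### Power weights under the heat flow: the source of the operator bounds. -/

section PowerWeights

variable {ν : ℝ}

/-- The Gamma integral after w ↦ 1/w. It writes u^q with q < 0 as a superposition of the functions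
on which the kernel acts by translation. -/
theorem lintegral_rpow_mul_exp_neg_div {q : ℝ} (hq : q < 0) {u : ℝ} (hu : 0 < u) :
    ∫⁻ w in Ioi (0 : ℝ), ENNReal.ofReal (w ^ (q - 1) * Real.exp (-u / w))
      = ENNReal.ofReal (Real.Gamma (-q) * u ^ q) := by
  have hΓ : 0 < Real.Gamma (-q) := Real.Gamma_pos_of_pos (by linarith)
  have h1 := Real.integral_rpow_mul_exp_neg_mul_Ioi (a := -q) (by linarith) hu
  rw [← integral_comp_rpow_Ioi _ (show (-1 : ℝ) ≠ 0 by norm_num)] at h1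
  have h2 : ∫ w in Ioi (0 : ℝ), w ^ (q - 1) * Real.exp (-u / w) = Real.Gamma (-q) * u ^ q := by
    rw [one_div, Real.inv_rpow hu.le, Real.rpow_neg hu.le, inv_inv, mul_comm] at h1
    rw [← h1]
    refine setIntegral_congr_fun measurableSet_Ioi fun w hw => ?_
    have hw' : 0 < w := hw
    simp only [smul_eq_mul, Real.rpow_neg_one, abs_neg, abs_one, one_mul]
    rw [Real.inv_rpow hw'.le, ← Real.rpow_neg hw'.le, ← mul_assoc, ← Real.rpow_add hw']
    congr 2
    · ring
    · field_simp
  refine lintegral_ofReal_eq_of_integral_eq ?_ (by positivity) ?_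
  · filter_upwards [ae_restrict_mem measurableSet_Ioi] with w hw
    have hw' : 0 < w := hw
    change 0 ≤ _
    positivity
  · rw [integral_complex_ofReal, h2]

/-- Insert the superposition for u^q, exchange the integrals and translate w by t; only the density
w^(ν+q) stays unshifted. -/
theorem lintegral_besselHeatReal_mul_rpow (hν : -1 / 2 < ν) {q : ℝ} (hq : q < 0) {t : ℝ}
    (ht : 0 < t) {v : ℝ} (hv : 0 ≤ v) :
    ENNReal.ofReal (Real.Gamma (-q))
        * ∫⁻ u in Ioi (0 : ℝ), ENNReal.ofReal (besselHeatReal ν t u v * u ^ (ν + q))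
      = ∫⁻ w in Ioi (0 : ℝ), ENNReal.ofReal
        (w ^ (ν + q) * ((w + t) ^ (-(ν + 1)) * Real.exp (-v / (w + t)))) := by
  have hm : Measurable fun u => besselHeatReal ν t u v :=
    (measurable_besselHeatReal ht).of_uncurry_right
  have h1 : ∀ u ∈ Ioi (0 : ℝ), ENNReal.ofReal (Real.Gamma (-q))
        * ENNReal.ofReal (besselHeatReal ν t u v * u ^ (ν + q))
      = ∫⁻ w in Ioi (0 : ℝ), ENNReal.ofReal (w ^ (ν + q)) *
        ENNReal.ofReal (besselHeatReal ν t u v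
          * (u ^ ν * (w ^ (-(ν + 1)) * Real.exp (-u / w)))) := by
    intro u hu
    have hu' : 0 < u := hu
    have hH := besselHeatReal_nonneg hν ht u v
    have hΓ : 0 < Real.Gamma (-q) := Real.Gamma_pos_of_pos (by linarith)
    have e1 : Real.Gamma (-q) * (besselHeatReal ν t u v * u ^ (ν + q))
        = (besselHeatReal ν t u v * u ^ ν) * (Real.Gamma (-q) * u ^ q) := by
      rw [Real.rpow_add hu']
      ring
    rw [← ENNReal.ofReal_mul hΓ.le, e1, ENNReal.ofReal_mul (mul_nonneg hH (by positivity)),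
      ← lintegral_rpow_mul_exp_neg_div hq hu', ← lintegral_const_mul _ (by fun_prop)]
    refine setLIntegral_congr_fun measurableSet_Ioi fun w hw => ?_
    have hw' : 0 < w := hw
    rw [← ENNReal.ofReal_mul (by positivity), ← ENNReal.ofReal_mul (by positivity)]
    congr 1
    rw [show q - 1 = ν + q + -(ν + 1) by ring, Real.rpow_add hw' (ν + q)]
    ring
  rw [← lintegral_const_mul _ (by fun_prop), setLIntegral_congr_fun measurableSet_Ioi h1,
    lintegral_lintegral_swap]
  · refine setLIntegral_congr_fun measurableSet_Ioi fun w hw => ?_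
    have hw' : 0 < w := hw
    rw [lintegral_const_mul _ (by fun_prop), lintegral_besselHeatReal_mul_heatCurve hν ht hw' hv,
      ← ENNReal.ofReal_mul (by positivity)]
  · refine Measurable.aemeasurable ?_
    unfold Function.uncurry
    have hm' : Measurable fun p : ℝ × ℝ => besselHeatReal ν t p.1 v := hm.comp measurable_fst
    fun_prop

/-- Replacing w + t by w leaves the integral for v^q restricted to w > t. This is where the
excessive inequality becomes strict. -/
theorem lintegral_shift_rpow_mul_exp_le {q : ℝ} (hq : q < 0) {t v : ℝ} (ht : 0 < t)
    (hv : 0 < v) :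
    ∫⁻ w in Ioi (0 : ℝ), ENNReal.ofReal ((w + t) ^ (q - 1) * Real.exp (-v / (w + t)))
      ≤ ENNReal.ofReal (Real.Gamma (-q) * v ^ q) := by
  have h1 := (measurePreserving_add_right volume t).setLIntegral_comp_preimage_emb
    (measurableEmbedding_addRight t)
    (fun w => ENNReal.ofReal (w ^ (q - 1) * Real.exp (-v / w))) (Ioi t)
  rw [preimage_add_const_Ioi, sub_self] at h1
  rw [h1, ← lintegral_rpow_mul_exp_neg_div hq hv]
  exact lintegral_mono_set (Ioi_subset_Ioi ht.le)

/-- The weight `u^q` with `-ν ≤ q ≤ 0` is excessive for the Bessel heat kernel. -/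
theorem lintegral_besselHeatReal_mul_rpow_le (hν : -1 / 2 < ν) {q : ℝ} (hq : q ≤ 0)
    (hqν : 0 ≤ ν + q) {t v : ℝ} (ht : 0 < t) (hv : 0 < v) :
    ∫⁻ u in Ioi (0 : ℝ), ENNReal.ofReal (besselHeatReal ν t u v * u ^ (ν + q))
      ≤ ENNReal.ofReal (v ^ q) := by
  rcases hq.eq_or_lt with rfl | hq'
  · rw [add_zero, lintegral_besselHeatReal hν ht hv.le, Real.rpow_zero, ENNReal.ofReal_one]
  have hΓ : 0 < Real.Gamma (-q) := Real.Gamma_pos_of_pos (by linarith)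
  rw [← ENNReal.mul_le_mul_iff_right (a := ENNReal.ofReal (Real.Gamma (-q)))
    (by simpa using hΓ) ENNReal.ofReal_ne_top,
    lintegral_besselHeatReal_mul_rpow hν hq' ht hv.le, ← ENNReal.ofReal_mul hΓ.le]
  refine le_trans ?_ (lintegral_shift_rpow_mul_exp_le hq' ht hv)
  refine setLIntegral_mono (by fun_prop) fun w hw => ENNReal.ofReal_le_ofReal ?_
  have hw' : 0 < w := hw
  rw [show q - 1 = ν + q + -(ν + 1) by ring,
    Real.rpow_add (show 0 < w + t by positivity) (ν + q), mul_assoc]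
  gcongr
  linarith

/-- Raise x ≤ 2a e^(x/(2a)) to the power a. -/
theorem rpow_mul_exp_neg_half_le {a x : ℝ} (ha : 0 < a) (hx : 0 ≤ x) :
    x ^ a * Real.exp (-(x / 2)) ≤ (2 * a) ^ a := by
  have h1 : x ≤ 2 * a * Real.exp (x / (2 * a)) := by
    have := Real.add_one_le_exp (x / (2 * a))
    calc x = 2 * a * (x / (2 * a)) := by field_simp
      _ ≤ _ := by gcongr; linarith
  calc x ^ a * Real.exp (-(x / 2))
      ≤ (2 * a * Real.exp (x / (2 * a))) ^ a * Real.exp (-(x / 2)) := by gcongr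
    _ = (2 * a) ^ a * (Real.exp (x / 2) * Real.exp (-(x / 2))) := by
        rw [Real.mul_rpow (by positivity) (Real.exp_pos _).le, ← Real.exp_mul, mul_assoc]
        congr 3
        field_simp
    _ = _ := by rw [← Real.exp_add]; simp

/-- The weights `u^q` with `-ν - 1 < q ≤ 0` are almost excessive for the Bessel heat kernel. -/
theorem exists_lintegral_besselHeatReal_mul_rpow_le (hν : 0 < ν) {q : ℝ} (hq : q ≤ 0)
    (hqν : -1 < ν + q) :
    ∃ C : ℝ, 0 ≤ C ∧ (0 ≤ ν + q → C = 1) ∧ ∀ t v : ℝ, 0 < t → 0 < v →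
      ∫⁻ u in Ioi (0 : ℝ), ENNReal.ofReal (besselHeatReal ν t u v * u ^ (ν + q))
        ≤ ENNReal.ofReal (C * v ^ q) := by
  have hν' : -1 / 2 < ν := by linarith
  rcases le_or_gt 0 (ν + q) with h0 | h0
  · refine ⟨1, zero_le_one, fun _ => rfl, fun t v ht hv => ?_⟩
    rw [one_mul]
    exact lintegral_besselHeatReal_mul_rpow_le hν' hq h0 ht hv
  have hq' : q < 0 := by linarith
  have hΓ : 0 < Real.Gamma (-q) := Real.Gamma_pos_of_pos (by linarith)
  refine ⟨2 ^ (-(ν + q)) + (Real.Gamma (-q))⁻¹ * ((2 * -q) ^ (-q) / (ν + q + 1)), ?_,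
    fun h => absurd h (not_le.2 h0), fun t v ht hv => ?_⟩
  · have h1 : 0 < ν + q + 1 := by linarith
    have h2 : 0 < 2 * -q := by linarith
    positivity
  rw [← ENNReal.mul_le_mul_iff_right (a := ENNReal.ofReal (Real.Gamma (-q)))
    (by simpa using hΓ) ENNReal.ofReal_ne_top,
    lintegral_besselHeatReal_mul_rpow hν' hq' ht hv.le, ← ENNReal.ofReal_mul hΓ.le]
  -- The density is now decreasing. For w > t, w ≥ (w + t)/2 costs the factor 2^(−(ν+q)). For w ≤ t,
  -- the shifted factors are bounded by t^(−ν−1) e^(−v/(2t)), and w^(ν+q) is integrable at 0 since ν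
  -- + q > −1.
  have h1 : ∀ w ∈ Ioi (0 : ℝ), ENNReal.ofReal
        (w ^ (ν + q) * ((w + t) ^ (-(ν + 1)) * Real.exp (-v / (w + t))))
      ≤ ENNReal.ofReal (2 ^ (-(ν + q))) *
          ENNReal.ofReal ((w + t) ^ (q - 1) * Real.exp (-v / (w + t)))
        + (Ioc 0 t).indicator (fun w => ENNReal.ofReal (t ^ (-(ν + 1)) * Real.exp (-(v / t / 2)))
          * ENNReal.ofReal (w ^ (ν + q))) w := by
    intro w hw
    have hw' : 0 < w := hw
    rcases le_or_gt w t with hwt | hwt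
    · rw [indicator_of_mem (by exact ⟨hw', hwt⟩)]
      refine le_add_left ?_
      rw [← ENNReal.ofReal_mul (by positivity), mul_comm (w ^ (ν + q))]
      refine ENNReal.ofReal_le_ofReal ?_
      gcongr ?_ * ?_ * _
      · rw [Real.rpow_neg (by positivity), Real.rpow_neg (by positivity)]
        gcongr
        linarith
      · refine Real.exp_le_exp.2 ?_
        rw [neg_div, neg_le_neg_iff, div_div]
        gcongr
        linarith
    · refine le_add_right ?_
      rw [← ENNReal.ofReal_mul (by positivity)]
      refine ENNReal.ofReal_le_ofReal ?_
      rw [show q - 1 = ν + q + -(ν + 1) by ring,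
        Real.rpow_add (show 0 < w + t by positivity) (ν + q), ← mul_assoc,
        ← mul_assoc, ← mul_assoc]
      gcongr ?_ * _ * _
      rw [Real.rpow_neg zero_le_two, inv_mul_eq_div, ← Real.div_rpow (by positivity) zero_le_two]
      exact Real.rpow_le_rpow_of_nonpos (by positivity) (by linarith) h0.le
  refine (setLIntegral_mono' measurableSet_Ioi h1).trans ?_
  rw [lintegral_add_left (by fun_prop), lintegral_const_mul _ (by fun_prop),
    lintegral_indicator measurableSet_Ioc,
    Measure.restrict_restrict_of_subset Ioc_subset_Ioi_self, lintegral_const_mul _ (by fun_prop)]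
  have h2 : ∫⁻ w in Ioc 0 t, ENNReal.ofReal (w ^ (ν + q))
      = ENNReal.ofReal (t ^ (ν + q + 1) / (ν + q + 1)) := by
    rw [← ofReal_integral_eq_lintegral_ofReal]
    · rw [← intervalIntegral.integral_of_le ht.le, integral_rpow (Or.inl hqν),
        Real.zero_rpow (by linarith), sub_zero]
    · exact (intervalIntegral.intervalIntegrable_rpow' hqν).1
    · filter_upwards [ae_restrict_mem measurableSet_Ioc] with w hw
      exact Real.rpow_nonneg hw.1.le _
  have h5 : 0 < ν + q + 1 := by linarith
  rw [h2, ← ENNReal.ofReal_mul (by positivity)]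
  -- The part w ≤ t contributes a multiple of t^q e^(−v/(2t)), which is at most a constant times
  -- v^q.
  have h3 : t ^ (-(ν + 1)) * Real.exp (-(v / t / 2)) * (t ^ (ν + q + 1) / (ν + q + 1))
      ≤ (2 * -q) ^ (-q) / (ν + q + 1) * v ^ q := by
    have h4 := rpow_mul_exp_neg_half_le (a := -q) (x := v / t) (by linarith) (by positivity)
    have e1 : t ^ (-(ν + 1)) * t ^ (ν + q + 1) = v ^ q * (v / t) ^ (-q) := by
      rw [← Real.rpow_add ht, Real.div_rpow hv.le ht.le, Real.rpow_neg hv.le, Real.rpow_neg ht.le]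
      have : v ^ q ≠ 0 := by positivity
      field_simp
      congr 1
      ring
    calc _ = t ^ (-(ν + 1)) * t ^ (ν + q + 1) * (Real.exp (-(v / t / 2)) / (ν + q + 1)) := by ring
      _ = v ^ q * ((v / t) ^ (-q) * Real.exp (-(v / t / 2))) / (ν + q + 1) := by rw [e1]; ring
      _ ≤ v ^ q * ((2 * -q) ^ (-q)) / (ν + q + 1) := by gcongr
      _ = _ := by ring
  calc _ ≤ ENNReal.ofReal (2 ^ (-(ν + q))) * ENNReal.ofReal (Real.Gamma (-q) * v ^ q)
        + ENNReal.ofReal ((2 * -q) ^ (-q) / (ν + q + 1) * v ^ q) := by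
        gcongr
        exact lintegral_shift_rpow_mul_exp_le hq' ht hv
    _ = _ := by
        have h6 : 0 < 2 * -q := by linarith
        rw [← ENNReal.ofReal_mul (by positivity), ← ENNReal.ofReal_add (by positivity)
          (by positivity)]
        congr 1
        field_simp

end PowerWeights

/-! ### Integrals with respect to x^m dx. -/

section WeightedMeasure

instance (m : ℝ) : SFinite (wMeasure m) := by
  unfold wMeasure
  infer_instance

theorem lintegral_wMeasure (m : ℝ) (f : ℝ → ENNReal) :
    ∫⁻ x, f x ∂(wMeasure m) = ∫⁻ x in Ioi (0 : ℝ), ENNReal.ofReal (x ^ m) * f x := by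
  unfold wMeasure
  rw [lintegral_withDensity_eq_lintegral_mul_non_measurable _ (by fun_prop)
    (Eventually.of_forall fun x => ENNReal.ofReal_lt_top)]
  rfl

theorem integral_wMeasure (m : ℝ) {E : Type*} [NormedAddCommGroup E] [NormedSpace ℝ E]
    (f : ℝ → E) : ∫ x, f x ∂(wMeasure m) = ∫ x in Ioi (0 : ℝ), x ^ m • f x := by
  unfold wMeasure
  rw [integral_withDensity_eq_integral_toReal_smul (by fun_prop)
    (Eventually.of_forall fun x => ENNReal.ofReal_lt_top)]
  refine setIntegral_congr_fun measurableSet_Ioi fun x hx => ?_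
  have hx' : 0 < x := hx
  rw [ENNReal.toReal_ofReal (by positivity)]

theorem integrable_wMeasure_iff (m : ℝ) {E : Type*} [NormedAddCommGroup E] [NormedSpace ℝ E]
    (f : ℝ → E) :
    Integrable f (wMeasure m) ↔ IntegrableOn (fun x => x ^ m • f x) (Ioi 0) := by
  unfold wMeasure
  rw [integrable_withDensity_iff_integrable_smul' (by fun_prop)
    (Eventually.of_forall fun x => ENNReal.ofReal_lt_top)]
  refine integrableOn_congr_fun (fun x hx => ?_) measurableSet_Ioi
  have hx' : 0 < x := hx
  rw [ENNReal.toReal_ofReal (by positivity)]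

theorem ae_wMeasure_of_pos {m : ℝ} {p : ℝ → Prop} (h : ∀ x, 0 < x → p x) :
    ∀ᵐ x ∂(wMeasure m), p x :=
  ae_wMeasure_iff.2 ((ae_restrict_mem measurableSet_Ioi).mono h)

end WeightedMeasure

/-! ### The substitution u = x^σ/σ². -/

section ChangeOfVariables

/-- The variable `u = x^σ / σ²` in which the operator becomes `u ∂² + (1 + ν) ∂`. -/
def heatVar (σ x : ℝ) : ℝ := x ^ σ / σ ^ 2

/-- The derivative of `heatVar`. -/
def heatVarDeriv (σ x : ℝ) : ℝ := x ^ (σ - 1) / σ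

variable {σ : ℝ}

theorem heatVar_pos (hσ : 0 < σ) {x : ℝ} (hx : 0 < x) : 0 < heatVar σ x := by
  unfold heatVar
  positivity

theorem heatVarDeriv_pos (hσ : 0 < σ) {x : ℝ} (hx : 0 < x) : 0 < heatVarDeriv σ x := by
  unfold heatVarDeriv
  positivity

@[fun_prop]
theorem measurable_heatVar : Measurable (heatVar σ) := by
  unfold heatVar
  fun_prop

@[fun_prop]
theorem measurable_heatVarDeriv : Measurable (heatVarDeriv σ) := by
  unfold heatVarDeriv
  fun_prop

theorem hasDerivAt_heatVar (hσ : 0 < σ) {x : ℝ} (hx : 0 < x) :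
    HasDerivAt (heatVar σ) (heatVarDeriv σ x) x := by
  have := (Real.hasDerivAt_rpow_const (p := σ) (Or.inl hx.ne')).div_const (σ ^ 2)
  have e : σ * x ^ (σ - 1) / σ ^ 2 = heatVarDeriv σ x := by
    unfold heatVarDeriv
    field_simp
  rwa [e] at this

theorem injOn_heatVar (hσ : 0 < σ) : InjOn (heatVar σ) (Ioi 0) := by
  intro x hx y hy h
  have hx' : 0 < x := hx
  have hy' : 0 < y := hy
  unfold heatVar at h
  rw [div_left_inj' (by positivity)] at h
  exact Real.rpow_left_injOn hσ.ne' hx'.le hy'.le h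

theorem image_heatVar (hσ : 0 < σ) : heatVar σ '' Ioi 0 = Ioi 0 := by
  ext u
  constructor
  · rintro ⟨x, hx, rfl⟩
    exact heatVar_pos hσ hx
  · intro hu
    have hu' : 0 < u := hu
    refine ⟨(σ ^ 2 * u) ^ σ⁻¹, Real.rpow_pos_of_pos (by positivity) _, ?_⟩
    unfold heatVar
    rw [Real.rpow_inv_rpow (by positivity) hσ.ne']
    field_simp

theorem lintegral_comp_heatVar (hσ : 0 < σ) (f : ℝ → ENNReal) :
    ∫⁻ x in Ioi (0 : ℝ), ENNReal.ofReal (heatVarDeriv σ x) * f (heatVar σ x)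
      = ∫⁻ u in Ioi (0 : ℝ), f u := by
  conv_rhs => rw [← image_heatVar hσ, lintegral_image_eq_lintegral_abs_deriv_mul measurableSet_Ioi
    (fun x hx => (hasDerivAt_heatVar hσ hx).hasDerivWithinAt) (injOn_heatVar hσ)]
  refine setLIntegral_congr_fun measurableSet_Ioi fun x hx => ?_
  rw [abs_of_pos (heatVarDeriv_pos hσ hx)]

theorem integral_comp_heatVar (hσ : 0 < σ) (f : ℝ → ℂ) :
    ∫ x in Ioi (0 : ℝ), heatVarDeriv σ x • f (heatVar σ x) = ∫ u in Ioi (0 : ℝ), f u := by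
  conv_rhs => rw [← image_heatVar hσ, integral_image_eq_integral_abs_deriv_smul measurableSet_Ioi
    (fun x hx => (hasDerivAt_heatVar hσ hx).hasDerivWithinAt) (injOn_heatVar hσ)]
  refine setIntegral_congr_fun measurableSet_Ioi fun x hx => ?_
  rw [abs_of_pos (heatVarDeriv_pos hσ hx)]

theorem heatVar_rpow (hσ : 0 < σ) {x : ℝ} (hx : 0 < x) (p : ℝ) :
    heatVar σ x ^ p = x ^ (σ * p) * σ ^ (-(2 * p)) := by
  unfold heatVar
  rw [Real.div_rpow (by positivity) (by positivity), ← Real.rpow_mul hx.le, ← Real.rpow_natCast,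
    ← Real.rpow_mul hσ.le, Real.rpow_neg hσ.le]
  push_cast
  rfl

/-- The measure x^(σp+σ−1) dx is a constant multiple of u^p du. Power weights are transferred
between x and u by this identity. -/
theorem rpow_eq_heatVar (hσ : 0 < σ) {x : ℝ} (hx : 0 < x) (p : ℝ) :
    x ^ (σ * p + σ - 1) = σ ^ (2 * p + 1) * (heatVar σ x ^ p * heatVarDeriv σ x) := by
  rw [heatVar_rpow hσ hx, heatVarDeriv, Real.rpow_neg hσ.le,
    Real.rpow_add_one hσ.ne', show σ * p + σ - 1 = σ * p + (σ - 1) by ring, Real.rpow_add hx]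
  field_simp

end ChangeOfVariables

/-! ### The semigroup kernel in the original variable. -/

section Kernel

/-- The kernel of the semigroup with respect to the measure `x^n dx`. -/
def semigroupKernel (σ d k n : ℝ) (z : ℂ) (x y : ℝ) : ℂ :=
  ((σ ^ (-(2 * (d / σ) + 1)) * x ^ k * y ^ (σ - 1 + d - k - n) : ℝ) : ℂ)
    * besselHeat (d / σ) z (heatVar σ x) (heatVar σ y)

/-- The curve `w ↦ x^k w^{-ν-1} e^{-x^σ / (σ² w)}`, as functions on the half-line. -/
def curveFun (σ d k : ℝ) (w : ℂ) (x : ℝ) : ℂ :=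
  ((x ^ k : ℝ) : ℂ) * heatCurve (d / σ) w (heatVar σ x)

variable {σ d k n : ℝ}

theorem measurable_semigroupKernel (z : ℂ) :
    Measurable (Function.uncurry (semigroupKernel σ d k n z)) := by
  have h := (measurable_besselHeat (ν := d / σ) z).comp (by fun_prop :
      Measurable fun p : ℝ × ℝ => (heatVar σ p.1, heatVar σ p.2))
  simp only [Function.comp_def, Function.uncurry_apply_pair] at h
  unfold semigroupKernel Function.uncurry
  fun_prop

/-- The powers of y in the kernel are chosen so that, against x^n dx and the factor y^k of the
curve, exactly the measure u^ν du remains; the statement is then the translation property in u. -/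
theorem integral_semigroupKernel_mul_curveFun (hσ : 0 < σ) (hd : 0 < d) {z w : ℂ}
    (hz : 0 < z.re) (hw : 0 < w.re) {x : ℝ} (hx : 0 < x) :
    ∫ y, semigroupKernel σ d k n z x y * curveFun σ d k w y ∂(wMeasure n)
      = curveFun σ d k (w + z) x := by
  have hν : -1 / 2 < d / σ := by
    have : 0 < d / σ := by positivity
    linarith
  have hU := heatVar_pos hσ hx
  have key := integral_besselHeat_mul_heatCurve hν hz hw hU.le
  rw [← integral_comp_heatVar hσ] at key
  rw [integral_wMeasure, curveFun, ← key, ← integral_const_mul]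
  refine setIntegral_congr_fun measurableSet_Ioi fun y hy => ?_
  have hy' : 0 < y := hy
  simp only [semigroupKernel, curveFun, Complex.real_smul]
  rw [besselHeat_comm]
  have e1 : σ ^ (-(2 * (d / σ) + 1)) * (y ^ n * y ^ (σ - 1 + d - k - n) * y ^ k)
      = heatVarDeriv σ y * heatVar σ y ^ (d / σ) := by
    rw [← Real.rpow_add hy', ← Real.rpow_add hy',
      show n + (σ - 1 + d - k - n) + k = σ * (d / σ) + σ - 1 by field_simp; ring,
      rpow_eq_heatVar hσ hy', ← mul_assoc, ← Real.rpow_add hσ, neg_add_cancel, Real.rpow_zero]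
    ring
  have e2 := congrArg (fun r : ℝ => (r : ℂ)) e1
  simp only [Complex.ofReal_mul] at e2 ⊢
  linear_combination ((x ^ k : ℝ) : ℂ) * besselHeat (d / σ) z (heatVar σ y) (heatVar σ x)
    * heatCurve (d / σ) w (heatVar σ y) * e2

/-- The columns of the kernel are bounded in `L¹`, uniformly on sectors. -/
theorem exists_lintegral_semigroupKernel_le (hσ : 0 < σ) (hd : 0 < d) (hk : -1 < n + k)
    (hn : n ≤ σ - 1 + d - k) :
    ∃ C : ℝ, 0 ≤ C ∧ (σ - 1 - k ≤ n → C = 1) ∧ ∀ z : ℂ, 0 < z.re → ∀ y : ℝ, 0 < y →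
      ∫⁻ x, ‖semigroupKernel σ d k n z x y‖ₑ ∂(wMeasure n)
        ≤ ENNReal.ofReal (C * (‖z‖ / z.re) ^ (d / σ + 1)) := by
  have hν : 0 < d / σ := by positivity
  have hν' : -1 / 2 < d / σ := by linarith
  -- With this q, x^(n+k) dx is a multiple of u^(ν+q) du, and the kernel's factor y^(σ−1+d−k−n) =
  -- y^(−σq) cancels the resulting v^q. The lower bound on n gives ν + q > −1, the upper bound gives
  -- q ≤ 0, and ν + q ≥ 0 amounts to n ≥ n_*^-.
  set q : ℝ := (n - (σ - 1 + d - k)) / σ with hq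
  have hq0 : q ≤ 0 := div_nonpos_of_nonpos_of_nonneg (by linarith) hσ.le
  have hp : d / σ + q = (n + k + 1) / σ - 1 := by
    rw [hq]
    field_simp
    ring
  have hp' : -1 < d / σ + q := by
    rw [hp]
    have : 0 < (n + k + 1) / σ := div_pos (by linarith) hσ
    linarith
  obtain ⟨C, hC0, hC1, hC⟩ := exists_lintegral_besselHeatReal_mul_rpow_le hν hq0 hp'
  refine ⟨C, hC0, fun h => hC1 ?_, fun z hz y hy => ?_⟩
  · rw [hp, sub_nonneg, le_div_iff₀ hσ]
    linarith
  have hz0 : 0 < ‖z‖ := norm_pos_iff.2 fun h => by simp [h] at hz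
  set t : ℝ := ‖z‖ ^ 2 / z.re with ht
  have ht0 : 0 < t := by positivity
  set M : ℝ := (‖z‖ / z.re) ^ (d / σ + 1) with hM
  have hM0 : 0 ≤ M := by positivity
  set A : ℝ := σ ^ (-(2 * (d / σ) + 1)) * y ^ (σ - 1 + d - k - n) * M * σ ^ (2 * (d / σ + q) + 1)
    with hA
  have hA0 : 0 ≤ A := by positivity
  have h1 : ∀ x ∈ Ioi (0 : ℝ), ENNReal.ofReal (x ^ n) * ‖semigroupKernel σ d k n z x y‖ₑ
      ≤ ENNReal.ofReal A * (ENNReal.ofReal (heatVarDeriv σ x) *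
        ENNReal.ofReal (besselHeatReal (d / σ) t (heatVar σ x) (heatVar σ y)
          * heatVar σ x ^ (d / σ + q))) := by
    intro x hx
    have hx' : 0 < x := hx
    have hH := besselHeatReal_nonneg hν' ht0 (heatVar σ x) (heatVar σ y)
    have hU := heatVar_pos hσ hx'
    have hU' := heatVarDeriv_pos hσ hx'
    rw [← ENNReal.ofReal_mul hU'.le, ← ENNReal.ofReal_mul hA0, ← ofReal_norm,
      ← ENNReal.ofReal_mul (by positivity)]
    refine ENNReal.ofReal_le_ofReal ?_
    rw [semigroupKernel, norm_mul, Complex.norm_of_nonneg (by positivity)]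
    have e1 : x ^ n * x ^ k
        = σ ^ (2 * (d / σ + q) + 1) * (heatVar σ x ^ (d / σ + q) * heatVarDeriv σ x) := by
      rw [← rpow_eq_heatVar hσ hx', ← Real.rpow_add hx', hp]
      congr 1
      field_simp
      ring
    calc _ ≤ x ^ n * (σ ^ (-(2 * (d / σ) + 1)) * x ^ k * y ^ (σ - 1 + d - k - n)
          * (M * besselHeatReal (d / σ) t (heatVar σ x) (heatVar σ y))) := by
          gcongr
          exact norm_besselHeat_le hν' hz _ _
      _ = σ ^ (-(2 * (d / σ) + 1)) * y ^ (σ - 1 + d - k - n)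
          * (M * besselHeatReal (d / σ) t (heatVar σ x) (heatVar σ y)) * (x ^ n * x ^ k) := by
          ring
      _ = _ := by rw [e1, hA]; ring
  rw [lintegral_wMeasure]
  refine (setLIntegral_mono' measurableSet_Ioi h1).trans ?_
  have hm : Measurable fun x => besselHeatReal (d / σ) t (heatVar σ x) (heatVar σ y) :=
    ((measurable_besselHeatReal ht0).of_uncurry_right (y := heatVar σ y)).comp measurable_heatVar
  rw [lintegral_const_mul _ (by fun_prop), lintegral_comp_heatVar hσ fun u =>
    ENNReal.ofReal (besselHeatReal (d / σ) t u (heatVar σ y) * u ^ (d / σ + q))]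
  refine (mul_le_mul_right (hC t _ ht0 (heatVar_pos hσ hy)) _).trans_eq ?_
  rw [← ENNReal.ofReal_mul hA0]
  congr 1
  have e2 : y ^ (σ - 1 + d - k - n) * y ^ (σ * q) = 1 := by
    rw [← Real.rpow_add hy, hq]
    rw [show σ - 1 + d - k - n + σ * ((n - (σ - 1 + d - k)) / σ) = 0 by field_simp; ring,
      Real.rpow_zero]
  have e3 : σ ^ (-(2 * (d / σ) + 1)) * σ ^ (2 * (d / σ + q) + 1) * σ ^ (-(2 * q)) = 1 := by
    rw [← Real.rpow_add hσ, ← Real.rpow_add hσ]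
    rw [show -(2 * (d / σ) + 1) + (2 * (d / σ + q) + 1) + -(2 * q) = 0 by ring, Real.rpow_zero]
  rw [heatVar_rpow hσ hy, hA]
  calc _ = C * M * (y ^ (σ - 1 + d - k - n) * y ^ (σ * q))
        * (σ ^ (-(2 * (d / σ) + 1)) * σ ^ (2 * (d / σ + q) + 1) * σ ^ (-(2 * q))) := by ring
    _ = C * M := by rw [e2, e3]; ring

end Kernel

/-! ### Density of exponentials in the weighted space. -/

section Density

/-- The map t = e^(−x^σ) carries (0, ∞) to (0, 1). In the variable t a compactly supported function
extends continuously by 0 to t = 0, so Weierstrass approximation on [0, 1] applies. -/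
theorem exists_polynomial_exp_neg_rpow_near {σ : ℝ} (hσ : 0 < σ) {φ : ℝ → ℝ} (hφ : Continuous φ)
    (hc : HasCompactSupport φ) {ε : ℝ} (hε : 0 < ε) :
    ∃ p : Polynomial ℝ, ∀ x : ℝ, 0 < x → |p.eval (Real.exp (-x ^ σ)) - φ x| < ε := by
  set ψ : ℝ → ℝ := fun t => if t ≤ 0 then 0 else φ ((-Real.log t) ^ σ⁻¹) with hψ
  have hψc : ContinuousOn ψ (Icc 0 1) := by
    refine fun t ht => ContinuousAt.continuousWithinAt ?_
    rcases ht.1.eq_or_lt with rfl | ht0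
    · have h1 : Tendsto (fun t : ℝ => (-Real.log t) ^ σ⁻¹) (𝓝[>] 0) atTop :=
        (tendsto_rpow_atTop (inv_pos.2 hσ)).comp
          (tendsto_neg_atBot_atTop.comp Real.tendsto_log_nhdsGT_zero)
      have h2 : ∀ᶠ x in atTop, φ x = 0 := by
        have := hasCompactSupport_iff_eventuallyEq.1 hc
        rw [coclosedCompact_eq_cocompact, cocompact_eq_atBot_atTop] at this
        exact this.filter_mono le_sup_right
      have h3 := eventually_nhdsWithin_iff.1 (h1.eventually h2)
      refine (continuousAt_const (y := (0 : ℝ))).congr ?_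
      filter_upwards [h3] with t ht
      rcases le_or_gt t 0 with h | h
      · simp [hψ, h]
      · simp [hψ, not_le.2 h, ht h]
    · have h1 : ContinuousAt (fun t : ℝ => φ ((-Real.log t) ^ σ⁻¹)) t := by
        refine hφ.continuousAt.comp ?_
        exact (Real.continuousAt_log ht0.ne').neg.rpow_const (Or.inr (inv_pos.2 hσ).le)
      refine h1.congr ?_
      filter_upwards [lt_mem_nhds ht0] with s hs
      simp [hψ, not_le.2 hs]
  obtain ⟨p, hp⟩ := exists_polynomial_near_of_continuousOn 0 1 ψ hψc ε hε
  refine ⟨p, fun x hx => ?_⟩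
  have h1 := hp (Real.exp (-x ^ σ)) ⟨(Real.exp_pos _).le, by
    rw [Real.exp_le_one_iff, neg_nonpos]
    positivity⟩
  have h2 : ψ (Real.exp (-x ^ σ)) = φ x := by
    simp only [hψ, not_le.2 (Real.exp_pos _), if_false, Real.log_exp, neg_neg]
    rw [Real.rpow_rpow_inv hx.le hσ.ne']
  rwa [h2] at h1

theorem integrable_rpow_mul_exp_neg_rpow {σ k n c : ℝ} (hσ : 0 < σ) (hk : -1 < n + k)
    (hc : 0 < c) :
    Integrable (fun x : ℝ => x ^ k * Real.exp (-c * x ^ σ)) (wMeasure n) := by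
  rw [integrable_wMeasure_iff]
  refine (integrableOn_rpow_mul_exp_neg_mul_rpow hk hσ hc).congr_fun (fun x hx => ?_)
    measurableSet_Ioi
  have hx' : 0 < x := hx
  simp only [smul_eq_mul]
  rw [Real.rpow_add hx', mul_assoc]

/-- The functions `x^k e^{-j x^σ}`, `j = 1, 2, …`, have dense span in `L¹(x^n dx)`. -/
theorem dense_of_exp_neg_rpow {σ k n : ℝ} (hσ : 0 < σ) (hk : -1 < n + k)
    {S : Submodule ℂ (X n)}
    (hS : ∀ (j : ℕ) (c : ℂ), ∃ g ∈ S, g =ᵐ[wMeasure n]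
      fun x => c * ((x ^ k * Real.exp (-(j + 1) * x ^ σ) : ℝ) : ℂ)) :
    Dense (S : Set (X n)) := by
  set ρ : ℝ → ℝ := fun x => x ^ k * Real.exp (-1 * x ^ σ) with hρ
  have hρm : Measurable ρ := by fun_prop
  have hρi : Integrable ρ (wMeasure n) := integrable_rpow_mul_exp_neg_rpow hσ hk one_pos
  have hρ0 : ∀ x, 0 < x → 0 < ρ x := fun x hx => by positivity
  -- The factor ρ already carries one e^(−x^σ), so the monomial of degree j corresponds to the
  -- exponent j + 1.
  have hpoly : ∀ (p : Polynomial ℝ) (c : ℂ), ∃ g ∈ S, g =ᵐ[wMeasure n]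
      fun x => c * ((ρ x * p.eval (Real.exp (-x ^ σ)) : ℝ) : ℂ) := by
    intro p c
    induction p using Polynomial.induction_on' with
    | add p q hp hq =>
      obtain ⟨g, hg, hg'⟩ := hp
      obtain ⟨h, hh, hh'⟩ := hq
      refine ⟨g + h, S.add_mem hg hh, ?_⟩
      filter_upwards [Lp.coeFn_add g h, hg', hh'] with x h1 h2 h3
      rw [h1, Pi.add_apply, h2, h3, Polynomial.eval_add]
      push_cast
      ring
    | monomial j a =>
      obtain ⟨g, hg, hg'⟩ := hS j (c * a)
      refine ⟨g, hg, ?_⟩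
      filter_upwards [hg'] with x hx
      rw [hx, Polynomial.eval_monomial, ← Real.exp_nat_mul]
      have e1 : ρ x * (a * Real.exp (j * -x ^ σ))
          = a * (x ^ k * Real.exp (-(j + 1) * x ^ σ)) := by
        rw [hρ, show -((j : ℝ) + 1) * x ^ σ = -1 * x ^ σ + j * -x ^ σ by ring, Real.exp_add]
        ring
      rw [e1]
      push_cast
      ring
  have hfin : IsFiniteMeasure ((wMeasure n).withDensity fun x => ENNReal.ofReal (ρ x)) :=
    isFiniteMeasure_withDensity_ofReal hρi.2
  have hint : ∀ f : ℝ → ℂ, Integrable f ((wMeasure n).withDensity fun x => ENNReal.ofReal (ρ x)) ↔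
      Integrable (fun x => (ρ x : ℂ) * f x) (wMeasure n) := by
    intro f
    rw [integrable_withDensity_iff_integrable_smul' (by fun_prop)
      (Eventually.of_forall fun x => ENNReal.ofReal_lt_top)]
    refine integrable_congr (ae_wMeasure_of_pos fun x hx => ?_)
    simp only
    rw [ENNReal.toReal_ofReal (hρ0 x hx).le, Complex.real_smul]
  rw [Metric.dense_iff]
  intro f r hr
  set W : ℝ := ∫ x, ρ x ∂(wMeasure n) with hW
  have hW0 : 0 ≤ W := integral_nonneg_of_ae (ae_wMeasure_of_pos fun x hx => (hρ0 x hx).le)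
  -- The error is δ from approximating f/ρ in L¹(ρ x^n dx) by a compactly supported function, plus
  -- 2δW from approximating its real and imaginary parts by polynomials: r/2 in total.
  set δ : ℝ := r / (2 * (1 + 2 * W)) with hδ
  have hδ0 : 0 < δ := by positivity
  have hfρ : Integrable (fun x => f x / (ρ x : ℂ))
      ((wMeasure n).withDensity fun x => ENNReal.ofReal (ρ x)) := by
    rw [hint]
    refine f.integrable.congr (ae_wMeasure_of_pos fun x hx => ?_)
    have : (ρ x : ℂ) ≠ 0 := by exact_mod_cast (hρ0 x hx).ne'
    field_simp
  obtain ⟨φ, hφc, hφ, hφcont, hφi⟩ := hfρ.exists_hasCompactSupport_integral_sub_le hδ0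
  obtain ⟨p, hp⟩ := exists_polynomial_exp_neg_rpow_near hσ (Complex.continuous_re.comp hφcont)
    (hφc.comp_left rfl) hδ0
  obtain ⟨q, hq⟩ := exists_polynomial_exp_neg_rpow_near hσ (Complex.continuous_im.comp hφcont)
    (hφc.comp_left rfl) hδ0
  obtain ⟨g, hg, hg'⟩ := hpoly p 1
  obtain ⟨h, hh, hh'⟩ := hpoly q Complex.I
  refine ⟨g + h, ?_, S.add_mem hg hh⟩
  rw [mem_ball_iff_norm', L1.norm_eq_integral_norm]
  have h1 : ∫ x, ‖f x - ρ x * φ x‖ ∂(wMeasure n) ≤ δ := by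
    rw [integral_withDensity_eq_integral_toReal_smul (by fun_prop)
      (Eventually.of_forall fun x => ENNReal.ofReal_lt_top)] at hφ
    refine le_of_eq_of_le (integral_congr_ae (ae_wMeasure_of_pos fun x hx => ?_)) hφ
    have hne : (ρ x : ℂ) ≠ 0 := by exact_mod_cast (hρ0 x hx).ne'
    simp only [smul_eq_mul]
    rw [ENNReal.toReal_ofReal (hρ0 x hx).le, ← Complex.norm_of_nonneg (hρ0 x hx).le, ← norm_mul,
      Complex.norm_of_nonneg (hρ0 x hx).le]
    congr 1
    field_simp
  have h2 : ∀ᵐ x ∂(wMeasure n), ‖(f - (g + h) : X n) x‖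
      ≤ ‖f x - ρ x * φ x‖ + ρ x * (2 * δ) := by
    filter_upwards [Lp.coeFn_sub f (g + h), Lp.coeFn_add g h, hg', hh',
      ae_wMeasure_of_pos (m := n) (p := fun x => 0 < x) fun x hx => hx] with x e1 e2 e3 e4 hx
    rw [e1, Pi.sub_apply, e2, Pi.add_apply, e3, e4]
    have hφx : φ x = ((φ x).re : ℂ) + Complex.I * ((φ x).im : ℂ) := by
      rw [mul_comm, Complex.re_add_im]
    have e5 : f x - (1 * ((ρ x * p.eval (Real.exp (-x ^ σ)) : ℝ) : ℂ)
        + Complex.I * ((ρ x * q.eval (Real.exp (-x ^ σ)) : ℝ) : ℂ))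
        = (f x - ρ x * φ x) - ρ x * (((p.eval (Real.exp (-x ^ σ)) - (φ x).re : ℝ) : ℂ)
          + Complex.I * ((q.eval (Real.exp (-x ^ σ)) - (φ x).im : ℝ) : ℂ)) := by
      conv_rhs => rw [hφx]
      simp only [Complex.add_re, Complex.add_im, Complex.ofReal_re, Complex.ofReal_im,
        Complex.mul_re, Complex.mul_im, Complex.I_re, Complex.I_im]
      push_cast
      ring
    rw [e5]
    refine (norm_sub_le _ _).trans (add_le_add le_rfl ?_)
    rw [norm_mul, Complex.norm_of_nonneg (hρ0 x hx).le]
    refine mul_le_mul_of_nonneg_left ((norm_add_le _ _).trans ?_) (hρ0 x hx).le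
    rw [norm_mul, Complex.norm_I, one_mul, Complex.norm_real, Complex.norm_real]
    have e6 := hp x hx
    have e7 := hq x hx
    simp only [Function.comp_apply] at e6 e7
    simp only [Real.norm_eq_abs]
    linarith
  have h3 : Integrable (fun x => f x - ρ x * φ x) (wMeasure n) :=
    f.integrable.sub ((hint φ).1 hφi)
  calc ∫ x, ‖(f - (g + h) : X n) x‖ ∂(wMeasure n)
      ≤ ∫ x, (‖f x - ρ x * φ x‖ + ρ x * (2 * δ)) ∂(wMeasure n) :=
        integral_mono_ae (L1.integrable_coeFn _).norm (h3.norm.add (hρi.mul_const _)) h2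
    _ = ∫ x, ‖f x - ρ x * φ x‖ ∂(wMeasure n) + W * (2 * δ) := by
        rw [integral_add h3.norm (hρi.mul_const _), integral_mul_const]
    _ ≤ δ * (1 + 2 * W) := by linarith
    _ = r / 2 := by rw [hδ]; field_simp
    _ < r := half_lt_self hr

end Density

/-! ### The analytic curve in X_n and its dense span. -/

section Curve

/-- The derivative of `curveFun` with respect to `w`. -/
def curveDerivFun (σ d k : ℝ) (w : ℂ) (x : ℝ) : ℂ :=
  curveFun σ d k w x * (heatVar σ x / w ^ 2 - (d / σ + 1 : ℝ) / w)

variable {σ d k n : ℝ}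

theorem hasDerivAt_heatCurve (ν u : ℝ) {w : ℂ} (hw : 0 < w.re) :
    HasDerivAt (fun w => heatCurve ν w u)
      (heatCurve ν w u * (u / w ^ 2 - (ν + 1 : ℝ) / w)) w := by
  have hw0 : w ≠ 0 := fun h => by simp [h] at hw
  have h1 : HasDerivAt (fun w : ℂ => w ^ (-(ν + 1 : ℝ) : ℂ))
      (-(ν + 1 : ℝ) * w ^ (-(ν + 1 : ℝ) - 1 : ℂ)) w := by
    simpa using (hasDerivAt_id w).cpow_const (c := (-(ν + 1 : ℝ) : ℂ)) (Or.inl hw)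
  have h2 : HasDerivAt (fun w : ℂ => Complex.exp (-u / w))
      (Complex.exp (-u / w) * (u / w ^ 2)) w := by
    refine HasDerivAt.cexp ?_
    have := (hasDerivAt_inv hw0).const_mul (-u : ℂ)
    have e : (-u : ℂ) * -(w ^ 2)⁻¹ = u / w ^ 2 := by
      field_simp
    rw [e] at this
    exact this
  have h3 := h1.mul h2
  refine h3.congr_deriv ?_
  rw [Complex.cpow_sub _ _ hw0, Complex.cpow_one, heatCurve]
  field_simp
  ring

theorem hasDerivAt_curveFun (x : ℝ) {w : ℂ} (hw : 0 < w.re) :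
    HasDerivAt (fun w => curveFun σ d k w x) (curveDerivFun σ d k w x) w := by
  have := (hasDerivAt_heatCurve (d / σ) (heatVar σ x) hw).const_mul ((x ^ k : ℝ) : ℂ)
  refine this.congr_deriv ?_
  rw [curveDerivFun, curveFun, mul_assoc]

theorem measurable_curveFun (w : ℂ) : Measurable (curveFun σ d k w) := by
  unfold curveFun heatCurve
  fun_prop

theorem measurable_curveDerivFun (w : ℂ) : Measurable (curveDerivFun σ d k w) := by
  have := measurable_curveFun (σ := σ) (d := d) (k := k) w
  unfold curveDerivFun
  fun_prop

/-- A dominating function for `curveFun` and `curveDerivFun` near a point of the half-plane. -/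
theorem exists_bound_curveFun (hσ : 0 < σ) (hd : 0 < d) (hk : -1 < n + k) {w₀ : ℂ}
    (hw₀ : 0 < w₀.re) :
    ∃ B : ℝ → ℝ, Integrable B (wMeasure n) ∧ ∀ x, 0 < x → ∀ w ∈ Metric.ball w₀ (w₀.re / 2),
      0 < w.re ∧ ‖curveFun σ d k w x‖ ≤ B x ∧ ‖curveDerivFun σ d k w x‖ ≤ B x := by
  set m : ℝ := w₀.re / 2 with hm
  have hm0 : 0 < m := half_pos hw₀
  set M : ℝ := ‖w₀‖ + m with hM
  have hM0 : 0 < M := by positivity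
  -- On the ball Re w > m and |w| < M, so Re(1/w) = Re w/|w|² ≥ c: a uniform exponential decay rate.
  -- The second summand of the bound absorbs the factor u/w² of the derivative.
  set c : ℝ := m / M ^ 2 with hc
  have hc0 : 0 < c := by positivity
  have hσd : 0 < d / σ + 1 := by positivity
  set A : ℝ := m ^ (-(d / σ + 1)) with hA
  have hA0 : 0 < A := by positivity
  set B : ℝ → ℝ := fun x => A * (x ^ k * Real.exp (-(c / σ ^ 2) * x ^ σ)) * (1 + (d / σ + 1) / m)
    + A * (x ^ (k + σ) * Real.exp (-(c / σ ^ 2) * x ^ σ)) / (σ ^ 2 * m ^ 2) with hB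
  refine ⟨B, ?_, ?_⟩
  · have h1 := integrable_rpow_mul_exp_neg_rpow (c := c / σ ^ 2) hσ hk (by positivity)
    have h2 := integrable_rpow_mul_exp_neg_rpow (k := k + σ) (n := n) (c := c / σ ^ 2) hσ
      (by linarith) (by positivity)
    exact ((h1.const_mul A).mul_const _).add ((h2.const_mul A).div_const _)
  intro x hx w hw
  rw [mem_ball_iff_norm] at hw
  have h1 := (Complex.abs_re_le_norm (w - w₀)).trans_lt hw
  rw [Complex.sub_re, abs_lt] at h1
  have hwm : m < w.re := by linarith
  have hw0 : 0 < w.re := hm0.trans hwm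
  have hwn : m < ‖w‖ := hwm.trans_le (Complex.re_le_norm w)
  have hwn0 : 0 < ‖w‖ := hm0.trans hwn
  have hwM : ‖w‖ < M := by
    have := norm_add_le (w - w₀) w₀
    rw [sub_add_cancel] at this
    linarith
  have hU := heatVar_pos hσ hx
  have h2 : ‖curveFun σ d k w x‖ ≤ A * (x ^ k * Real.exp (-(c / σ ^ 2) * x ^ σ)) := by
    rw [curveFun, heatCurve, norm_mul, norm_mul, Complex.norm_of_nonneg (by positivity),
      ← Complex.ofReal_neg, Complex.norm_cpow_real, Complex.norm_exp, ← Complex.ofReal_neg,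
      div_eq_mul_inv _ w, Complex.re_ofReal_mul, Complex.inv_re, Complex.normSq_eq_norm_sq]
    have h3 : ‖w‖ ^ (-(d / σ + 1)) ≤ A :=
      Real.rpow_le_rpow_of_nonpos hm0 hwn.le (by linarith)
    have h4 : -heatVar σ x * (w.re / ‖w‖ ^ 2) ≤ -(c / σ ^ 2) * x ^ σ := by
      have h5 : c ≤ w.re / ‖w‖ ^ 2 := by
        rw [hc]
        gcongr
      calc -heatVar σ x * (w.re / ‖w‖ ^ 2) ≤ -heatVar σ x * c :=
            mul_le_mul_of_nonpos_left h5 (by linarith)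
        _ = _ := by rw [heatVar]; ring
    calc _ ≤ x ^ k * (A * Real.exp (-(c / σ ^ 2) * x ^ σ)) := by gcongr
      _ = _ := by ring
  have hE : 0 < A * (x ^ k * Real.exp (-(c / σ ^ 2) * x ^ σ)) := by positivity
  have hE2 : A * (x ^ (k + σ) * Real.exp (-(c / σ ^ 2) * x ^ σ)) / (σ ^ 2 * m ^ 2)
      = A * (x ^ k * Real.exp (-(c / σ ^ 2) * x ^ σ)) * (heatVar σ x / m ^ 2) := by
    rw [Real.rpow_add hx, heatVar]
    field_simp
  have hBx : B x = A * (x ^ k * Real.exp (-(c / σ ^ 2) * x ^ σ))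
      * (1 + (heatVar σ x / m ^ 2 + (d / σ + 1) / m)) := by
    simp only [hB]
    rw [hE2]
    ring
  refine ⟨hw0, ?_, ?_⟩
  · rw [hBx]
    have : 0 ≤ heatVar σ x / m ^ 2 + (d / σ + 1) / m := by positivity
    nlinarith
  · rw [curveDerivFun, norm_mul, hBx]
    refine mul_le_mul h2 ?_ (norm_nonneg _) hE.le
    refine (norm_sub_le _ _).trans ?_
    rw [norm_div, norm_div, norm_pow, Complex.norm_of_nonneg hU.le,
      Complex.norm_of_nonneg hσd.le]
    have h3 : heatVar σ x / ‖w‖ ^ 2 ≤ heatVar σ x / m ^ 2 := by gcongr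
    have h4 : (d / σ + 1) / ‖w‖ ≤ (d / σ + 1) / m := by gcongr
    linarith

theorem integrable_curveFun (hσ : 0 < σ) (hd : 0 < d) (hk : -1 < n + k) {w : ℂ}
    (hw : 0 < w.re) : Integrable (curveFun σ d k w) (wMeasure n) := by
  obtain ⟨B, hB, h⟩ := exists_bound_curveFun hσ hd hk hw
  exact hB.mono' (measurable_curveFun w).aestronglyMeasurable (ae_wMeasure_of_pos fun x hx =>
    (h x hx w (Metric.mem_ball_self (half_pos hw))).2.1)

theorem integrable_curveDerivFun (hσ : 0 < σ) (hd : 0 < d) (hk : -1 < n + k) {w : ℂ}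
    (hw : 0 < w.re) : Integrable (curveDerivFun σ d k w) (wMeasure n) := by
  obtain ⟨B, hB, h⟩ := exists_bound_curveFun hσ hd hk hw
  exact hB.mono' (measurable_curveDerivFun w).aestronglyMeasurable (ae_wMeasure_of_pos fun x hx =>
    (h x hx w (Metric.mem_ball_self (half_pos hw))).2.2)

open scoped Classical in
/-- The element of `X n` defined by an integrable function, and zero otherwise. -/
def toX (n : ℝ) (f : ℝ → ℂ) : X n :=
  if h : Integrable f (wMeasure n) then h.toL1 f else 0

theorem coeFn_toX {f : ℝ → ℂ} (h : Integrable f (wMeasure n)) : toX n f =ᵐ[wMeasure n] f := by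
  rw [toX, dif_pos h]
  exact Integrable.coeFn_toL1 h

theorem hasDerivAt_curve (hσ : 0 < σ) (hd : 0 < d) (hk : -1 < n + k) {w : ℂ}
    (hw : 0 < w.re) :
    HasDerivAt (fun w => toX n (curveFun σ d k w)) (toX n (curveDerivFun σ d k w)) w := by
  obtain ⟨B, hB, h⟩ := exists_bound_curveFun hσ hd hk hw
  have hr := half_pos hw
  have hpos : ∀ v ∈ Metric.ball w (w.re / 2), 0 < v.re := fun v hv => (h 1 one_pos v hv).1
  refine hasDerivAt_L1_of_dominated hr hB (F := curveFun σ d k) (F' := curveDerivFun σ d k)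
    (fun v hv => coeFn_toX (integrable_curveFun hσ hd hk (hpos v hv)))
    (coeFn_toX (integrable_curveDerivFun hσ hd hk hw))
    (ae_wMeasure_of_pos fun x hx v hv => (h x hx v hv).2.2)
    (ae_wMeasure_of_pos fun x _ v hv => hasDerivAt_curveFun x (hpos v hv))

theorem dense_span_curve (hσ : 0 < σ) (hd : 0 < d) (hk : -1 < n + k) :
    Dense (Submodule.span ℂ ((fun w => toX n (curveFun σ d k w)) '' {w | 0 < w.re}) :
      Set (X n)) := by
  refine dense_of_exp_neg_rpow hσ hk fun j c => ?_
  -- At this time u/w = (j + 1) x^σ, so the curve point is a multiple of the required exponential.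
  set w : ℝ := (σ ^ 2 * (j + 1))⁻¹ with hw
  have hw0 : 0 < w := by positivity
  have hwre : 0 < (w : ℂ).re := by simpa using hw0
  set b : ℂ := (w : ℂ) ^ (-(d / σ + 1 : ℝ) : ℂ) with hb
  have hb0 : b ≠ 0 := by simp [hb, Complex.cpow_eq_zero_iff, hw0.ne']
  refine ⟨(c * b⁻¹) • toX n (curveFun σ d k w), Submodule.smul_mem _ _
    (Submodule.subset_span ⟨w, hwre, rfl⟩), ?_⟩
  filter_upwards [Lp.coeFn_smul (c * b⁻¹) (toX n (curveFun σ d k w)),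
    coeFn_toX (integrable_curveFun hσ hd hk hwre)] with x h1 h2
  rw [h1, Pi.smul_apply, h2, curveFun, heatCurve, ← hb, smul_eq_mul]
  have e1 : Complex.exp (-(heatVar σ x : ℂ) / w)
      = ((Real.exp (-(j + 1) * x ^ σ) : ℝ) : ℂ) := by
    rw [← Complex.ofReal_neg, ← Complex.ofReal_div, ← Complex.ofReal_exp]
    congr 2
    rw [hw, heatVar]
    field_simp
  rw [e1]
  push_cast
  field_simp

end Curve

/-! ### The semigroup on X_n: positivity and contractivity. -/

section Semigroup

variable {σ d k n : ℝ}

theorem isPositiveOp_of_kernel {S : X n →L[ℂ] X n} {κ : ℝ → ℝ → ℝ}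
    (hκ : ∀ x y, 0 < x → 0 < y → 0 ≤ κ x y)
    (hS : ∀ f : X n, S f =ᵐ[wMeasure n] fun x => ∫ y, (κ x y : ℂ) * f y ∂(wMeasure n)) :
    IsPositiveOp S := by
  intro f hf
  filter_upwards [hS f, ae_wMeasure_of_pos (m := n) (p := fun x => 0 < x) fun x hx => hx]
    with x hx hx0
  have h1 : ∫ y, (κ x y : ℂ) * f y ∂(wMeasure n)
      = ((∫ y, κ x y * (f y).re ∂(wMeasure n) : ℝ) : ℂ) := by
    rw [← integral_complex_ofReal]
    refine integral_congr_ae ?_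
    filter_upwards [hf] with y hy
    rw [Complex.ofReal_mul]
    congr 1
    exact Complex.ext (by simp) (by simp [hy.2])
  rw [hx, h1, Complex.ofReal_re, Complex.ofReal_im]
  refine ⟨integral_nonneg_of_ae ?_, rfl⟩
  filter_upwards [hf, ae_wMeasure_of_pos (m := n) (p := fun x => 0 < x) fun x hx => hx]
    with y hy hy0
  exact mul_nonneg (hκ x y hx0 hy0) hy.1

/-- The semigroup which translates the curve `w ↦ x^k w^{-ν-1} e^{-x^σ / (σ² w)}`. -/
theorem exists_translation_semigroup (hσ : 0 < σ) (hd : 0 < d) (hk : -1 < n + k)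
    (hn : n ≤ σ - 1 + d - k) :
    ∃ T : ℂ → X n →L[ℂ] X n, IsBoundedAnalyticSemigroup (Real.pi / 2) T ∧
      (∀ t : ℝ, 0 ≤ t → IsPositiveOp (T (t : ℂ))) ∧
      (σ - 1 - k ≤ n → ∀ t : ℝ, 0 ≤ t → ‖T (t : ℂ)‖ ≤ 1) ∧
      ∀ z w : ℂ, 0 < z.re → 0 < w.re →
        T z (toX n (curveFun σ d k w)) = toX n (curveFun σ d k (w + z)) := by
  obtain ⟨C, hC0, hC1, hC⟩ := exists_lintegral_semigroupKernel_le hσ hd hk hn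
  have hex : ∀ z : ℂ, ∃ S : X n →L[ℂ] X n, 0 < z.re →
      ‖S‖ ≤ C * (‖z‖ / z.re) ^ (d / σ + 1) ∧
      ∀ f : X n, S f =ᵐ[wMeasure n]
        fun x => ∫ y, semigroupKernel σ d k n z x y * f y ∂(wMeasure n) := by
    intro z
    by_cases hz : 0 < z.re
    · obtain ⟨S, hS⟩ := exists_kernelOperator (measurable_semigroupKernel z)
        (C := C * (‖z‖ / z.re) ^ (d / σ + 1)) (by positivity)
        (ae_wMeasure_of_pos fun y hy => hC z hz y hy)
      exact ⟨S, fun _ => hS⟩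
    · exact ⟨0, fun h => absurd h hz⟩
  choose S hS using hex
  -- The identity is the value outside the open half-plane; only T 0 = 1 matters there.
  set T : ℂ → X n →L[ℂ] X n := fun z => if 0 < z.re then S z else 1 with hT
  have hTS : ∀ z : ℂ, 0 < z.re → T z = S z := fun z hz => if_pos hz
  have hT0 : T 0 = 1 := if_neg (by simp)
  have htrans : ∀ z w : ℂ, 0 < z.re → 0 < w.re →
        T z (toX n (curveFun σ d k w)) = toX n (curveFun σ d k (w + z)) := by
    intro z w hz hw
    refine Lp.ext ?_
    rw [hTS z hz]
    filter_upwards [(hS z hz).2 (toX n (curveFun σ d k w)),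
      coeFn_toX (n := n) (integrable_curveFun hσ hd hk (w := w + z)
        (by rw [Complex.add_re]; positivity)),
      ae_wMeasure_of_pos (m := n) (p := fun x => 0 < x) fun x hx => hx] with x h1 h2 hx
    rw [h1, h2, ← integral_semigroupKernel_mul_curveFun (n := n) hσ hd hz hw hx]
    refine integral_congr_ae ?_
    filter_upwards [coeFn_toX (n := n) (integrable_curveFun hσ hd hk hw)] with y hy
    rw [hy]
  have hν : 0 < d / σ := by positivity
  refine ⟨T, isBoundedAnalyticSemigroup_of_translation (μ := d / σ + 1) (by positivity) hC0 hT0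
    htrans (fun w hw => (hasDerivAt_curve hσ hd hk hw).differentiableAt.differentiableWithinAt)
    (dense_span_curve hσ hd hk) (fun z hz => by rw [hTS z hz]; exact (hS z hz).1), ?_, ?_, htrans⟩
  · intro t ht
    rcases ht.eq_or_lt with rfl | ht
    · rw [Complex.ofReal_zero, hT0]
      exact fun f hf => hf
    · have htre : 0 < (t : ℂ).re := by simpa using ht
      rw [hTS t htre]
      refine isPositiveOp_of_kernel (κ := fun x y => σ ^ (-(2 * (d / σ) + 1)) * x ^ k
        * y ^ (σ - 1 + d - k - n) * besselHeatReal (d / σ) t (heatVar σ x) (heatVar σ y))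
        (fun x y hx hy => ?_) fun f => ?_
      · have := besselHeatReal_nonneg (ν := d / σ) (by linarith) ht (heatVar σ x) (heatVar σ y)
        positivity
      · refine ((hS t htre).2 f).trans (Eventually.of_forall fun x => ?_)
        simp only [semigroupKernel, besselHeat_ofReal ht, Complex.ofReal_mul]
  · intro h t ht
    rcases ht.eq_or_lt with rfl | ht
    · rw [Complex.ofReal_zero, hT0]
      exact ContinuousLinearMap.norm_id_le
    · have htre : 0 < (t : ℂ).re := by simpa using ht
      rw [hTS t htre]
      refine (hS t htre).1.trans_eq ?_
      rw [hC1 h, Complex.ofReal_re, Complex.norm_of_nonneg ht.le, div_self ht.ne', Real.one_rpow,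
        one_mul]

end Semigroup

/-! ### Iterated primitives that invert the operator in divergence form. -/

section Primitive

/-- The primitive `s ↦ ∫₀ˢ y^β g(y) dy`. -/
def weightedPrim (β : ℝ) (g : ℝ → ℂ) (s : ℝ) : ℂ := ∫ y in (0 : ℝ)..s, y ^ β • g y

/-- The iterated primitive `x ↦ ∫₁ˣ s^(-1-d) (∫₀ˢ y^β g(y) dy) ds`. -/
def doublePrim (β d : ℝ) (g : ℝ → ℂ) (x : ℝ) : ℂ :=
  ∫ s in (1 : ℝ)..x, s ^ (-1 - d) • weightedPrim β g s

variable {β d n : ℝ} {f g : ℝ → ℂ}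

/-- Used with β = n_*^+: the condition n ≤ n_*^+ makes y^β g integrable at 0, so that primitives can
start there. -/
theorem norm_rpow_smul_le (hn : n ≤ β) {s y : ℝ} (hy : 0 < y) (hys : y ≤ s) :
    ‖y ^ β • g y‖ ≤ s ^ (β - n) * (y ^ n * ‖g y‖) := by
  rw [norm_smul, Real.norm_of_nonneg (by positivity), ← mul_assoc]
  refine mul_le_mul_of_nonneg_right ?_ (norm_nonneg _)
  calc y ^ β = y ^ (β - n) * y ^ n := by rw [← Real.rpow_add hy]; congr 1; ring
    _ ≤ _ := by
      refine mul_le_mul_of_nonneg_right ?_ (by positivity)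
      exact Real.rpow_le_rpow hy.le hys (by linarith)

theorem integrableOn_rpow_smul (hn : n ≤ β) (hg : Integrable g (wMeasure n)) (s : ℝ) :
    IntegrableOn (fun y => y ^ β • g y) (Ioc 0 s) := by
  have h0 := ((integrable_wMeasure_iff n g).1 hg).mono_set (Ioc_subset_Ioi_self : Ioc 0 s ⊆ Ioi 0)
  have hm : AEStronglyMeasurable (fun y => y ^ β • g y) (volume.restrict (Ioc 0 s)) := by
    have h1 : AEStronglyMeasurable (fun y : ℝ => y ^ (β - n) • (y ^ n • g y))
        (volume.restrict (Ioc 0 s)) :=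
      (by fun_prop : Measurable fun y : ℝ => y ^ (β - n)).aestronglyMeasurable.smul
        h0.aestronglyMeasurable
    refine h1.congr ?_
    filter_upwards [ae_restrict_mem measurableSet_Ioc] with y hy
    rw [smul_smul, ← Real.rpow_add hy.1, sub_add_cancel]
  refine (h0.norm.const_mul (s ^ (β - n))).mono' hm ?_
  filter_upwards [ae_restrict_mem measurableSet_Ioc] with y hy
  refine (norm_rpow_smul_le hn hy.1 hy.2).trans_eq ?_
  rw [norm_smul, Real.norm_of_nonneg (Real.rpow_nonneg hy.1.le _)]

theorem intervalIntegrable_rpow_smul (hn : n ≤ β) (hg : Integrable g (wMeasure n)) {s t : ℝ}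
    (hs : 0 ≤ s) (ht : 0 ≤ t) : IntervalIntegrable (fun y => y ^ β • g y) volume s t := by
  refine intervalIntegrable_iff.2 ((integrableOn_rpow_smul hn hg (max s t)).mono_set ?_)
  exact Ioc_subset_Ioc_left (le_min hs ht)

theorem norm_weightedPrim_le (hn : n ≤ β) (hg : Integrable g (wMeasure n)) {s : ℝ} (hs : 0 < s) :
    ‖weightedPrim β g s‖ ≤ s ^ (β - n) * ∫ y, ‖g y‖ ∂(wMeasure n) := by
  have h0 := ((integrable_wMeasure_iff n _).1 hg.norm)
  rw [weightedPrim, intervalIntegral.integral_of_le hs.le]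
  calc _ ≤ ∫ y in Ioc 0 s, ‖y ^ β • g y‖ := norm_integral_le_integral_norm _
    _ ≤ ∫ y in Ioc 0 s, s ^ (β - n) * (y ^ n * ‖g y‖) := by
        refine setIntegral_mono_on (integrableOn_rpow_smul hn hg s).norm
          ((h0.mono_set Ioc_subset_Ioi_self).const_mul _) measurableSet_Ioc fun y hy => ?_
        exact norm_rpow_smul_le hn hy.1 hy.2
    _ = s ^ (β - n) * ∫ y in Ioc 0 s, y ^ n * ‖g y‖ := integral_const_mul _ _
    _ ≤ s ^ (β - n) * ∫ y in Ioi 0, y ^ n * ‖g y‖ := by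
        refine mul_le_mul_of_nonneg_left ?_ (by positivity)
        refine setIntegral_mono_set h0 ?_ Ioc_subset_Ioi_self.eventuallyLE
        filter_upwards [ae_restrict_mem measurableSet_Ioi] with y hy
        have : (0 : ℝ) < y := hy
        positivity
    _ = _ := by rw [integral_wMeasure]; rfl

theorem continuousOn_weightedPrim (hn : n ≤ β) (hg : Integrable g (wMeasure n)) :
    ContinuousOn (weightedPrim β g) (Ici 0) := by
  intro s hs
  have hs' : (0 : ℝ) ≤ s := hs
  have h := intervalIntegral.continuousOn_primitive_interval (μ := volume) (a := 0) (b := s + 1)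
    (f := fun y => y ^ β • g y) (by
      rw [uIcc_of_le (by linarith), integrableOn_Icc_iff_integrableOn_Ioc]
      exact integrableOn_rpow_smul hn hg _)
  rw [uIcc_of_le (by linarith)] at h
  refine (h s ⟨hs', by linarith⟩).mono_of_mem_nhdsWithin ?_
  rw [← Ici_inter_Iic]
  exact inter_mem_nhdsWithin _ (Iic_mem_nhds (by linarith))

theorem continuousAt_weightedPrim (hn : n ≤ β) (hg : Integrable g (wMeasure n)) {s : ℝ}
    (hs : 0 < s) : ContinuousAt (weightedPrim β g) s :=
  (continuousOn_weightedPrim hn hg).continuousAt (Ici_mem_nhds hs)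

theorem tendsto_weightedPrim_zero (hn : n ≤ β) (hg : Integrable g (wMeasure n)) :
    Tendsto (weightedPrim β g) (𝓝[>] 0) (𝓝 0) := by
  have h := continuousOn_weightedPrim hn hg 0 self_mem_Ici
  have h0 : weightedPrim β g 0 = 0 := by simp [weightedPrim]
  rw [ContinuousWithinAt, h0] at h
  exact h.mono_left (nhdsWithin_mono _ Ioi_subset_Ici_self)

theorem continuousOn_doublePrim_integrand (hn : n ≤ β) (hg : Integrable g (wMeasure n)) :
    ContinuousOn (fun s : ℝ => s ^ (-1 - d) • weightedPrim β g s) (Ioi 0) := fun s hs =>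
  ((Real.continuousAt_rpow_const s _ (Or.inl (ne_of_gt hs))).smul
    (continuousAt_weightedPrim hn hg hs)).continuousWithinAt

theorem intervalIntegrable_doublePrim_integrand (hn : n ≤ β) (hg : Integrable g (wMeasure n))
    {s t : ℝ} (hs : 0 < s) (ht : 0 < t) :
    IntervalIntegrable (fun s : ℝ => s ^ (-1 - d) • weightedPrim β g s) volume s t := by
  refine ((continuousOn_doublePrim_integrand hn hg).mono fun y hy => ?_).intervalIntegrable
  exact (lt_min hs ht).trans_le hy.1

theorem hasDerivAt_doublePrim (hn : n ≤ β) (hg : Integrable g (wMeasure n)) {x : ℝ}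
    (hx : 0 < x) :
    HasDerivAt (doublePrim β d g) (x ^ (-1 - d) • weightedPrim β g x) x := by
  have hc := continuousOn_doublePrim_integrand (d := d) hn hg
  refine intervalIntegral.integral_hasDerivAt_right
    (intervalIntegrable_doublePrim_integrand hn hg one_pos hx) ?_
    (hc.continuousAt (Ioi_mem_nhds hx))
  exact hc.stronglyMeasurableAtFilter isOpen_Ioi x hx

theorem continuousOn_doublePrim (hn : n ≤ β) (hg : Integrable g (wMeasure n)) :
    ContinuousOn (doublePrim β d g) (Ioi 0) := fun _ hx =>
  (hasDerivAt_doublePrim hn hg hx).continuousAt.continuousWithinAt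

theorem doublePrim_sub_doublePrim (hn : n ≤ β) (hg : Integrable g (wMeasure n)) {x y : ℝ}
    (hx : 0 < x) (hy : 0 < y) :
    doublePrim β d g y - doublePrim β d g x = ∫ s in x..y, s ^ (-1 - d) • weightedPrim β g s :=
  intervalIntegral.integral_interval_sub_left
    (intervalIntegrable_doublePrim_integrand hn hg one_pos hy)
    (intervalIntegrable_doublePrim_integrand hn hg one_pos hx)

theorem weightedPrim_congr {s : ℝ} (hs : 0 ≤ s) (h : f =ᵐ[volume.restrict (Ioi 0)] g) :
    weightedPrim β f s = weightedPrim β g s := by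
  refine intervalIntegral.integral_congr_ae ?_
  rw [uIoc_of_le hs]
  filter_upwards [(ae_restrict_iff' measurableSet_Ioi).1 h] with y hy hys
  rw [hy hys.1]

theorem weightedPrim_add (hn : n ≤ β) (hf : Integrable f (wMeasure n))
    (hg : Integrable g (wMeasure n)) {s : ℝ} (hs : 0 ≤ s) :
    weightedPrim β (f + g) s = weightedPrim β f s + weightedPrim β g s := by
  simp only [weightedPrim, Pi.add_apply, smul_add]
  exact intervalIntegral.integral_add (intervalIntegrable_rpow_smul hn hf le_rfl hs)
    (intervalIntegrable_rpow_smul hn hg le_rfl hs)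

theorem weightedPrim_smul (c : ℂ) (s : ℝ) :
    weightedPrim β (c • g) s = c • weightedPrim β g s := by
  simp only [weightedPrim, Pi.smul_apply, ← intervalIntegral.integral_smul]
  exact intervalIntegral.integral_congr fun y _ => smul_comm _ _ _

theorem doublePrim_congr {x : ℝ} (hx : 0 < x) (h : f =ᵐ[volume.restrict (Ioi 0)] g) :
    doublePrim β d f x = doublePrim β d g x := by
  refine intervalIntegral.integral_congr fun s hs => ?_
  rw [weightedPrim_congr ((lt_min one_pos hx).trans_le hs.1).le h]

theorem doublePrim_add (hn : n ≤ β) (hf : Integrable f (wMeasure n))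
    (hg : Integrable g (wMeasure n)) {x : ℝ} (hx : 0 < x) :
    doublePrim β d (f + g) x = doublePrim β d f x + doublePrim β d g x := by
  simp only [doublePrim]
  rw [← intervalIntegral.integral_add
    (intervalIntegrable_doublePrim_integrand hn hf one_pos hx)
    (intervalIntegrable_doublePrim_integrand hn hg one_pos hx)]
  refine intervalIntegral.integral_congr fun s hs => ?_
  rw [weightedPrim_add hn hf hg ((lt_min one_pos hx).trans_le hs.1).le, smul_add]

theorem doublePrim_smul (c : ℂ) (x : ℝ) :
    doublePrim β d (c • g) x = c • doublePrim β d g x := by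
  simp only [doublePrim, ← intervalIntegral.integral_smul, weightedPrim_smul]
  exact intervalIntegral.integral_congr fun y _ => smul_comm _ _ _

/-- At each fixed x the iterated primitive is continuous in g for the L¹ norm; this gives closedness
of `primitiveGraph`. -/
theorem norm_doublePrim_le (hn : n ≤ β) (hg : Integrable g (wMeasure n)) {x : ℝ} (hx : 0 < x) :
    ‖doublePrim β d g x‖ ≤ |∫ s in (1 : ℝ)..x, s ^ (-1 - d) * s ^ (β - n)|
      * ∫ y, ‖g y‖ ∂(wMeasure n) := by
  have h0 : 0 ≤ ∫ y, ‖g y‖ ∂(wMeasure n) := integral_nonneg fun _ => norm_nonneg _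
  have hp : ∀ s ∈ uIcc 1 x, 0 < s := fun s hs => (lt_min one_pos hx).trans_le hs.1
  rw [← abs_of_nonneg h0, ← abs_mul, ← intervalIntegral.integral_mul_const]
  refine intervalIntegral.norm_integral_le_abs_of_norm_le ?_ ?_
  · filter_upwards [ae_restrict_mem measurableSet_uIoc] with s hs
    have hs' := hp s (uIoc_subset_uIcc hs)
    rw [norm_smul, Real.norm_of_nonneg (by positivity), mul_assoc]
    exact mul_le_mul_of_nonneg_left (norm_weightedPrim_le hn hg hs') (by positivity)
  · refine ContinuousOn.intervalIntegrable fun s hs => ?_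
    have hs' := (hp s hs).ne'
    exact (((Real.continuousAt_rpow_const s _ (Or.inl hs')).mul
      (Real.continuousAt_rpow_const s _ (Or.inl hs'))).mul continuousAt_const).continuousWithinAt

end Primitive

/-! ### The graph of regular solutions and its closedness. -/

section PrimitiveGraph

variable {β d k n : ℝ}

/-- The pairs `(f, g)` such that `f(x) = x^k (c + ∫₁ˣ s^(-1-d) (∫₀ˢ y^β g(y) dy) ds)`. -/
def primitiveGraph (k d : ℝ) (hn : n ≤ β) : Submodule ℂ (X n × X n) where
  carrier := {p | ∃ c : ℂ, p.1 =ᵐ[wMeasure n] fun x => x ^ k • (c + doublePrim β d p.2 x)}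
  zero_mem' := by
    refine ⟨0, ?_⟩
    filter_upwards [Lp.coeFn_zero ℂ 1 (wMeasure n),
      ae_wMeasure_of_pos (m := n) (p := fun x => 0 < x) fun x hx => hx] with x h1 hx
    have h2 : doublePrim β d ((0 : X n) : ℝ → ℂ) x = 0 := by
      rw [doublePrim_congr hx (ae_eq_restrict (Lp.coeFn_zero ℂ 1 (wMeasure n)))]
      simp [doublePrim, weightedPrim]
    rw [Prod.fst_zero, Prod.snd_zero, h1, h2]
    simp
  add_mem' := by
    rintro p q ⟨c, hc⟩ ⟨e, he⟩
    refine ⟨c + e, ?_⟩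
    filter_upwards [Lp.coeFn_add p.1 q.1, hc, he,
      ae_wMeasure_of_pos (m := n) (p := fun x => 0 < x) fun x hx => hx] with x h1 h2 h3 hx
    rw [Prod.fst_add, Prod.snd_add, h1, Pi.add_apply, h2, h3,
      doublePrim_congr hx (ae_eq_restrict (Lp.coeFn_add p.2 q.2)),
      doublePrim_add hn p.2.integrable q.2.integrable hx, ← smul_add]
    congr 1
    ring
  smul_mem' := by
    rintro e p ⟨c, hc⟩
    refine ⟨e • c, ?_⟩
    filter_upwards [Lp.coeFn_smul e p.1, hc,
      ae_wMeasure_of_pos (m := n) (p := fun x => 0 < x) fun x hx => hx] with x h1 h2 hx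
    rw [Prod.smul_fst, Prod.smul_snd, h1, Pi.smul_apply, h2,
      doublePrim_congr hx (ae_eq_restrict (Lp.coeFn_smul e p.2)),
      doublePrim_smul, ← smul_add, smul_comm]

theorem mem_primitiveGraph {hn : n ≤ β} {p : X n × X n} : p ∈ primitiveGraph k d hn ↔
    ∃ c : ℂ, p.1 =ᵐ[wMeasure n] fun x => x ^ k • (c + doublePrim β d p.2 x) :=
  Iff.rfl

theorem norm_doublePrim_sub_le (hn : n ≤ β) (f g : X n) {x : ℝ} (hx : 0 < x) :
    ‖doublePrim β d f x - doublePrim β d g x‖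
      ≤ |∫ s in (1 : ℝ)..x, s ^ (-1 - d) * s ^ (β - n)| * ‖f - g‖ := by
  have h1 : doublePrim β d f x = doublePrim β d (f - g : X n) x + doublePrim β d g x := by
    rw [← doublePrim_add hn (f - g).integrable g.integrable hx]
    refine doublePrim_congr hx (ae_eq_restrict (m := n) ?_)
    filter_upwards [Lp.coeFn_sub f g] with y hy
    rw [Pi.add_apply, hy, Pi.sub_apply, sub_add_cancel]
  rw [h1, add_sub_cancel_right, L1.norm_eq_integral_norm]
  exact norm_doublePrim_le hn (f - g).integrable hx

/-- Along an almost everywhere convergent subsequence, the first components and the iterated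
primitives converge at almost every x. Hence the constants c converge, and their limit cannot depend
on x. -/
theorem isClosed_primitiveGraph (hn : n ≤ β) :
    IsClosed (primitiveGraph k d hn : Set (X n × X n)) := by
  refine IsSeqClosed.isClosed fun p q hp hpq => ?_
  choose c hc using fun j => mem_primitiveGraph.1 (hp j)
  have h1 : Tendsto (fun j => (p j).1) atTop (𝓝 q.1) := (continuous_fst.tendsto q).comp hpq
  have h2 : Tendsto (fun j => (p j).2) atTop (𝓝 q.2) := (continuous_snd.tendsto q).comp hpq
  obtain ⟨φ, hφ, hφa⟩ := (tendstoInMeasure_of_tendsto_Lp h1).exists_seq_tendsto_ae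
  have hΦ : ∀ x, 0 < x → Tendsto (fun j => doublePrim β d (p (φ j)).2 x) atTop
      (𝓝 (doublePrim β d q.2 x)) := by
    intro x hx
    rw [tendsto_iff_norm_sub_tendsto_zero]
    have h3 := (tendsto_iff_norm_sub_tendsto_zero.1 (h2.comp hφ.tendsto_atTop)).const_mul
      |∫ s in (1 : ℝ)..x, s ^ (-1 - d) * s ^ (β - n)|
    rw [mul_zero] at h3
    exact squeeze_zero (fun _ => norm_nonneg _)
      (fun j => norm_doublePrim_sub_le hn (p (φ j)).2 q.2 hx) h3
  have key : ∀ᵐ x ∂(wMeasure n), 0 < x ∧ Tendsto (fun j => c (φ j)) atTop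
      (𝓝 (x ^ (-k) • q.1 x - doublePrim β d q.2 x)) := by
    filter_upwards [hφa, ae_all_iff.2 hc,
      ae_wMeasure_of_pos (m := n) (p := fun x => 0 < x) fun x hx => hx] with x h3 h4 hx
    refine ⟨hx, ((h3.const_smul (x ^ (-k))).sub (hΦ x hx)).congr fun j => ?_⟩
    rw [h4, smul_smul, ← Real.rpow_add hx, neg_add_cancel, Real.rpow_zero, one_smul,
      add_sub_cancel_right]
  -- The measure is nonzero, so an almost everywhere statement holds at some point, which fixes the
  -- limiting constant.
  have : NeBot (ae (wMeasure n)) := by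
    rw [neBot_iff]
    intro h0
    have h5 : ∀ᵐ x ∂(wMeasure n), False := by
      rw [h0]
      exact Filter.eventually_bot
    have h6 := ae_wMeasure_iff.1 h5
    rw [ae_iff] at h6
    simp at h6
  obtain ⟨x₀, -, h₀⟩ := key.exists
  refine mem_primitiveGraph.2 ⟨x₀ ^ (-k) • q.1 x₀ - doublePrim β d q.2 x₀, ?_⟩
  filter_upwards [key] with x hx
  rw [tendsto_nhds_unique h₀ hx.2, sub_add_cancel, smul_smul, ← Real.rpow_add hx.1,
    add_neg_cancel, Real.rpow_zero, one_smul]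

end PrimitiveGraph

/-! ### Test functions on the half-line and integration by parts. -/

section TestFunctions

theorem exists_subset_Icc_of_isCompact_of_subset_Ioi {K : Set ℝ} (hK : IsCompact K)
    (h : K ⊆ Ioi 0) : ∃ a b : ℝ, 0 < a ∧ a ≤ b ∧ K ⊆ Icc a b := by
  rcases K.eq_empty_or_nonempty with rfl | hne
  · exact ⟨1, 1, one_pos, le_rfl, empty_subset _⟩
  · exact ⟨sInf K, sSup K, h (hK.sInf_mem hne), (hK.isLeast_sInf hne).2 (hK.sSup_mem hne),
      fun x hx => ⟨(hK.isLeast_sInf hne).2 hx, (hK.isGreatest_sSup hne).2 hx⟩⟩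

theorem exists_tsupport_subset_Icc (φ : 𝓓(halfLine, ℝ)) :
    ∃ a b : ℝ, 0 < a ∧ a ≤ b ∧ tsupport φ ⊆ Icc a b :=
  exists_subset_Icc_of_isCompact_of_subset_Ioi φ.hasCompactSupport φ.tsupport_subset

/-- The product of a test function with a power. -/
def rpowMulTest (s : ℝ) (φ : 𝓓(halfLine, ℝ)) : 𝓓(halfLine, ℝ) :=
  ⟨fun y => y ^ s * φ y, contDiff_rpow_mul s φ,
    φ.hasCompactSupport.of_isClosed_subset (isClosed_tsupport _) (tsupport_rpow_mul s φ),
    (tsupport_rpow_mul s φ).trans φ.tsupport_subset⟩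

@[simp]
theorem rpowMulTest_apply (s : ℝ) (φ : 𝓓(halfLine, ℝ)) (y : ℝ) :
    rpowMulTest s φ y = y ^ s * φ y := rfl

/-- The derivative of a test function. -/
def derivTest (φ : 𝓓(halfLine, ℝ)) : 𝓓(halfLine, ℝ) :=
  ⟨deriv φ, (contDiff_infty_iff_deriv.1 φ.contDiff).2, φ.hasCompactSupport.deriv,
    tsupport_deriv_subset.trans φ.tsupport_subset⟩

@[simp]
theorem derivTest_apply (φ : 𝓓(halfLine, ℝ)) (y : ℝ) : derivTest φ y = deriv φ y := rfl

theorem hasDerivAt_test (φ : 𝓓(halfLine, ℝ)) (x : ℝ) : HasDerivAt φ (derivTest φ x) x :=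
  (φ.contDiff.differentiable (by simp) x).hasDerivAt

theorem test_eq_zero_of_nonpos (φ : 𝓓(halfLine, ℝ)) {x : ℝ} (hx : x ≤ 0) : φ x = 0 :=
  image_eq_zero_of_notMem_tsupport fun h => not_lt.2 hx (φ.tsupport_subset h)

/-- A test function with vanishing integral is the derivative of a test function. -/
theorem exists_derivTest_eq (ψ : 𝓓(halfLine, ℝ)) (h : ∫ x in Ioi (0 : ℝ), ψ x = 0) :
    ∃ ζ : 𝓓(halfLine, ℝ), derivTest ζ = ψ := by
  obtain ⟨a, b, ha, hab, hs⟩ := exists_tsupport_subset_Icc ψ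
  have hd : ∀ x, HasDerivAt (fun x => ∫ y in (0 : ℝ)..x, ψ y) (ψ x) x := fun x =>
    intervalIntegral.integral_hasDerivAt_right (ψ.continuous.intervalIntegrable _ _)
      ψ.continuous.stronglyMeasurable.stronglyMeasurableAtFilter ψ.continuous.continuousAt
  have hdd : deriv (fun x => ∫ y in (0 : ℝ)..x, ψ y) = ψ := funext fun x => (hd x).deriv
  -- The primitive vanishes left of the support trivially, and right of it because the total
  -- integral is 0.
  have hsupp : tsupport (fun x => ∫ y in (0 : ℝ)..x, ψ y) ⊆ Icc a b := by
    refine closure_minimal (fun x hx => ?_) isClosed_Icc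
    by_contra hn
    refine hx ?_
    by_cases hxa : x < a
    · refine intervalIntegral.integral_zero_ae (Eventually.of_forall fun y hy => ?_)
      refine image_eq_zero_of_notMem_tsupport fun hy' => ?_
      have h1 := (hs hy').1
      have h2 : y ≤ max 0 x := hy.2
      exact absurd h2 (not_le.2 (max_lt (ha.trans_le h1) (hxa.trans_le h1)))
    · have hxb : b < x := by
        by_contra hb
        exact hn ⟨not_lt.1 hxa, not_lt.1 hb⟩
      simp only
      rw [intervalIntegral.integral_of_le (by linarith)]
      refine Eq.trans ?_ h
      refine (setIntegral_eq_of_subset_of_forall_sdiff_eq_zero measurableSet_Ioi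
        Ioc_subset_Ioi_self fun y hy => ?_).symm
      refine image_eq_zero_of_notMem_tsupport fun hy' => hy.2 ⟨hy.1, ?_⟩
      exact (hs hy').2.trans hxb.le
  refine ⟨⟨fun x => ∫ y in (0 : ℝ)..x, ψ y, ?_, ?_, ?_⟩, ?_⟩
  · refine contDiff_infty_iff_deriv.2 ⟨fun x => (hd x).differentiableAt, ?_⟩
    rw [hdd]
    exact ψ.contDiff
  · exact isCompact_Icc.of_isClosed_subset (isClosed_tsupport _) hsupp
  · exact hsupp.trans fun x hx => ha.trans_le hx.1
  · ext x
    exact congrFun hdd x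

theorem integral_test_smul_eq {E : Type*} [NormedAddCommGroup E] [NormedSpace ℝ E]
    (φ : 𝓓(halfLine, ℝ)) (h : ℝ → E) :
    ∫ x in Ioi (0 : ℝ), φ x • h x = ∫ x, φ x • h x :=
  setIntegral_eq_integral_of_forall_compl_eq_zero fun x hx => by
    rw [test_eq_zero_of_nonpos φ (not_lt.1 hx), zero_smul]

theorem integrable_test_smul {E : Type*} [NormedAddCommGroup E] [NormedSpace ℝ E]
    (φ : 𝓓(halfLine, ℝ)) {h : ℝ → E} (hh : LocallyIntegrableOn h (Ioi 0)) :
    Integrable fun x => φ x • h x := by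
  rw [← integrableOn_iff_integrable_of_support_subset (s := tsupport φ)]
  · exact (hh.integrableOn_compact_subset φ.tsupport_subset
      φ.hasCompactSupport).continuousOn_smul φ.continuous.continuousOn φ.hasCompactSupport
  · intro x hx
    refine subset_tsupport _ fun h0 => ?_
    simp [h0] at hx

/-- Integration by parts against a test function on the half-line. -/
theorem integral_derivTest_smul {E : Type*} [NormedAddCommGroup E] [NormedSpace ℝ E]
    [CompleteSpace E] (φ : 𝓓(halfLine, ℝ)) {G G' : ℝ → E}
    (hG : ∀ x, 0 < x → HasDerivAt G (G' x) x) (hG' : ContinuousOn G' (Ioi 0)) :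
    ∫ x in Ioi (0 : ℝ), derivTest φ x • G x = -∫ x in Ioi (0 : ℝ), φ x • G' x := by
  have hGc : ContinuousOn G (Ioi 0) := fun x hx => (hG x hx).continuousAt.continuousWithinAt
  have i0 := integrable_test_smul φ (hGc.locallyIntegrableOn measurableSet_Ioi)
  have i1 := integrable_test_smul φ (hG'.locallyIntegrableOn measurableSet_Ioi)
  have i2 := integrable_test_smul (derivTest φ) (hGc.locallyIntegrableOn measurableSet_Ioi)
  rw [integral_test_smul_eq, integral_test_smul_eq, eq_neg_iff_add_eq_zero, add_comm,
    ← integral_add i1 i2]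
  refine integral_eq_zero_of_hasDerivAt_of_integrable (fun x => ?_) (i1.add i2) i0
  by_cases hx : x ∈ tsupport φ
  · exact (hasDerivAt_test φ x).fun_smul (hG x (φ.tsupport_subset hx))
  · have h0 : (fun y => φ y • G y) =ᶠ[𝓝 x] fun _ => 0 := by
      filter_upwards [notMem_tsupport_iff_eventuallyEq.1 hx] with y hy
      simp [hy]
    have e1 : φ x = 0 := image_eq_zero_of_notMem_tsupport hx
    have e2 : derivTest φ x = 0 :=
      image_eq_zero_of_notMem_tsupport fun h => hx (tsupport_deriv_subset h)
    rw [e1, e2, zero_smul, zero_smul, add_zero]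
    exact (hasDerivAt_const x (0 : E)).congr_of_eventuallyEq h0

/-- Integration by parts for the primitive of a locally integrable function. -/
theorem integral_derivTest_smul_primitive (φ : 𝓓(halfLine, ℝ)) {G : ℝ → ℂ}
    (hG : ∀ s, IntegrableOn G (Ioc 0 s)) :
    ∫ x in Ioi (0 : ℝ), derivTest φ x • (∫ y in (0 : ℝ)..x, G y)
      = -∫ x in Ioi (0 : ℝ), φ x • G x := by
  obtain ⟨a, b, ha, hab, hs⟩ := exists_tsupport_subset_Icc φ
  -- G has no pointwise derivative relation to its primitive, so the proof is Fubini on the triangle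
  -- y ≤ x. Cutting G off at b, beyond the support of the test function, secures integrability.
  set D : Set (ℝ × ℝ) := {p | p.2 ≤ p.1} with hD
  have hDm : MeasurableSet D := measurableSet_le measurable_snd measurable_fst
  have hb : ∀ x, b < x → derivTest φ x = 0 := fun x hx =>
    image_eq_zero_of_notMem_tsupport fun h =>
      not_lt.2 (hs (tsupport_deriv_subset h)).2 hx
  have hint : Integrable (D.indicator fun p : ℝ × ℝ =>
      ((derivTest φ p.1 : ℝ) : ℂ) * (Ioc 0 b).indicator G p.2)
      ((volume.restrict (Ioi 0)).prod (volume.restrict (Ioi 0))) := by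
    refine Integrable.indicator (Integrable.mul_prod (f := fun x => ((derivTest φ x : ℝ) : ℂ))
      (g := (Ioc 0 b).indicator G) ?_ ?_) hDm
    · exact (((derivTest φ).continuous.integrable_of_hasCompactSupport
        (derivTest φ).hasCompactSupport).ofReal).restrict
    · exact ((integrable_indicator_iff measurableSet_Ioc).2 (hG b)).restrict
  have hL : ∀ x ∈ Ioi (0 : ℝ), derivTest φ x • (∫ y in (0 : ℝ)..x, G y)
      = ∫ y in Ioi (0 : ℝ), D.indicator (fun p : ℝ × ℝ =>
      ((derivTest φ p.1 : ℝ) : ℂ) * (Ioc 0 b).indicator G p.2) (x, y) := by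
    intro x hx
    have hx' : (0 : ℝ) < x := hx
    by_cases hxb : b < x
    · rw [hb x hxb, zero_smul]
      refine (integral_eq_zero_of_ae (Eventually.of_forall fun y => ?_)).symm
      simp [indicator, hb x hxb]
    · rw [intervalIntegral.integral_of_le hx'.le, Complex.real_smul, ← integral_const_mul]
      have e : Ioc 0 x = Ioi 0 ∩ Iic x := Ioi_inter_Iic.symm
      rw [e, ← setIntegral_indicator measurableSet_Iic]
      refine setIntegral_congr_fun measurableSet_Ioi fun y hy => ?_
      have hy' : (0 : ℝ) < y := hy
      by_cases hyx : y ≤ x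
      · have : y ∈ Ioc 0 b := ⟨hy', hyx.trans (not_lt.1 hxb)⟩
        simp [indicator, hD, hyx, this.1, this.2]
      · simp [indicator, hD, hyx]
  have hR : ∀ y ∈ Ioi (0 : ℝ), ∫ x in Ioi (0 : ℝ), D.indicator (fun p : ℝ × ℝ =>
      ((derivTest φ p.1 : ℝ) : ℂ) * (Ioc 0 b).indicator G p.2) (x, y) = -(φ y • G y) := by
    intro y hy
    have hy' : (0 : ℝ) < y := hy
    have e0 : ∫ x in Ioi y, ((derivTest φ x : ℝ) : ℂ) = -(φ y : ℂ) := by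
      simp only [derivTest_apply]
      rw [integral_complex_ofReal, φ.hasCompactSupport.integral_Ioi_deriv_eq
        (φ.contDiff.of_le (by simp)) y]
      simp
    have e1 : ∀ x, D.indicator (fun p : ℝ × ℝ =>
        ((derivTest φ p.1 : ℝ) : ℂ) * (Ioc 0 b).indicator G p.2) (x, y)
        = (Ici y).indicator (fun x => ((derivTest φ x : ℝ) : ℂ)) x * (Ioc 0 b).indicator G y := by
      intro x
      by_cases hxy : y ≤ x <;> simp [indicator, hD, hxy]
    simp only [e1]
    rw [integral_mul_const, setIntegral_indicator measurableSet_Ici,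
      inter_eq_self_of_subset_right (Ici_subset_Ioi.2 hy'),
      integral_Ici_eq_integral_Ioi, e0]
    by_cases hyb : y ≤ b
    · rw [indicator_of_mem (show y ∈ Ioc 0 b from ⟨hy', hyb⟩), Complex.real_smul, neg_mul]
    · have : φ y = 0 := image_eq_zero_of_notMem_tsupport fun h => hyb (hs h).2
      simp [this]
  rw [setIntegral_congr_fun measurableSet_Ioi hL, integral_integral_swap (f := fun x y =>
    D.indicator (fun p : ℝ × ℝ => ((derivTest φ p.1 : ℝ) : ℂ) * (Ioc 0 b).indicator G p.2) (x, y))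
    hint,
    setIntegral_congr_fun measurableSet_Ioi hR, integral_neg]

end TestFunctions

/-! ### The weak equation in divergence form. -/

section Adjoint

variable {σ d k n : ℝ}

/-- The formal adjoint in divergence form. -/
theorem formalAdjoint_eq (η : 𝓓(halfLine, ℝ)) {x : ℝ} (hx : 0 < x) :
    formalAdjoint (2 - σ) (1 + d - 2 * k) (k * (k - d)) (rpowMulTest (σ - 1 + d - k) η) x
      = x ^ (-k) * derivTest (rpowMulTest (1 + d) (derivTest η)) x := by
  have hη := hasDerivAt_test η
  have hη' := hasDerivAt_test (derivTest η)
  have hpow : ∀ (p y : ℝ), 0 < y → HasDerivAt (fun y : ℝ => y ^ p) (p * y ^ (p - 1)) y :=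
    fun p y hy => Real.hasDerivAt_rpow_const (Or.inl hy.ne')
  set γ : ℝ := 1 + d - k with hγ
  have e0 : ∀ p q : ℝ, p + (σ - 1 + d - k) = q → ∀ y, 0 < y →
      y ^ p * rpowMulTest (σ - 1 + d - k) η y = y ^ q * η y := by
    intro p q hpq y hy
    rw [rpowMulTest_apply, ← mul_assoc, ← Real.rpow_add hy, hpq]
  have hev : ∀ {f g : ℝ → ℝ}, (∀ y, 0 < y → f y = g y) → ∀ y, 0 < y → f =ᶠ[𝓝 y] g :=
    fun h y hy => (eventually_gt_nhds hy).mono fun z hz => h z hz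
  have d1 : ∀ y, 0 < y → deriv (fun y => y ^ (2 - σ) * rpowMulTest (σ - 1 + d - k) η y) y
      = γ * y ^ (γ - 1) * η y + y ^ γ * derivTest η y := by
    intro y hy
    rw [(hev (e0 (2 - σ) γ (by rw [hγ]; ring)) y hy).deriv_eq]
    exact ((hpow γ y hy).mul (hη y)).deriv
  have d2 : deriv (deriv fun y => y ^ (2 - σ) * rpowMulTest (σ - 1 + d - k) η y) x
      = γ * ((γ - 1) * x ^ (γ - 1 - 1)) * η x + γ * x ^ (γ - 1) * derivTest η x
        + (γ * x ^ (γ - 1) * derivTest η x + x ^ γ * derivTest (derivTest η) x) := by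
    rw [(hev d1 x hx).deriv_eq]
    exact ((((hpow (γ - 1) x hx).const_mul γ).mul (hη x)).add
      ((hpow γ x hx).mul (hη' x))).deriv
  have d3 : deriv (fun y => y ^ (2 - σ - 1) * rpowMulTest (σ - 1 + d - k) η y) x
      = (γ - 1) * x ^ (γ - 1 - 1) * η x + x ^ (γ - 1) * derivTest η x := by
    rw [(hev (e0 (2 - σ - 1) (γ - 1) (by rw [hγ]; ring)) x hx).deriv_eq]
    exact ((hpow (γ - 1) x hx).mul (hη x)).deriv
  have d4 : derivTest (rpowMulTest (1 + d) (derivTest η)) x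
      = (1 + d) * x ^ (1 + d - 1) * derivTest η x + x ^ (1 + d) * derivTest (derivTest η) x :=
    ((hpow (1 + d) x hx).mul (hη' x)).deriv
  rw [formalAdjoint, d2, d3, d4, e0 (2 - σ - 2) (γ - 1 - 1) (by rw [hγ]; ring) x hx]
  have p1 : x ^ (-k) * x ^ (1 + d - 1) = x ^ (γ - 1) := by
    rw [← Real.rpow_add hx]; congr 1; rw [hγ]; ring
  have p2 : x ^ (-k) * x ^ (1 + d) = x ^ γ := by
    rw [← Real.rpow_add hx]; congr 1; rw [hγ]; ring
  generalize x ^ (γ - 1 - 1) = P, x ^ (γ - 1) = Q, x ^ γ = R, x ^ (-k) = S,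
    x ^ (1 + d - 1) = U, x ^ (1 + d) = V at *
  rw [hγ]
  linear_combination -(1 + d) * derivTest η x * p1 - derivTest (derivTest η) x * p2

theorem rpowMulTest_rpowMulTest_neg (s : ℝ) (φ : 𝓓(halfLine, ℝ)) :
    rpowMulTest s (rpowMulTest (-s) φ) = φ := by
  ext y
  rcases le_or_gt y 0 with hy | hy
  · rw [test_eq_zero_of_nonpos _ hy, test_eq_zero_of_nonpos _ hy]
  · rw [rpowMulTest_apply, rpowMulTest_apply, ← mul_assoc, ← Real.rpow_add hy, add_neg_cancel,
      Real.rpow_zero, one_mul]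

/-- The weak formulation of the equation, tested in divergence form. -/
theorem hasDistribOp_iff {f g : ℝ → ℂ} :
    HasDistribOp (2 - σ) (1 + d - 2 * k) (k * (k - d)) f g ↔ ∀ η : 𝓓(halfLine, ℝ),
      ∫ x in Ioi (0 : ℝ), derivTest (rpowMulTest (1 + d) (derivTest η)) x • (x ^ (-k) • f x)
        = ∫ x in Ioi (0 : ℝ), η x • (x ^ (σ - 1 + d - k) • g x) := by
  have key : ∀ η : 𝓓(halfLine, ℝ),
      (∫ x in Ioi (0 : ℝ), formalAdjoint (2 - σ) (1 + d - 2 * k) (k * (k - d))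
        (rpowMulTest (σ - 1 + d - k) η) x • f x
        = ∫ x in Ioi (0 : ℝ), rpowMulTest (σ - 1 + d - k) η x • g x) ↔
      ∫ x in Ioi (0 : ℝ), derivTest (rpowMulTest (1 + d) (derivTest η)) x • (x ^ (-k) • f x)
        = ∫ x in Ioi (0 : ℝ), η x • (x ^ (σ - 1 + d - k) • g x) := by
    intro η
    have e1 : ∀ x ∈ Ioi (0 : ℝ), formalAdjoint (2 - σ) (1 + d - 2 * k) (k * (k - d))
        (rpowMulTest (σ - 1 + d - k) η) x • f x
        = derivTest (rpowMulTest (1 + d) (derivTest η)) x • (x ^ (-k) • f x) := fun x hx => by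
      rw [formalAdjoint_eq η hx, smul_smul, mul_comm]
    have e2 : ∀ x ∈ Ioi (0 : ℝ), rpowMulTest (σ - 1 + d - k) η x • g x
        = η x • (x ^ (σ - 1 + d - k) • g x) := fun x _ => by
      rw [rpowMulTest_apply, smul_smul, mul_comm]
    rw [setIntegral_congr_fun measurableSet_Ioi e1, setIntegral_congr_fun measurableSet_Ioi e2]
  refine ⟨fun h η => (key η).1 (h _), fun h φ => ?_⟩
  have := (key (rpowMulTest (-(σ - 1 + d - k)) φ)).2 (h _)
  rwa [rpowMulTest_rpowMulTest_neg] at this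

/-- Two integrations by parts. The first is classical, since the outer primitive is C¹ and x^(1+d)
cancels its weight; the second falls on the primitive of a merely integrable function. -/
theorem weak_eq_doublePrim {β : ℝ} (hn : n ≤ β) {g : ℝ → ℂ} (hg : Integrable g (wMeasure n))
    (c : ℂ) (η : 𝓓(halfLine, ℝ)) :
    ∫ x in Ioi (0 : ℝ), derivTest (rpowMulTest (1 + d) (derivTest η)) x • (c + doublePrim β d g x)
      = ∫ x in Ioi (0 : ℝ), η x • (x ^ β • g x) := by
  rw [integral_derivTest_smul _
    (fun x hx => (hasDerivAt_doublePrim (d := d) hn hg hx).const_add c)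
    (continuousOn_doublePrim_integrand hn hg)]
  have e : ∀ x ∈ Ioi (0 : ℝ), rpowMulTest (1 + d) (derivTest η) x •
      (x ^ (-1 - d) • weightedPrim β g x)
      = derivTest η x • ∫ y in (0 : ℝ)..x, y ^ β • g y := fun x hx => by
    rw [rpowMulTest_apply, smul_smul, mul_comm, ← mul_assoc, ← Real.rpow_add hx]
    simp [weightedPrim]
  rw [setIntegral_congr_fun measurableSet_Ioi e,
    integral_derivTest_smul_primitive η (integrableOn_rpow_smul hn hg), neg_neg]

theorem hasDistribOp_of_mem_primitiveGraph (hn : n ≤ σ - 1 + d - k) {p : X n × X n}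
    (hp : p ∈ primitiveGraph k d hn) :
    HasDistribOp (2 - σ) (1 + d - 2 * k) (k * (k - d)) p.1 p.2 := by
  obtain ⟨c, hc⟩ := mem_primitiveGraph.1 hp
  refine hasDistribOp_iff.2 fun η => ?_
  rw [← weak_eq_doublePrim hn p.2.integrable c]
  refine integral_congr_ae ?_
  filter_upwards [ae_eq_restrict hc, ae_restrict_mem measurableSet_Ioi] with x h1 hx
  rw [h1, smul_smul (x ^ (-k)), ← Real.rpow_add hx, neg_add_cancel, Real.rpow_zero, one_smul]

end Adjoint

/-! ### Distributional solutions of the homogeneous and inhomogeneous equations. -/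

section DuBoisReymond

variable {d : ℝ}

/-- Integration of test functions against a real function, as a linear functional. -/
def testFunctional {h : ℝ → ℝ} (hh : LocallyIntegrableOn h (Ioi 0)) :
    𝓓(halfLine, ℝ) →ₗ[ℝ] ℝ where
  toFun φ := ∫ x in Ioi (0 : ℝ), φ x • h x
  map_add' φ ψ := by
    rw [← integral_add (integrable_test_smul φ hh).restrict (integrable_test_smul ψ hh).restrict]
    simp only [← add_smul]
    rfl
  map_smul' c φ := by
    rw [RingHom.id_apply, ← integral_smul]
    simp only [smul_smul]
    rfl

theorem testFunctional_apply {h : ℝ → ℝ} (hh : LocallyIntegrableOn h (Ioi 0))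
    (φ : 𝓓(halfLine, ℝ)) : testFunctional hh φ = ∫ x in Ioi (0 : ℝ), φ x • h x := rfl

theorem locallyIntegrableOn_rpow (s : ℝ) : LocallyIntegrableOn (fun x : ℝ => x ^ s) (Ioi 0) :=
  ContinuousOn.locallyIntegrableOn (fun x hx => (Real.continuousAt_rpow_const x s
    (Or.inl (ne_of_gt hx))).continuousWithinAt) measurableSet_Ioi

theorem ae_eq_zero_of_test {E : Type*} [NormedAddCommGroup E]
    [NormedSpace ℝ E] [CompleteSpace E] {h : ℝ → E} (hh : LocallyIntegrableOn h (Ioi 0))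
    (h0 : ∀ φ : 𝓓(halfLine, ℝ), ∫ x in Ioi (0 : ℝ), φ x • h x = 0) :
    h =ᵐ[volume.restrict (Ioi 0)] 0 := by
  refine (ae_restrict_iff' measurableSet_Ioi).2 ?_
  refine isOpen_Ioi.ae_eq_zero_of_integral_contDiff_smul_eq_zero hh fun φ h1 h2 h3 => ?_
  rw [← h0 ⟨φ, h1, h2, h3⟩]
  exact (integral_test_smul_eq ⟨φ, h1, h2, h3⟩ h).symm

/-- A test function has the form (x^(1+d) η′)′ as soon as it annihilates 1 and x^(−d): the first
condition makes it a derivative ζ′, the second makes x^(−1−d) ζ a derivative. So the functional of h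
vanishes on the common kernel of two functionals. -/
theorem ae_eq_of_weak_eq_zero_real (hd : 0 < d) {h : ℝ → ℝ}
    (hh : LocallyIntegrableOn h (Ioi 0))
    (h0 : ∀ η : 𝓓(halfLine, ℝ),
      ∫ x in Ioi (0 : ℝ), derivTest (rpowMulTest (1 + d) (derivTest η)) x • h x = 0) :
    ∃ c B : ℝ, h =ᵐ[volume.restrict (Ioi 0)] fun x => c + B * x ^ (-d) := by
  have hker : ⨅ i : Fin 2, LinearMap.ker
      ((![testFunctional (locallyIntegrableOn_rpow 0), testFunctional (locallyIntegrableOn_rpow (-d))]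
        : Fin 2 → 𝓓(halfLine, ℝ) →ₗ[ℝ] ℝ) i) ≤ LinearMap.ker (testFunctional hh) := by
    intro ψ hψ
    rw [Submodule.mem_iInf] at hψ
    have h1 : testFunctional (locallyIntegrableOn_rpow 0) ψ = 0 := hψ 0
    have h2 : testFunctional (locallyIntegrableOn_rpow (-d)) ψ = 0 := hψ 1
    rw [LinearMap.mem_ker]
    simp only [testFunctional_apply, Real.rpow_zero, smul_eq_mul, mul_one] at h1 h2 ⊢
    obtain ⟨ζ, rfl⟩ := exists_derivTest_eq ψ h1
    have h3 := integral_derivTest_smul ζ (G := fun x : ℝ => x ^ (-d))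
      (G' := fun x => -d * x ^ (-d - 1))
      (fun x hx => Real.hasDerivAt_rpow_const (Or.inl hx.ne'))
      (fun x hx => (continuousAt_const.mul (Real.continuousAt_rpow_const x _
        (Or.inl (ne_of_gt hx)))).continuousWithinAt)
    simp only [smul_eq_mul] at h3
    rw [h2] at h3
    have h4 : ∫ x in Ioi (0 : ℝ), rpowMulTest (-1 - d) ζ x = 0 := by
      have e : ∀ x : ℝ, ζ x * (-d * x ^ (-d - 1)) = -d * rpowMulTest (-1 - d) ζ x := fun x => by
        rw [rpowMulTest_apply, show -d - 1 = -1 - d by ring]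
        ring
      simp only [e, integral_const_mul] at h3
      have h5 : d * ∫ x in Ioi (0 : ℝ), rpowMulTest (-1 - d) ζ x = 0 := by linarith
      exact (mul_eq_zero.1 h5).resolve_left hd.ne'
    obtain ⟨η, hη⟩ := exists_derivTest_eq _ h4
    have e : rpowMulTest (1 + d) (derivTest η) = ζ := by
      rw [hη]
      have := rpowMulTest_rpowMulTest_neg (1 + d) ζ
      rwa [neg_add'] at this
    have := h0 η
    rwa [e] at this
  -- Pure linear algebra: a functional vanishing on the common kernel of finitely many functionals
  -- is a linear combination of them.
  obtain ⟨a, ha⟩ := (Submodule.mem_span_range_iff_exists_fun ℝ).1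
    (mem_span_of_iInf_ker_le_ker hker)
  rw [Fin.sum_univ_two] at ha
  refine ⟨a 0, a 1, ?_⟩
  have hloc : LocallyIntegrableOn (fun x : ℝ => a 0 + a 1 * x ^ (-d)) (Ioi 0) :=
    ContinuousOn.locallyIntegrableOn (fun x hx => (continuousAt_const.add
      (continuousAt_const.mul (Real.continuousAt_rpow_const x _
        (Or.inl (ne_of_gt hx))))).continuousWithinAt) measurableSet_Ioi
  have hz := ae_eq_zero_of_test (hh.sub hloc) fun φ => by
    have e1 := LinearMap.congr_fun ha φ
    simp only [LinearMap.add_apply, LinearMap.smul_apply, testFunctional_apply,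
      Matrix.cons_val_zero, Matrix.cons_val_one, Real.rpow_zero, smul_eq_mul, mul_one] at e1
    have i0 : Integrable fun x => φ x := φ.continuous.integrable_of_hasCompactSupport
      φ.hasCompactSupport
    have i1 := integrable_test_smul φ (locallyIntegrableOn_rpow (-d))
    have i2 := integrable_test_smul φ hh
    have e2 : ∀ x, φ x • (h - fun x : ℝ => a 0 + a 1 * x ^ (-d)) x
        = φ x • h x - (a 0 * φ x + a 1 * (φ x • x ^ (-d))) := fun x => by
      simp only [Pi.sub_apply, smul_eq_mul]
      ring
    simp only [e2]
    rw [integral_sub i2.restrict ((i0.const_mul _).fun_add (i1.const_mul _)).restrict,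
      integral_add (i0.const_mul _).restrict (i1.const_mul _).restrict, integral_const_mul,
      integral_const_mul]
    simp only [smul_eq_mul]
    rw [e1, sub_self]
  filter_upwards [hz] with x hx
  simpa [sub_eq_zero] using hx

theorem ae_eq_of_weak_eq_zero (hd : 0 < d) {h : ℝ → ℂ}
    (hh : LocallyIntegrableOn h (Ioi 0))
    (h0 : ∀ η : 𝓓(halfLine, ℝ),
      ∫ x in Ioi (0 : ℝ), derivTest (rpowMulTest (1 + d) (derivTest η)) x • h x = 0) :
    ∃ c B : ℂ, h =ᵐ[volume.restrict (Ioi 0)] fun x => c + x ^ (-d) • B := by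
  have key : ∀ L : ℂ →L[ℝ] ℝ, ∃ c B : ℝ,
      (fun x => L (h x)) =ᵐ[volume.restrict (Ioi 0)] fun x => c + B * x ^ (-d) := by
    intro L
    refine ae_eq_of_weak_eq_zero_real hd ?_ fun η => ?_
    · intro x hx
      exact (hh x hx).imp fun s hs => ⟨hs.1, L.integrable_comp hs.2⟩
    · have := L.integral_comp_comm (μ := volume.restrict (Ioi 0)) (integrable_test_smul
        (derivTest (rpowMulTest (1 + d) (derivTest η))) hh).restrict
      rw [h0 η, map_zero] at this
      simpa only [map_smul] using this
  obtain ⟨c₁, B₁, h1⟩ := key Complex.reCLM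
  obtain ⟨c₂, B₂, h2⟩ := key Complex.imCLM
  refine ⟨⟨c₁, c₂⟩, ⟨B₁, B₂⟩, ?_⟩
  filter_upwards [h1, h2] with x h3 h4
  simp only [Complex.reCLM_apply, Complex.imCLM_apply] at h3 h4
  apply Complex.ext
  · simp [h3, mul_comm]
  · simp [h4, mul_comm]

/-- The distributional solutions of the equation. -/
theorem HasDistribOp.exists_ae_eq {σ k n : ℝ} (hd : 0 < d) (hn : n ≤ σ - 1 + d - k) {f g : ℝ → ℂ}
    (hf : Integrable f (wMeasure n)) (hg : Integrable g (wMeasure n))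
    (h : HasDistribOp (2 - σ) (1 + d - 2 * k) (k * (k - d)) f g) :
    ∃ c B : ℂ, f =ᵐ[wMeasure n]
      fun x => x ^ k • (c + doublePrim (σ - 1 + d - k) d g x + x ^ (-d) • B) := by
  have l1 : LocallyIntegrableOn (fun x => x ^ (-k) • f x) (Ioi 0) :=
    LocallyIntegrableOn.continuousOn_smul (isOpen_Ioi.isLocallyClosed)
      (locallyIntegrableOn_of_wMeasure hf) (g := fun x : ℝ => x ^ (-k))
      (fun x hx => (Real.continuousAt_rpow_const x _ (Or.inl (ne_of_gt hx))).continuousWithinAt)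
  have l2 : LocallyIntegrableOn (doublePrim (σ - 1 + d - k) d g) (Ioi 0) :=
    (continuousOn_doublePrim hn hg).locallyIntegrableOn measurableSet_Ioi
  obtain ⟨c, B, hcB⟩ := ae_eq_of_weak_eq_zero hd (l1.sub l2) fun η => by
    have h1 := hasDistribOp_iff.1 h η
    have h2 := weak_eq_doublePrim (d := d) hn hg 0 η
    simp only [zero_add] at h2
    simp only [Pi.sub_apply, smul_sub]
    rw [integral_sub (integrable_test_smul _ l1).restrict (integrable_test_smul _ l2).restrict,
      h1, h2, sub_self]
  refine ⟨c, B, ae_wMeasure_iff.2 ?_⟩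
  filter_upwards [hcB, ae_restrict_mem measurableSet_Ioi] with x h1 hx
  have h2 : x ^ (-k) • f x = c + doublePrim (σ - 1 + d - k) d g x + x ^ (-d) • B := by
    rw [Pi.sub_apply, sub_eq_iff_eq_add] at h1
    rw [h1]
    ring
  rw [← h2, smul_smul, ← Real.rpow_add hx, add_neg_cancel, Real.rpow_zero, one_smul]

end DuBoisReymond

/-! ### The curve solves the equation. -/

section CurveMembership

variable {σ d k n : ℝ}

theorem hasDerivAt_heatCurve_heatVar (hσ : 0 < σ) (ν : ℝ) (w : ℂ) {x : ℝ} (hx : 0 < x) :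
    HasDerivAt (fun x => heatCurve ν w (heatVar σ x))
      (heatCurve ν w (heatVar σ x) * (-(heatVarDeriv σ x : ℂ) / w)) x := by
  have h1 : HasDerivAt (fun x => -(heatVar σ x : ℂ) / w) (-(heatVarDeriv σ x : ℂ) / w) x :=
    ((hasDerivAt_heatVar hσ hx).ofReal_comp.neg).div_const w
  have h2 := h1.cexp.const_mul (w ^ (-(ν + 1 : ℝ) : ℂ))
  refine h2.congr_deriv ?_
  rw [heatCurve]
  ring

/-- The curve satisfies ∂_w e = A e, so the primitive is the flux x^(1+d) (x^(−k) e)′. It vanishes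
at 0 because d + σ > 0. -/
theorem weightedPrim_curveDerivFun (hσ : 0 < σ) (hd : 0 < d) (hk : -1 < n + k)
    (hn : n ≤ σ - 1 + d - k) {w : ℂ} (hw : 0 < w.re) {s : ℝ} (hs : 0 < s) :
    weightedPrim (σ - 1 + d - k) (curveDerivFun σ d k w) s
      = ((s ^ (d + σ) : ℝ) : ℂ) * (heatCurve (d / σ) w (heatVar σ s) * (-1 / (σ * w))) := by
  have hw0 : w ≠ 0 := fun h => by simp [h] at hw
  have hσ0 : (σ : ℂ) ≠ 0 := by exact_mod_cast hσ.ne'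
  have hcont : Continuous fun x : ℝ => ((x ^ (d + σ) : ℝ) : ℂ)
      * (heatCurve (d / σ) w (heatVar σ x) * (-1 / (σ * w))) := by
    have h1 : Continuous fun x : ℝ => x ^ (d + σ) :=
      Real.continuous_rpow_const (by positivity)
    have h2 : Continuous (heatVar σ) := (Real.continuous_rpow_const hσ.le).div_const _
    unfold heatCurve
    fun_prop
  have hderiv : ∀ x ∈ Ioo 0 s, HasDerivAt (fun x : ℝ => ((x ^ (d + σ) : ℝ) : ℂ)
      * (heatCurve (d / σ) w (heatVar σ x) * (-1 / (σ * w))))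
      (x ^ (σ - 1 + d - k) • curveDerivFun σ d k w x) x := by
    intro x hx
    have hx0 : 0 < x := hx.1
    have h1 := ((Real.hasDerivAt_rpow_const (p := d + σ) (Or.inl hx0.ne')).ofReal_comp).mul
      ((hasDerivAt_heatCurve_heatVar hσ (d / σ) w hx0).mul_const (-1 / (σ * w) : ℂ))
    refine h1.congr_deriv ?_
    have p1 : x ^ (d + σ) = x * x ^ (d + σ - 1) := by
      rw [Real.rpow_sub_one hx0.ne']; field_simp
    have p2 : x ^ (σ - 1 + d - k) * x ^ k = x ^ (d + σ - 1) := by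
      rw [← Real.rpow_add hx0]; congr 1; ring
    have p3 : x ^ σ = x * x ^ (σ - 1) := by
      rw [Real.rpow_sub_one hx0.ne']; field_simp
    have e1 : x ^ (σ - 1 + d - k) • curveDerivFun σ d k w x
        = ((x ^ (d + σ - 1) : ℝ) : ℂ) * heatCurve (d / σ) w (heatVar σ x)
          * (((x * x ^ (σ - 1) : ℝ) : ℂ) / σ ^ 2 / w ^ 2 - (d / σ + 1 : ℝ) / w) := by
      rw [curveDerivFun, curveFun, ← p2, ← p3, Complex.real_smul, heatVar]
      push_cast
      ring
    rw [e1, heatVarDeriv, p1]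
    push_cast
    field_simp
    ring
  rw [weightedPrim, intervalIntegral.integral_eq_sub_of_hasDerivAt_of_le hs.le hcont.continuousOn
    hderiv ((intervalIntegrable_rpow_smul hn (integrable_curveDerivFun hσ hd hk hw) le_rfl hs.le))]
  simp [Real.zero_rpow (by positivity : d + σ ≠ 0)]

theorem doublePrim_curveDerivFun (hσ : 0 < σ) (hd : 0 < d) (hk : -1 < n + k)
    (hn : n ≤ σ - 1 + d - k) {w : ℂ} (hw : 0 < w.re) {x : ℝ} (hx : 0 < x) :
    doublePrim (σ - 1 + d - k) d (curveDerivFun σ d k w) x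
      = heatCurve (d / σ) w (heatVar σ x) - heatCurve (d / σ) w (heatVar σ 1) := by
  have hp : ∀ s ∈ uIcc 1 x, 0 < s := fun s hs => (lt_min one_pos hx).trans_le hs.1
  rw [doublePrim]
  refine intervalIntegral.integral_eq_sub_of_hasDerivAt
    (f := fun x => heatCurve (d / σ) w (heatVar σ x)) (fun s hs => ?_)
    (intervalIntegrable_doublePrim_integrand hn (integrable_curveDerivFun hσ hd hk hw) one_pos hx)
  have hs0 := hp s hs
  refine (hasDerivAt_heatCurve_heatVar hσ (d / σ) w hs0).congr_deriv ?_
  have p1 : s ^ (-1 - d) * s ^ (d + σ) = s ^ (σ - 1) := by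
    rw [← Real.rpow_add hs0]; congr 1; ring
  rw [weightedPrim_curveDerivFun hσ hd hk hn hw hs0, heatVarDeriv, Complex.real_smul, ← mul_assoc,
    ← Complex.ofReal_mul, p1]
  have hw0 : w ≠ 0 := fun h => by simp [h] at hw
  have hσ0 : (σ : ℂ) ≠ 0 := by exact_mod_cast hσ.ne'
  push_cast
  field_simp

theorem curve_mem_primitiveGraph (hσ : 0 < σ) (hd : 0 < d) (hk : -1 < n + k)
    (hn : n ≤ σ - 1 + d - k) {w : ℂ} (hw : 0 < w.re) :
    (toX n (curveFun σ d k w), toX n (curveDerivFun σ d k w))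
      ∈ primitiveGraph (β := σ - 1 + d - k) k d hn := by
  refine mem_primitiveGraph.2 ⟨heatCurve (d / σ) w (heatVar σ 1), ?_⟩
  have h2 := ae_eq_restrict (coeFn_toX (integrable_curveDerivFun hσ hd hk hw))
  filter_upwards [coeFn_toX (integrable_curveFun hσ hd hk hw),
    ae_wMeasure_of_pos (m := n) (p := fun x => 0 < x) fun x hx => hx] with x h1 hx
  rw [h1, doublePrim_congr hx h2, doublePrim_curveDerivFun hσ hd hk hn hw hx, add_sub_cancel,
    curveFun, Complex.real_smul]

end CurveMembership

/-! ### Injectivity of 1 − A on regular solutions. -/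

section Uniqueness

/-- If `M' = x^p G` and `G' = x^q M` on the half-line and `M` vanishes at `0`, then `|G|` is
nondecreasing. -/
theorem monotoneOn_norm_sq_of_cooperative {E : Type*} [NormedAddCommGroup E]
    [InnerProductSpace ℝ E] {M G : ℝ → E} {p q : ℝ}
    (hM : ∀ x, 0 < x → HasDerivAt M (x ^ p • G x) x)
    (hG : ∀ x, 0 < x → HasDerivAt G (x ^ q • M x) x)
    (h0 : Tendsto M (𝓝[>] 0) (𝓝 0)) : MonotoneOn (fun x => ‖G x‖ ^ 2) (Ioi 0) := by
  have hE : ∀ x, 0 < x → HasDerivAt (fun x => inner ℝ (M x) (G x))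
      (x ^ q * ‖M x‖ ^ 2 + x ^ p * ‖G x‖ ^ 2) x := fun x hx => by
    refine ((hM x hx).inner ℝ (hG x hx)).congr_deriv ?_
    rw [real_inner_smul_left, real_inner_smul_right, real_inner_self_eq_norm_sq,
      real_inner_self_eq_norm_sq]
  have hM2 : ∀ x, 0 < x → HasDerivAt (fun x => ‖M x‖ ^ 2) (2 * (x ^ p * inner ℝ (M x) (G x))) x :=
    fun x hx => by simpa only [real_inner_smul_right] using (hM x hx).norm_sq
  have hG2 : ∀ x, 0 < x → HasDerivAt (fun x => ‖G x‖ ^ 2) (2 * (x ^ q * inner ℝ (M x) (G x))) x :=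
    fun x hx => by
      simpa only [real_inner_smul_right, real_inner_comm] using (hG x hx).norm_sq
  have hmono : MonotoneOn (fun x => inner ℝ (M x) (G x)) (Ioi 0) := by
    refine monotoneOn_of_deriv_nonneg (convex_Ioi 0)
      (fun x hx => (hE x hx).continuousAt.continuousWithinAt) ?_ ?_ <;> rw [interior_Ioi]
    · exact fun x hx => (hE x hx).differentiableAt.differentiableWithinAt
    · intro x hx
      have hx' : (0 : ℝ) < x := hx
      rw [(hE x hx).deriv]
      positivity
  -- If ⟨M, G⟩ is negative at u, monotonicity keeps it negative on (0, u], so ‖M‖² decreases there.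
  -- Since M tends to 0 at 0, this forces M(u) = 0, a contradiction.
  have hnonneg : ∀ u, 0 < u → 0 ≤ inner ℝ (M u) (G u) := by
    intro u hu
    by_contra! hneg
    have hanti : AntitoneOn (fun x => ‖M x‖ ^ 2) (Ioc 0 u) := by
      refine antitoneOn_of_deriv_nonpos (convex_Ioc 0 u)
        (fun x hx => (hM2 x hx.1).continuousAt.continuousWithinAt) ?_ ?_ <;> rw [interior_Ioc]
      · exact fun x hx => (hM2 x hx.1).differentiableAt.differentiableWithinAt
      · intro x hx
        rw [(hM2 x hx.1).deriv]
        have h1 := hmono hx.1 hu hx.2.le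
        have h2 := Real.rpow_pos_of_pos hx.1 p
        have h3 := mul_nonpos_of_nonneg_of_nonpos h2.le (h1.trans hneg.le)
        linarith
    have hlim : Tendsto (fun x => ‖M x‖ ^ 2) (𝓝[>] 0) (𝓝 0) := by
      simpa using h0.norm.pow 2
    have hle : ‖M u‖ ^ 2 ≤ 0 := by
      refine ge_of_tendsto hlim ?_
      filter_upwards [Ioc_mem_nhdsGT hu] with x hx
      exact hanti hx ⟨hu, le_rfl⟩ hx.2
    have hMu : M u = 0 := by
      rw [← norm_eq_zero]
      exact pow_eq_zero_iff two_ne_zero |>.1 (le_antisymm hle (by positivity))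
    rw [hMu, inner_zero_left] at hneg
    exact lt_irrefl _ hneg
  refine monotoneOn_of_deriv_nonneg (convex_Ioi 0)
    (fun x hx => (hG2 x hx).continuousAt.continuousWithinAt) ?_ ?_ <;> rw [interior_Ioi]
  · exact fun x hx => (hG2 x hx).differentiableAt.differentiableWithinAt
  · intro x hx
    have hx' : (0 : ℝ) < x := hx
    rw [(hG2 x hx).deriv]
    have := hnonneg x hx
    positivity

variable {β d k n : ℝ}

/-- With G = x^(−k) f and M the primitive of x^β f, the equation Af = f is the cooperative system M′
= x^(β+k) G, G′ = x^(−1−d) M. So |G| is nondecreasing; if it were nonzero, x^(n+k) would be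
integrable at infinity, against n + k > −1. -/
theorem eq_zero_of_mem_primitiveGraph (hk : -1 < n + k) (hn : n ≤ β) {f : X n}
    (hf : (f, f) ∈ primitiveGraph k d hn) : f = 0 := by
  obtain ⟨c, hc⟩ := mem_primitiveGraph.1 hf
  set G : ℝ → ℂ := fun x => c + doublePrim β d f x with hG
  have hGd : ∀ x, 0 < x → HasDerivAt G (x ^ (-1 - d) • weightedPrim β f x) x := fun x hx =>
    (hasDerivAt_doublePrim hn f.integrable hx).const_add c
  have hi : Integrable (fun x => x ^ k • G x) (wMeasure n) := f.integrable.congr hc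
  have hMd : ∀ x, 0 < x → HasDerivAt (weightedPrim β f) (x ^ (β + k) • G x) x := by
    intro x hx
    have hcont : ContinuousOn (fun y => y ^ β • y ^ k • G y) (Ioi 0) := fun y hy =>
      ((Real.continuousAt_rpow_const y _ (Or.inl (ne_of_gt hy))).smul
        ((Real.continuousAt_rpow_const y _ (Or.inl (ne_of_gt hy))).smul
          (hGd y hy).continuousAt)).continuousWithinAt
    have h1 : HasDerivAt (weightedPrim β fun x => x ^ k • G x) (x ^ β • x ^ k • G x) x :=
      intervalIntegral.integral_hasDerivAt_right
        (intervalIntegrable_rpow_smul hn hi le_rfl hx.le)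
        (hcont.stronglyMeasurableAtFilter isOpen_Ioi x hx) (hcont.continuousAt (Ioi_mem_nhds hx))
    rw [smul_smul, ← Real.rpow_add hx] at h1
    refine h1.congr_of_eventuallyEq ?_
    filter_upwards [Ioi_mem_nhds hx] with y hy
    exact weightedPrim_congr (le_of_lt hy) (ae_eq_restrict hc)
  have hmono := monotoneOn_norm_sq_of_cooperative hMd hGd (tendsto_weightedPrim_zero hn f.integrable)
  have hG0 : ∀ v, 0 < v → G v = 0 := by
    intro v hv
    by_contra hne
    have hpos : 0 < ‖G v‖ := norm_pos_iff.2 hne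
    have h1 := (((integrable_wMeasure_iff n _).1 hi).mono_set (Ioi_subset_Ioi hv.le)).norm
    have h2 : IntegrableOn (fun x : ℝ => x ^ (n + k)) (Ioi v) := by
      refine (h1.const_mul ‖G v‖⁻¹).mono' (by fun_prop) ?_
      filter_upwards [ae_restrict_mem measurableSet_Ioi] with x hx
      have hx0 : 0 < x := hv.trans hx
      have h3 : ‖G v‖ ≤ ‖G x‖ :=
        (sq_le_sq₀ (norm_nonneg _) (norm_nonneg _)).1 (hmono hv hx0 (le_of_lt hx))
      rw [smul_smul, ← Real.rpow_add hx0, norm_smul, Real.norm_of_nonneg (by positivity),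
        mul_left_comm]
      refine le_mul_of_one_le_right (by positivity) ?_
      rwa [inv_mul_eq_div, one_le_div hpos]
    have := (integrableOn_Ioi_rpow_iff hv).1 h2
    linarith
  refine Lp.ext ?_
  filter_upwards [hc, Lp.coeFn_zero ℂ 1 (wMeasure n),
    ae_wMeasure_of_pos (m := n) (p := fun x => 0 < x) fun x hx => hx] with x h1 h2 hx
  have h3 : c + doublePrim β d f x = 0 := hG0 x hx
  rw [h1, h2, Pi.zero_apply, h3, smul_zero]

end Uniqueness

/-! ### Behaviour of the iterated primitive at the origin. -/

section DomainCondition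

/-- Tonelli's theorem on the triangle `0 < x < s ≤ 1`. -/
theorem lintegral_triangle {a b : ℝ → ENNReal} (ha : Measurable a) (hb : Measurable b) :
    ∫⁻ x in Ioc (0 : ℝ) 1, a x * ∫⁻ s in Ioc x 1, b s
      = ∫⁻ s in Ioc (0 : ℝ) 1, (∫⁻ x in Ioc 0 s, a x) * b s := by
  have h1 : ∀ x ∈ Ioc (0 : ℝ) 1, a x * ∫⁻ s in Ioc x 1, b s
      = ∫⁻ s in Ioc (0 : ℝ) 1, {p : ℝ × ℝ | p.1 < p.2}.indicator (fun p => a p.1 * b p.2) (x, s) := by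
    intro x hx
    rw [← lintegral_const_mul _ hb, ← inter_eq_self_of_subset_left
      (Ioc_subset_Ioc_left hx.1.le : Ioc x 1 ⊆ Ioc 0 1), ← setLIntegral_indicator measurableSet_Ioc]
    refine setLIntegral_congr_fun measurableSet_Ioc fun s hs => ?_
    by_cases hxs : x < s <;> simp [indicator, hxs, hs.2]
  have h2 : ∀ s ∈ Ioc (0 : ℝ) 1, (∫⁻ x in Ioc 0 s, a x) * b s
      = ∫⁻ x in Ioc (0 : ℝ) 1, {p : ℝ × ℝ | p.1 < p.2}.indicator (fun p => a p.1 * b p.2) (x, s) := by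
    intro s hs
    rw [← setLIntegral_congr Ioo_ae_eq_Ioc, ← lintegral_mul_const _ ha,
      ← inter_eq_self_of_subset_left
      ((Ioo_subset_Ioo_right hs.2).trans Ioo_subset_Ioc_self : Ioo 0 s ⊆ Ioc 0 1),
      ← setLIntegral_indicator measurableSet_Ioo]
    refine setLIntegral_congr_fun measurableSet_Ioc fun x hx => ?_
    by_cases hxs : x < s <;> simp [indicator, hxs, hx.1]
  rw [setLIntegral_congr_fun measurableSet_Ioc h1, setLIntegral_congr_fun measurableSet_Ioc h2]
  refine lintegral_lintegral_swap (Measurable.aemeasurable ?_)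
  exact Measurable.indicator (by fun_prop) (measurableSet_lt measurable_fst measurable_snd)

theorem lintegral_rpow_Ioc_zero {p : ℝ} (hp : -1 < p) {s : ℝ} (hs : 0 < s) :
    ∫⁻ x in Ioc 0 s, ENNReal.ofReal (x ^ p) = ENNReal.ofReal (s ^ (p + 1) / (p + 1)) := by
  rw [← ofReal_integral_eq_lintegral_ofReal, ← intervalIntegral.integral_of_le hs.le,
    integral_rpow (Or.inl hp), Real.zero_rpow (by linarith), sub_zero]
  · exact (intervalIntegrable_iff_integrableOn_Ioc_of_le hs.le).1
      (intervalIntegral.intervalIntegrable_rpow' hp)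
  · filter_upwards [ae_restrict_mem measurableSet_Ioc] with x hx
    exact Real.rpow_nonneg hx.1.le _

/-- For q < 0 compare with s^(q−1). At q = 0 this comparison diverges logarithmically, whence the
strict inequality there. -/
theorem exists_lintegral_rpow_le {e q : ℝ} (hq : q ≤ 0) (h : q - 1 ≤ e) (h' : q = 0 → q - 1 < e) :
    ∃ C : ℝ, 0 ≤ C ∧ ∀ y ∈ Ioc (0 : ℝ) 1,
      ∫⁻ s in Ioc y 1, ENNReal.ofReal (s ^ e) ≤ ENNReal.ofReal (C * y ^ q) := by
  rcases hq.eq_or_lt with hq0 | hq0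
  · have he : -1 < e := by linarith [h' hq0]
    refine ⟨1 / (e + 1), div_nonneg zero_le_one (by linarith), fun y hy => ?_⟩
    refine (lintegral_mono_set (Ioc_subset_Ioc_left hy.1.le)).trans_eq ?_
    rw [lintegral_rpow_Ioc_zero he one_pos, hq0, Real.rpow_zero, Real.one_rpow, mul_one]
  · refine ⟨1 / (-q), by
      rw [one_div, inv_nonneg]
      linarith, fun y hy => ?_⟩
    calc ∫⁻ s in Ioc y 1, ENNReal.ofReal (s ^ e)
        ≤ ∫⁻ s in Ioc y 1, ENNReal.ofReal (s ^ (q - 1)) := by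
          refine setLIntegral_mono' measurableSet_Ioc fun s hs => ENNReal.ofReal_le_ofReal ?_
          exact Real.rpow_le_rpow_of_exponent_ge (hy.1.trans hs.1) hs.2 h
      _ ≤ ∫⁻ s in Ioi y, ENNReal.ofReal (s ^ (q - 1)) := lintegral_mono_set Ioc_subset_Ioi_self
      _ = ENNReal.ofReal (1 / (-q) * y ^ q) := by
          rw [← ofReal_integral_eq_lintegral_ofReal
            (integrableOn_Ioi_rpow_of_lt (by linarith) hy.1),
            integral_Ioi_rpow_of_lt (by linarith) hy.1, sub_add_cancel]
          · congr 1
            field_simp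
          · filter_upwards [ae_restrict_mem measurableSet_Ioi] with x hx
            exact Real.rpow_nonneg (hy.1.trans hx).le _

variable {σ d k n r : ℝ}

theorem enorm_weightedPrim_le {β : ℝ} (g : ℝ → ℂ) {s : ℝ} (hs : 0 < s) :
    ‖weightedPrim β g s‖ₑ ≤ ∫⁻ y in Ioc 0 s, ENNReal.ofReal (y ^ β) * ‖g y‖ₑ := by
  rw [weightedPrim, intervalIntegral.integral_of_le hs.le]
  refine (enorm_integral_le_lintegral_enorm _).trans_eq ?_
  refine setLIntegral_congr_fun measurableSet_Ioc fun y hy => ?_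
  rw [enorm_smul, Real.enorm_of_nonneg (Real.rpow_nonneg hy.1.le _)]

theorem enorm_doublePrim_le {β : ℝ} (g : ℝ → ℂ) {x : ℝ} (hx : x ∈ Ioc (0 : ℝ) 1) :
    ‖doublePrim β d g x‖ₑ ≤ ∫⁻ s in Ioc x 1, ENNReal.ofReal (s ^ (-1 - d)) *
      ∫⁻ y in Ioc 0 s, ENNReal.ofReal (y ^ β) * ‖g y‖ₑ := by
  rw [doublePrim, intervalIntegral.integral_symm, enorm_neg,
    intervalIntegral.integral_of_le hx.2]
  refine (enorm_integral_le_lintegral_enorm _).trans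
    (setLIntegral_mono' measurableSet_Ioc fun s hs => ?_)
  have hs0 : 0 < s := hx.1.trans hs.1
  rw [enorm_smul, Real.enorm_of_nonneg (Real.rpow_nonneg hs0.le _)]
  exact mul_le_mul_right (enorm_weightedPrim_le g hs0) _

/-- Tonelli on the triangle, applied twice, moves all powers onto |g(y)|. The inner integral
converges since r + k > −1, and r ≥ n − σ is what bounds the resulting weight by y^n. -/
theorem lintegral_doublePrim_lt_top (hn : n ≤ σ - 1 + d - k) (hr : -1 < r + k) (hrn : n - σ ≤ r)
    (hrn' : n = σ - 1 + d - k → n - σ < r) (g : X n) :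
    ∫⁻ x in Ioc (0 : ℝ) 1, ENNReal.ofReal (x ^ (r + k)) * ‖doublePrim (σ - 1 + d - k) d g x‖ₑ
      < ⊤ := by
  set β : ℝ := σ - 1 + d - k with hβ
  have hg : Measurable fun y => ENNReal.ofReal (y ^ β) * ‖g y‖ₑ :=
    (by fun_prop : Measurable fun y : ℝ => ENNReal.ofReal (y ^ β)).mul
      (Lp.stronglyMeasurable g).measurable.enorm
  have hm : Measurable fun s : ℝ => ∫⁻ y in Ioc 0 s, ENNReal.ofReal (y ^ β) * ‖g y‖ₑ := by
    refine Monotone.measurable fun s t hst => lintegral_mono_set (Ioc_subset_Ioc_right hst)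
  obtain ⟨C, hC0, hC⟩ := exists_lintegral_rpow_le (e := r + k - d) (q := n - β) (by linarith)
    (by rw [hβ]; linarith) (fun h => by
      have := hrn' (by linarith)
      rw [hβ]
      linarith)
  calc _ ≤ ∫⁻ x in Ioc (0 : ℝ) 1, ENNReal.ofReal (x ^ (r + k)) *
        ∫⁻ s in Ioc x 1, ENNReal.ofReal (s ^ (-1 - d)) *
          ∫⁻ y in Ioc 0 s, ENNReal.ofReal (y ^ β) * ‖g y‖ₑ :=
        setLIntegral_mono' measurableSet_Ioc fun x hx =>
          mul_le_mul_right (enorm_doublePrim_le g hx) _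
    _ = ∫⁻ s in Ioc (0 : ℝ) 1, (∫⁻ x in Ioc 0 s, ENNReal.ofReal (x ^ (r + k))) *
        (ENNReal.ofReal (s ^ (-1 - d)) *
          ∫⁻ y in Ioc 0 s, ENNReal.ofReal (y ^ β) * ‖g y‖ₑ) :=
        lintegral_triangle (by fun_prop) (Measurable.mul (by fun_prop) hm)
    _ = ∫⁻ s in Ioc (0 : ℝ) 1, ENNReal.ofReal (1 / (r + k + 1)) *
        ((∫⁻ y in Ioc 0 s, ENNReal.ofReal (y ^ β) * ‖g y‖ₑ) *
          ENNReal.ofReal (s ^ (r + k - d))) := by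
        refine setLIntegral_congr_fun measurableSet_Ioc fun s hs => ?_
        have hs0 : 0 < s := hs.1
        rw [lintegral_rpow_Ioc_zero hr hs0, ← mul_assoc, ← ENNReal.ofReal_mul (by
          have : 0 < r + k + 1 := by linarith
          positivity), mul_comm (∫⁻ y in Ioc 0 s, ENNReal.ofReal (y ^ β) * ‖g y‖ₑ),
          ← mul_assoc, ← ENNReal.ofReal_mul (div_nonneg zero_le_one (by linarith))]
        have e : s ^ (r + k + 1) * s ^ (-1 - d) = s ^ (r + k - d) := by
          rw [← Real.rpow_add hs0]
          congr 1
          ring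
        rw [← e, div_mul_eq_mul_div, one_div_mul_eq_div]
    _ = ENNReal.ofReal (1 / (r + k + 1)) * ∫⁻ s in Ioc (0 : ℝ) 1,
        ((∫⁻ y in Ioc 0 s, ENNReal.ofReal (y ^ β) * ‖g y‖ₑ) *
          ENNReal.ofReal (s ^ (r + k - d))) :=
        lintegral_const_mul _ (hm.mul (by fun_prop))
    _ = ENNReal.ofReal (1 / (r + k + 1)) * ∫⁻ y in Ioc (0 : ℝ) 1,
        (ENNReal.ofReal (y ^ β) * ‖g y‖ₑ) * ∫⁻ s in Ioc y 1, ENNReal.ofReal (s ^ (r + k - d)) := by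
        rw [lintegral_triangle hg (by fun_prop)]
    _ ≤ ENNReal.ofReal (1 / (r + k + 1)) * ∫⁻ y in Ioc (0 : ℝ) 1,
        ENNReal.ofReal C * (ENNReal.ofReal (y ^ n) * ‖g y‖ₑ) := by
        refine mul_le_mul_right (setLIntegral_mono' measurableSet_Ioc fun y hy => ?_) _
        refine (mul_le_mul_right (hC y hy) _).trans_eq ?_
        have hy0 : 0 < y := hy.1
        rw [ENNReal.ofReal_mul hC0, show y ^ n = y ^ β * y ^ (n - β) by
          rw [← Real.rpow_add hy0, add_sub_cancel], ENNReal.ofReal_mul (by positivity)]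
        ring
    _ ≤ ENNReal.ofReal (1 / (r + k + 1)) * (ENNReal.ofReal C *
        ∫⁻ y in Ioi (0 : ℝ), (ENNReal.ofReal (y ^ n) * ‖g y‖ₑ)) := by
        refine mul_le_mul_right ?_ _
        rw [lintegral_const_mul' _ _ ENNReal.ofReal_ne_top]
        exact mul_le_mul_right (lintegral_mono_set Ioc_subset_Ioi_self) _
    _ < ⊤ := by
        rw [← lintegral_wMeasure]
        exact ENNReal.mul_lt_top ENNReal.ofReal_lt_top
          (ENNReal.mul_lt_top ENNReal.ofReal_lt_top g.integrable.2)

theorem integrableOn_rpow_smul_doublePrim (hn : n ≤ σ - 1 + d - k) (hr : -1 < r + k)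
    (hrn : n - σ ≤ r) (hrn' : n = σ - 1 + d - k → n - σ < r) (g : X n) (c : ℂ) :
    IntegrableOn (fun x : ℝ => x ^ r • x ^ k • (c + doublePrim (σ - 1 + d - k) d g x))
      (Ioc 0 1) := by
  have h1 : IntegrableOn (fun x : ℝ => x ^ (r + k)) (Ioc 0 1) :=
    (intervalIntegrable_iff_integrableOn_Ioc_of_le zero_le_one).1
      (intervalIntegral.intervalIntegrable_rpow' hr)
  have h2 : IntegrableOn (fun x : ℝ => x ^ (r + k) • doublePrim (σ - 1 + d - k) d g x)
      (Ioc 0 1) := by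
    constructor
    · refine (ContinuousOn.aestronglyMeasurable (fun x hx => ?_) measurableSet_Ioc)
      exact ((Real.continuousAt_rpow_const x _ (Or.inl hx.1.ne')).smul
        (hasDerivAt_doublePrim hn g.integrable hx.1).continuousAt).continuousWithinAt
    · refine (setLIntegral_congr_fun measurableSet_Ioc fun x hx => ?_).trans_lt
        (lintegral_doublePrim_lt_top hn hr hrn hrn' g)
      rw [enorm_smul, Real.enorm_of_nonneg (Real.rpow_nonneg hx.1.le _)]
  refine IntegrableOn.congr_fun (Integrable.add (h1.smul_const c) h2) (fun x hx => ?_)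
    measurableSet_Ioc
  rw [Pi.add_apply, ← smul_add, smul_smul, ← Real.rpow_add hx.1]

/-- A regular solution is o(x^(k−d)) at 0, because its flux tends to 0. This is the limit condition
in (c3). -/
theorem tendsto_rpow_smul_doublePrim_zero {β : ℝ} (hd : 0 < d) (hn : n ≤ β) {g : ℝ → ℂ}
    (hg : Integrable g (wMeasure n)) (c : ℂ) :
    Tendsto (fun x : ℝ => x ^ d • (c + doublePrim β d g x)) (𝓝[>] 0) (𝓝 0) := by
  have hpow : Tendsto (fun x : ℝ => x ^ d) (𝓝[>] 0) (𝓝 0) := by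
    have := (Real.continuous_rpow_const hd.le).tendsto 0
    rw [Real.zero_rpow hd.ne'] at this
    exact this.mono_left nhdsWithin_le_nhds
  rw [Metric.tendsto_nhds]
  intro ε hε
  -- Below δ the flux is smaller than εd/2, and ∫ₓ^δ s^(−1−d) ds ≤ x^(−d)/d, so that part
  -- contributes at most ε/2; the value at δ is killed by x^d.
  have hM := (tendsto_zero_iff_norm_tendsto_zero.1
    (tendsto_weightedPrim_zero hn hg)).eventually_lt_const (by positivity : 0 < ε / 2 * d)
  obtain ⟨δ, hδ0, hδ⟩ := mem_nhdsGT_iff_exists_Ioc_subset.1 hM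
  have hδ0' : (0 : ℝ) < δ := hδ0
  have h2 : Tendsto (fun x : ℝ => x ^ d * ‖c + doublePrim β d g δ‖) (𝓝[>] 0) (𝓝 0) := by
    simpa using hpow.mul_const ‖c + doublePrim β d g δ‖
  filter_upwards [h2.eventually_lt_const (half_pos hε), Ioc_mem_nhdsGT hδ0'] with x hx hxδ
  have hx0 : 0 < x := hxδ.1
  have h3 : ‖doublePrim β d g δ - doublePrim β d g x‖ ≤ ε / 2 * x ^ (-d) := by
    rw [doublePrim_sub_doublePrim hn hg hx0 hδ0']
    have hi : IntervalIntegrable (fun s : ℝ => ε / 2 * d * s ^ (-1 - d)) volume x δ := by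
      refine ContinuousOn.intervalIntegrable fun s hs => ?_
      have hs0 : 0 < s := (lt_min hx0 hδ0').trans_le hs.1
      exact (continuousAt_const.mul
        (Real.continuousAt_rpow_const s _ (Or.inl hs0.ne'))).continuousWithinAt
    refine (intervalIntegral.norm_integral_le_of_norm_le hxδ.2 ?_ hi).trans ?_
    · refine Eventually.of_forall fun s hs => ?_
      have hs0 : 0 < s := hx0.trans hs.1
      have h4 : ‖weightedPrim β g s‖ < ε / 2 * d := hδ ⟨hs0, hs.2⟩
      rw [norm_smul, Real.norm_of_nonneg (by positivity), mul_comm]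
      exact mul_le_mul_of_nonneg_right h4.le (by positivity)
    · rw [intervalIntegral.integral_const_mul, integral_rpow (Or.inr ⟨by linarith,
        fun h => not_lt.2 h.1 (lt_min hx0 hδ0')⟩), show -1 - d + 1 = -d by ring]
      have h5 : 0 < δ ^ (-d) := by positivity
      have h6 : ε / 2 * d * ((δ ^ (-d) - x ^ (-d)) / -d) = ε / 2 * (x ^ (-d) - δ ^ (-d)) := by
        field_simp
        ring
      rw [h6]
      exact mul_le_mul_of_nonneg_left (by linarith) (by positivity)
  rw [dist_zero_right, norm_smul, Real.norm_of_nonneg (by positivity)]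
  have h7 : ‖c + doublePrim β d g x‖ ≤ ‖c + doublePrim β d g δ‖ + ε / 2 * x ^ (-d) := by
    have h8 : c + doublePrim β d g x = (c + doublePrim β d g δ)
        - (doublePrim β d g δ - doublePrim β d g x) := by ring
    rw [h8]
    exact (norm_sub_le _ _).trans (add_le_add le_rfl h3)
  have h9 : x ^ d * x ^ (-d) = 1 := by rw [← Real.rpow_add hx0, add_neg_cancel, Real.rpow_zero]
  calc x ^ d * ‖c + doublePrim β d g x‖
      ≤ x ^ d * (‖c + doublePrim β d g δ‖ + ε / 2 * x ^ (-d)) := by gcongr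
    _ = x ^ d * ‖c + doublePrim β d g δ‖ + ε / 2 * (x ^ d * x ^ (-d)) := by ring
    _ < ε / 2 + ε / 2 * 1 := by rw [h9]; linarith
    _ = ε := by ring

end DomainCondition

/-! ### Matching the domain conditions with regular solutions. -/

section Domain

variable {σ d k n r : ℝ}

theorem sqrt_disc_eq (hd : 0 < d) : √(disc (1 + d - 2 * k) (k * (k - d))) = d := by
  rw [disc, show (1 + d - 2 * k - 1) ^ 2 - 4 * (k * (k - d)) = d ^ 2 by ring, Real.sqrt_sq hd.le]

theorem nStar_eq (hd : 0 < d) : nStar (1 + d - 2 * k) (k * (k - d)) = -1 - k := by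
  rw [nStar, sqrt_disc_eq hd]
  ring

theorem nStarMinus_eq (hd : 0 < d) :
    nStarMinus (2 - σ) (1 + d - 2 * k) (k * (k - d)) = σ - 1 - k := by
  rw [nStarMinus, sqrt_disc_eq hd]
  ring

theorem nStarPlus_eq (hd : 0 < d) :
    nStarPlus (2 - σ) (1 + d - 2 * k) (k * (k - d)) = σ - 1 + d - k := by
  rw [nStarPlus, sqrt_disc_eq hd]
  ring

/-- Near 0 the representation is used; on (1, ∞) membership in X_n suffices since r ≤ n. -/
theorem integrable_of_eq_doublePrim (hn : n ≤ σ - 1 + d - k) (hr : -1 < r + k) (hrn : n - σ ≤ r)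
    (hrn' : n = σ - 1 + d - k → n - σ < r) (hr_le : r ≤ n) {f g : X n} {c : ℂ}
    (h : f =ᵐ[wMeasure n] fun x => x ^ k • (c + doublePrim (σ - 1 + d - k) d g x)) :
    Integrable f (wMeasure r) := by
  rw [integrable_wMeasure_iff, ← Ioc_union_Ioi_eq_Ioi zero_le_one]
  have hf := (integrable_wMeasure_iff n _).1 f.integrable
  refine IntegrableOn.union ?_ ?_
  · refine (integrableOn_rpow_smul_doublePrim hn hr hrn hrn' g c).congr ?_
    filter_upwards [ae_restrict_of_ae_restrict_of_subset Ioc_subset_Ioi_self (ae_eq_restrict h)]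
      with x hx
    rw [hx]
  · have hf1 := hf.mono_set (Ioi_subset_Ioi zero_le_one)
    refine Integrable.mono hf1 ?_ ?_
    · have h1 : AEStronglyMeasurable (fun x : ℝ => x ^ (r - n) • (x ^ n • f x))
          (volume.restrict (Ioi 1)) :=
        (by fun_prop : Measurable fun x : ℝ => x ^ (r - n)).aestronglyMeasurable.smul
          hf1.aestronglyMeasurable
      refine h1.congr ?_
      filter_upwards [ae_restrict_mem measurableSet_Ioi] with x hx
      rw [smul_smul, ← Real.rpow_add (one_pos.trans hx), sub_add_cancel]
    · filter_upwards [ae_restrict_mem measurableSet_Ioi] with x hx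
      have hx1 : (1 : ℝ) < x := hx
      rw [norm_smul, norm_smul, Real.norm_of_nonneg (by positivity),
        Real.norm_of_nonneg (by positivity)]
      exact mul_le_mul_of_nonneg_right (Real.rpow_le_rpow_of_exponent_le hx1.le hr_le)
        (norm_nonneg _)

theorem continuousOn_rpow_smul_doublePrim {β : ℝ} (hn : n ≤ β) {g : ℝ → ℂ}
    (hg : Integrable g (wMeasure n)) (c : ℂ) :
    ContinuousOn (fun x : ℝ => x ^ k • (c + doublePrim β d g x)) (Ioi 0) := fun x hx =>
  ((Real.continuousAt_rpow_const x _ (Or.inl (ne_of_gt hx))).smul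
    (continuousAt_const.add (hasDerivAt_doublePrim hn hg hx).continuousAt)).continuousWithinAt

theorem domainCond_of_mem_primitiveGraph (hd : 0 < d)
    (hn : n ≤ σ - 1 + d - k) {p : X n × X n} (hp : p ∈ primitiveGraph k d hn) :
    DomainCond (2 - σ) (1 + d - 2 * k) (k * (k - d)) n p.1 := by
  obtain ⟨c, hc⟩ := mem_primitiveGraph.1 hp
  constructor
  · rw [nStarMinus_eq hd, nStar_eq hd]
    intro h1 r hr
    have h2 := hr.1
    exact integrable_of_eq_doublePrim hn (by linarith) (by linarith) (fun _ => by linarith) hr.2 hc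
  · rw [nStarMinus_eq hd, nStarPlus_eq hd]
    intro h1 h2 r hr
    have h3 := hr.1
    exact integrable_of_eq_doublePrim hn (by linarith) (by linarith) (fun h => by linarith) hr.2 hc
  · rw [nStarPlus_eq hd, sqrt_disc_eq hd]
    intro h1
    refine ⟨fun r hr => ?_, _, continuousOn_rpow_smul_doublePrim hn p.2.integrable c,
      ae_eq_restrict hc, ?_⟩
    · have h3 := hr.1
      exact integrable_of_eq_doublePrim hn (by linarith) (by linarith) (fun _ => by linarith)
        hr.2 hc
    · refine (tendsto_rpow_smul_doublePrim_zero hd hn p.2.integrable c).congr' ?_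
      filter_upwards [self_mem_nhdsWithin] with x hx
      rw [smul_smul, ← Real.rpow_add hx]
      congr 2
      ring

/-- The regular part is in X_r near 0, so the singular part B x^(k−d) would be too; but r + k − d ≤
−1 makes it non-integrable. -/
theorem eq_zero_of_integrable_singular (hn : n ≤ σ - 1 + d - k) (hr : -1 < r + k)
    (hrn : n - σ ≤ r) (hrn' : n = σ - 1 + d - k → n - σ < r) (hrd : r + k - d ≤ -1)
    {f : ℝ → ℂ} (hf : Integrable f (wMeasure r)) (g : X n) {c B : ℂ}
    (h : f =ᵐ[wMeasure n]
      fun x => x ^ k • (c + doublePrim (σ - 1 + d - k) d g x + x ^ (-d) • B)) : B = 0 := by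
  by_contra hB
  have h1 := ((integrable_wMeasure_iff r f).1 hf).mono_set
    (Ioc_subset_Ioi_self : Ioc (0 : ℝ) 1 ⊆ Ioi 0)
  have h2 := integrableOn_rpow_smul_doublePrim hn hr hrn hrn' g c
  have h3 : IntegrableOn (fun x : ℝ => x ^ (r + k - d)) (Ioc 0 1) := by
    refine ((h1.sub h2).norm.const_mul ‖B‖⁻¹).congr ?_
    filter_upwards [ae_restrict_of_ae_restrict_of_subset Ioc_subset_Ioi_self (ae_eq_restrict h),
      ae_restrict_mem measurableSet_Ioc] with x hx hx0
    rw [Pi.sub_apply, hx, ← smul_sub, ← smul_sub, add_sub_cancel_left, smul_smul, smul_smul,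
      ← Real.rpow_add hx0.1, ← Real.rpow_add hx0.1, norm_smul,
      Real.norm_of_nonneg (Real.rpow_nonneg hx0.1.le _), mul_comm, mul_assoc,
      mul_inv_cancel₀ (norm_ne_zero_iff.2 hB), mul_one]
    rfl
  have h4 := h3.mono_set Ioo_subset_Ioc_self
  have := (intervalIntegral.integrableOn_Ioo_rpow_iff one_pos).1 h4
  linarith

theorem mem_primitiveGraph_of_mem_operatorGraph (hσ : 0 < σ) (hd : 0 < d) (hk : -1 < n + k)
    (hn : n ≤ σ - 1 + d - k) {p : X n × X n}
    (hp : p ∈ operatorGraph (2 - σ) (1 + d - 2 * k) (k * (k - d)) n) :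
    p ∈ primitiveGraph k d hn := by
  obtain ⟨hdom, hdist⟩ := hp
  obtain ⟨c, B, hcB⟩ := hdist.exists_ae_eq hd hn p.1.integrable p.2.integrable
  have hB : B = 0 := by
    rcases le_or_gt n (σ - 1 - k) with h1 | h1
    · have h2 := hdom.case1 (by rwa [nStarMinus_eq hd]) (min n (d - k - 1))
        ⟨by rw [nStar_eq hd]; exact lt_min (by linarith) (by linarith), min_le_left _ _⟩
      have h3 : -1 - k < min n (d - k - 1) := lt_min (by linarith) (by linarith)
      exact eq_zero_of_integrable_singular hn (by linarith) (by linarith) (fun _ => by linarith)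
        (by linarith [min_le_right n (d - k - 1)]) h2 p.2 hcB
    rcases hn.lt_or_eq with h2 | h2
    · have h3 := hdom.case2 (by rwa [nStarMinus_eq hd]) (by rwa [nStarPlus_eq hd]) (n - σ)
        ⟨by linarith, by linarith⟩
      exact eq_zero_of_integrable_singular hn (by linarith) le_rfl (fun _ => by linarith)
        (by linarith) h3 p.2 hcB
    -- Integrability for r > n − σ no longer detects B, since r + k − d > −1. The weight in the
    -- limit condition is x^(d−k), and the weighted function tends to B.
    · have h3 := (hdom.case3 (by rwa [nStarPlus_eq hd])).2
      rw [sqrt_disc_eq hd] at h3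
      obtain ⟨h, hh, hph, hlim⟩ := h3
      have hc' : ContinuousOn (fun x : ℝ =>
          x ^ k • (c + doublePrim (σ - 1 + d - k) d p.2 x + x ^ (-d) • B)) (Ioi 0) := fun x hx =>
        ((Real.continuousAt_rpow_const x _ (Or.inl (ne_of_gt hx))).smul
          ((continuousAt_const.add (hasDerivAt_doublePrim hn p.2.integrable hx).continuousAt).add
          ((Real.continuousAt_rpow_const x _ (Or.inl (ne_of_gt hx))).smul
            continuousAt_const))).continuousWithinAt
      have heq := Measure.eqOn_open_of_ae_eq (hph.symm.trans (ae_eq_restrict hcB)) isOpen_Ioi hh hc'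
      have hlim' := (tendsto_rpow_smul_doublePrim_zero hd hn p.2.integrable c).add_const B
      rw [zero_add] at hlim'
      refine tendsto_nhds_unique hlim' (hlim.congr' ?_)
      filter_upwards [self_mem_nhdsWithin] with x hx
      rw [heq hx, smul_smul, ← Real.rpow_add hx, smul_add, smul_smul _ (x ^ (-d)),
        ← Real.rpow_add hx, show (1 + d - 2 * k + d - 1) / 2 + k = d by ring, add_neg_cancel,
        Real.rpow_zero, one_smul]
  refine mem_primitiveGraph.2 ⟨c, ?_⟩
  simpa [hB] using hcB

theorem operatorGraph_eq_primitiveGraph (hσ : 0 < σ) (hd : 0 < d) (hk : -1 < n + k)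
    (hn : n ≤ σ - 1 + d - k) :
    operatorGraph (2 - σ) (1 + d - 2 * k) (k * (k - d)) n = primitiveGraph k d hn :=
  le_antisymm (fun _ hp => mem_primitiveGraph_of_mem_operatorGraph hσ hd hk hn hp)
    fun _ hp => ⟨domainCond_of_mem_primitiveGraph hd hn hp,
      hasDistribOp_of_mem_primitiveGraph hn hp⟩

/-- The main result in terms of the exponents of the equation. -/
theorem exists_semigroup (hσ : 0 < σ) (hd : 0 < d) (hk : -1 < n + k) (hn : n ≤ σ - 1 + d - k) :
    ∃ T : ℂ → X n →L[ℂ] X n, IsBoundedAnalyticSemigroup (Real.pi / 2) T ∧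
      (∀ t : ℝ, 0 ≤ t → IsPositiveOp (T (t : ℂ))) ∧
      generator T = operator (2 - σ) (1 + d - 2 * k) (k * (k - d)) n ∧
      (σ - 1 - k ≤ n → ∀ t : ℝ, 0 ≤ t → ‖T (t : ℂ)‖ ≤ 1) := by
  obtain ⟨T, hT, hpos, hcontr, htrans⟩ := exists_translation_semigroup hσ hd hk hn
  refine ⟨T, hT, hpos, ?_, hcontr⟩
  rw [generator, operator, operatorGraph_eq_primitiveGraph hσ hd hk hn]
  congr 1
  refine hT.generatorGraph_eq ?_ fun f hf => eq_zero_of_mem_primitiveGraph hk hn hf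
  exact hT.generatorGraph_le htrans (dense_span_curve hσ hd hk) (isClosed_primitiveGraph hn)
    (fun w hw => hasDerivAt_curve hσ hd hk hw)
    (fun w hw => curve_mem_primitiveGraph hσ hd hk hn hw)

end Domain

end SingularOp

end

/-- Only the passage to σ, d, k remains: k and k − d are the roots of the indicial equation r² + (a
− 1)r + b = 0. The contraction bound is available at n = n_*^- as well. -/
theorem theorem1p2 (α a b n : ℝ) (hα : α < 2) (hD : 0 < SingularOp.disc a b)
    (hn₁ : SingularOp.nStar a b < n) (hn₂ : n ≤ SingularOp.nStarPlus α a b) :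
    ∃ T : ℂ → SingularOp.X n →L[ℂ] SingularOp.X n,
      SingularOp.IsBoundedAnalyticSemigroup (Real.pi / 2) T ∧
      (∀ t : ℝ, 0 ≤ t → SingularOp.IsPositiveOp (T (t : ℂ))) ∧
      SingularOp.generator T = SingularOp.operator α a b n ∧
      (SingularOp.nStarMinus α a b < n → ∀ t : ℝ, 0 ≤ t → ‖T (t : ℂ)‖ ≤ 1) := by
  obtain ⟨d, hd, hd2⟩ : ∃ d : ℝ, 0 < d ∧ d ^ 2 = SingularOp.disc a b :=
    ⟨√(SingularOp.disc a b), Real.sqrt_pos.2 hD, Real.sq_sqrt hD.le⟩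
  obtain ⟨σ, rfl⟩ : ∃ σ, α = 2 - σ := ⟨2 - α, by ring⟩
  obtain ⟨k, rfl⟩ : ∃ k, a = 1 + d - 2 * k := ⟨(1 + d - a) / 2, by ring⟩
  obtain rfl : b = k * (k - d) := by
    rw [SingularOp.disc] at hd2
    linarith
  rw [SingularOp.nStar_eq hd] at hn₁
  rw [SingularOp.nStarPlus_eq hd] at hn₂
  rw [SingularOp.nStarMinus_eq hd]
  obtain ⟨T, h1, h2, h3, h4⟩ := SingularOp.exists_semigroup (σ := σ) (d := d) (k := k) (n := n)
    (by linarith) hd (by linarith) hn₂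
  exact ⟨T, h1, h2, h3, fun h => h4 h.le⟩
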